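/- **Setting.** A join query consists of a finite attribute set $\mathcal A$ and relations $R_1,\dots,R_m$ with schemas $\mathrm{attr}(R_i)\subseteq\mathcal A$ that cover $\mathcal A$; an input consists of nonempty finite relations. $\bowtie_i R_i$ is the set of tuples $t$ over $\mathcal A$ with $\pi_{\mathrm{attr}(R_i)}(t)\in R_i$ for all $i$; $\mathrm{IN}=\sum_i|R_i|$ and $\mathrm{OUT}=|\bowtie_i R_i|$. $\tilde O(f)$ means at most $C\log^k(\mathrm{IN}+2)\cdot f$ with $C,k$ depending on the query (and below on $K$ or the fixed sequence of transforms) but not on the data. Steps are counted with unit cost per tuple: projections, selections, intersections and building an index cost one step per tuple scanned; a join is evaluated by an indexed nested loop that costs one step per index lookup, per matching row visited and per tuple emitted. Choosing transforms and solving linear programs whose size depends only on the query is not charged. *Degrees.* $\deg(v,R,A)=|\{t\in R:\pi_A(t)=v\}|$, $d_{R,A}=\max_v\deg(v,R,A)$. A degree configuration $c$ assigns to every relation $R$ and $A\subseteq\mathrm{attr}(R)$ a bucket index $c(R,A)\in\mathbb N$ (for the bucket $[2^l,2^{l+1})$), antitone in $A$, with $c(R,\mathrm{attr}(R))=0$ and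 $c(R,\emptyset)=\lfloor\log_2|R|\rfloor$; $R(c)$ is the set of $t\in R$ with all $\deg(\pi_A(t),R,A)$ in the prescribed buckets. *DBP.* For a cover $C$ of $X$, i.e. a set of pairs $(R,A)$ with $A\subseteq\mathrm{attr}(R)\cap X$ and $\bigcup_C A=X$, let $O_C$ be the minimum of $\sum_{a\in X}v_a$ subject to $\sum_{a\in A'}v_a\ge\log(d_{\pi_A(R),A\setminus A'}/2)$ for all $(R,A)\in C$, $A'\subseteq A$ (logarithms to base $\mathrm{IN}$). $\mathrm{DBP}(\mathcal R,X)=\min_C O_C$, and $\mathrm{DBP}(\mathcal R)=\mathrm{DBP}(\mathcal R,\mathcal A)$. *Transforms*, on a problem $\pi_{\mathcal O}(\bowtie_{R\in\mathcal R}R)$. **Heavy** on an attribute $X$: for each value $x$ of $X$ that lies in all relations containing $X$, solve the problem with $X=x$ selected and projected out; return the union of the results, each combined with $x$ if $X\in\mathcal O$. **Light** on a set $X$: compute $R_X=\bowtie_{R\in\mathcal R}\pi_X R$ by joining the $\pi_A(R)$, $(R,A)\in C$, for a cover $C$ with minimal $O_C$, filtering with all $\pi_X(R)$; replace the relations with schema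 inside $X$ by $R_X$. **Split** on a set $S$, with $\mathcal R\subseteq G_1\cup G_2$ where attributes common to $G_1$ and $G_2$ lie in $S\subseteq\mathrm{attr}(G_1)$: compute $R_S=\pi_S(\bowtie G_1)$. If $\mathcal O\subseteq\mathrm{attr}(G_2)$, return $\pi_{\mathcal O}(\bowtie (G_2\cup\{R_S\}))$. If $S\subseteq\mathcal O$, compute $O_2=\pi_{\mathcal O}(\bowtie (G_2\cup\{R_S\}))$, $R_S'=R_S\cap\pi_S(O_2)$, $O_1=\pi_{\mathcal O}(\bowtie(G_1\cup\{R'_S\}))$, and return $R'_S\bowtie O_1\bowtie O_2$. Subproblems are solved recursively until one relation is left. An applicable sequence of transforms is a finite tree of transforms whose input conditions hold and which ends in single relations. *DARTS* (with parameter $K$, the constant in front of $\mathrm{OUT}$) computes degrees, forms all configurations $c$ and all $R(c)$, processes each configuration with no empty $R(c)$ by an applicable sequence of transforms, with $\mathcal O=\mathcal A$, and returns the union of the results. The sequence is chosen from a given repertoire, depending on the query and $c$ only, so that it gives the smallest upper bound on $Q$: the least $x$ such that on every input with configuration $c$ the sequence takes at most $x+K\cdot\mathrm{OUT}$ steps (for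 that configuration's join). *Widths.* A fractional cover of $X$ is $w\ge0$ with $\sum_{R\ni a}w_R\ge1$ for all $a\in X$. $\mathrm{AGM}(X)=\inf_w\prod_R|R|^{w_R}$ and $\rho^*(X)=\inf_w\sum_R w_R$ over fractional covers $w$ of $X$. A GHD is a finite tree with bags $\chi(t)\subseteq\mathcal A$ such that each schema is contained in a bag and, for each attribute, the nodes whose bags contain it form a connected subtree. $\mathrm{fhw}=\min_{\mathrm{GHD}}\max_t\rho^*(\chi(t))$; the size-aware version is $\mathrm{fhw}_I=\min_{\mathrm{GHD}}\max_t\log_{\mathrm{IN}}\mathrm{AGM}(\chi(t))$. A query is $\alpha$-acyclic if it has a join tree on its relations (for each attribute, the relations containing it form a connected subtree). **Theorem.** For every join query: 1. There is $K_0$ such that for every $K\ge K_0$ and every repertoire containing all combinations of Split and Light transforms (for example only these, or all transforms), DARTS outputs the join and takes $$\tilde O(\mathrm{IN}^{\mathrm{fhw}}+\mathrm{OUT})\quad\text{and also}\quad\tilde O(\mathrm{IN}+\mathrm{IN}^{\mathrm{fhw}_I}+\mathrm{OUT})$$ steps, with constants independent of the repertoire. 2. If the query is $\alpha$-acyclic,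 then Split can be applied repeatedly, with $G_1$ an ear $R_1$ each time and $S=\mathrm{attr}(R_1)\cap\mathrm{attr}(R_2)$, where $R_2\ne R_1$ is a relation containing every attribute of $R_1$ that occurs in another relation (and with $R_S$, $R'_S$ absorbed into the containing relation $R_2$, $R_1$ by a Light transform on its schema), until one relation is left. For every such sequence, processing each degree configuration by it outputs the join in $\tilde O(\mathrm{IN}+\mathrm{OUT})$ steps. 3. For every degree configuration $c$ with no empty $R(c)$, the cost bound $\mathrm{IN}^{\mathrm{DBP}(\mathcal R(c))}$ of a single Light transform on $\mathcal A$ is at most $\mathrm{AGM}(\mathcal A)$, the AGM bound of the input; and processing each configuration by this single Light transform outputs the join in $\tilde O(\mathrm{IN}+\mathrm{AGM}(\mathcal A))$ steps in total. -/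

import Mathlib

/-! ## Tuples, relations, and the unit-cost evaluation primitive -/

/-- A tuple over the attributes `V` with values in `D`; `none` marks attributes outside its schema. -/
abbrev Tup (V D : Type*) := V → Option D

/-- A relation: its schema (set of attributes) and its finite set of tuples. -/
structure Table (V D : Type*) where
  schema : Finset V
  rows : Finset (Tup V D)

section Relations

variable {V D : Type*} [Fintype V] [DecidableEq V] [DecidableEq D]

/-- `π_A(t)`. -/
def restrict (A : Finset V) (t : Tup V D) : Tup V D := fun a => if a ∈ A then t a else none

/-- Two tuples agree on all attributes that both of them have. -/
def Compat (t r : Tup V D) : Prop := ∀ a, t a = none ∨ r a = none ∨ t a = r a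

instance (t r : Tup V D) : Decidable (Compat t r) := by unfold Compat; infer_instance

/-- The tuple with the attributes of both `t` and `r` (used for compatible tuples). -/
def merge (t r : Tup V D) : Tup V D := fun a => (t a).or (r a)

/-- The tuple without attributes. -/
def emptyTup : Tup V D := fun _ => none

/-- `π_A(R)`. -/
def Table.proj (A : Finset V) (R : Table V D) : Table V D :=
  ⟨R.schema ∩ A, R.rows.image (restrict A)⟩

/-- `deg(v, R, A)`: the number of tuples of `R` whose projection to `A` is `v`. -/
def deg (v : Tup V D) (R : Finset (Tup V D)) (A : Finset V) : ℕ :=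
  (R.filter fun t => restrict A t = v).card

/-- `d_{R,A}`: the maximal degree in `R` of a value of `A`. -/
def maxDeg (R : Table V D) (A : Finset V) : ℕ :=
  R.rows.sup fun t => deg (restrict A t) R.rows A

/-- Total number of tuples of a list of relations. -/
def tableSize (Rs : List (Table V D)) : ℕ := (Rs.map fun R => R.rows.card).sum

/-- Union of a list of schemas. -/
def unionAll (l : List (Finset V)) : Finset V := l.foldr (· ∪ ·) ∅

/-- All attributes of a list of relations. -/
def attrs (Rs : List (Table V D)) : Finset V := unionAll (Rs.map Table.schema)

/-- Nested-loop evaluation of a join in the given order: the current partial tuple `t` is extended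
by every matching row of the next relation. -/
def loopRows : List (Table V D) → Tup V D → Finset (Tup V D)
  | [], t => {t}
  | R :: Rs, t => (R.rows.filter (Compat t)).biUnion fun r => loopRows Rs (merge t r)

/-- Steps of the nested loop: one step per emitted tuple, and one step per index lookup that
returns the list of the matching rows, each of which is then visited in turn. -/
def loopSteps : List (Table V D) → Tup V D → ℕ
  | [], _ => 1
  | R :: Rs, t => 1 + ∑ r ∈ R.rows.filter (Compat t), loopSteps Rs (merge t r)

/-- Steps of a join evaluation: one step per row for building the indexes, then the nested loop. -/
def joinSteps (Rs : List (Table V D)) : ℕ := tableSize Rs + loopSteps Rs emptyTup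

/-! ## Degree-based packing -/

/-- A cover of the attribute set `X` by pairs `(R, A)` with `A ⊆ attr(R) ∩ X`, for the join of the
projections `π_X(R)`; relations are referred to by their position in the list. -/
def IsCover (Rs : List (Table V D)) (X : Finset V) (C : Finset (Fin Rs.length × Finset V)) : Prop :=
  (∀ p ∈ C, p.2 ⊆ (Rs.get p.1).schema ∩ X) ∧ C.biUnion Prod.snd = X

/-- Optimal value of the linear program that belongs to a cover, with bucket range `2` and in
natural logarithms (so the exponential of the value is the bound, whatever the base used). -/
noncomputable def coverValue (Rs : List (Table V D)) (X : Finset V)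
    (C : Finset (Fin Rs.length × Finset V)) : ℝ :=
  sInf {x : ℝ | ∃ v : V → ℝ,
    (∀ p ∈ C, ∀ A' ⊆ p.2,
      Real.log ((maxDeg ((Rs.get p.1).proj p.2) (p.2 \ A') : ℝ) / 2) ≤ ∑ a ∈ A', v a) ∧
    x = ∑ a ∈ X, v a}

/-- The degree-based packing bound `IN ^ DBP` of the join of the projections `π_X(R)`. -/
noncomputable def dbpBound (Rs : List (Table V D)) (X : Finset V) : ℝ :=
  Real.exp (sInf {x : ℝ | ∃ C, IsCover Rs X C ∧ x = coverValue Rs X C})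

open Classical in
/-- A cover whose linear program has the smallest value. -/
noncomputable def bestCover (Rs : List (Table V D)) (X : Finset V) :
    Finset (Fin Rs.length × Finset V) :=
  if h : ∃ C, IsCover Rs X C ∧ ∀ C', IsCover Rs X C' → coverValue Rs X C ≤ coverValue Rs X C'
  then h.choose else ∅

/-! ## The transforms -/

/-- The tables of the Light transform, in the order of evaluation: first the projections `π_A(R)`,
`(R, A)` in the cover; then every `π_X(R)`, as a semijoin filter. -/
noncomputable def lightTables (Rs : List (Table V D)) (X : Finset V)
    (C : Finset (Fin Rs.length × Finset V)) : List (Table V D) :=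
  (C.toList.map fun p => (Rs.get p.1).proj p.2) ++ Rs.map (Table.proj X)

/-- `R_X`, the join of all `π_X(R)`. -/
noncomputable def lightRel (Rs : List (Table V D)) (X : Finset V) : Table V D :=
  ⟨X, loopRows (lightTables Rs X (bestCover Rs X)) emptyTup⟩

/-- The relations after the Light transform. -/
noncomputable def lightReduce (Rs : List (Table V D)) (X : Finset V) : List (Table V D) :=
  lightRel Rs X :: Rs.filter fun R => ¬ R.schema ⊆ X

/-- Steps of the Light transform: computing all projections and all degrees in them, with one scan
per pair `A ⊆ B ⊆ attr(R)`; then the join. -/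
noncomputable def lightSteps (Rs : List (Table V D)) (X : Finset V) : ℕ :=
  (Rs.map fun R => ∑ B ∈ R.schema.powerset, ∑ _A ∈ B.powerset, R.rows.card).sum
    + joinSteps (lightTables Rs X (bestCover Rs X))

/-- The relations that contain the attribute `X`. -/
def heavyRels (Rs : List (Table V D)) (X : V) : List (Table V D) := Rs.filter fun R => X ∈ R.schema

/-- The values of `X` that lie in all relations containing `X` (as tuples over `{X}`). -/
def heavyVals (Rs : List (Table V D)) (X : V) : Finset (Tup V D) :=
  loopRows ((heavyRels Rs X).map (Table.proj {X})) emptyTup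

/-- `π_{V \ X} σ_{X = x} R`. -/
def heavySelect (X : V) (x : Tup V D) (R : Table V D) : Table V D :=
  ⟨R.schema.erase X, (R.rows.filter (Compat x)).image (restrict (R.schema.erase X))⟩

/-- The relations of the problem marginalized on `x`. -/
def heavyReduce (Rs : List (Table V D)) (X : V) (x : Tup V D) : List (Table V D) :=
  Rs.map fun R => if X ∈ R.schema then heavySelect X x R else R

/-- The sublist of the positions selected by `m`. -/
def pick {α : Type*} : (ℕ → Bool) → List α → List α
  | _, [] => []
  | m, a :: l => if m 0 then a :: pick (fun n => m (n + 1)) l else pick (fun n => m (n + 1)) l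

end Relations

/-- A combination of transforms, applied until one relation is left. A Split carries its
articulation set `S`, the positions `m₁`, `m₂` of the relations of `G₁`, `G₂`, and the
continuations for the subproblems: `splitOut` is the case `S ⊆ O`, `splitProj` is the case
`O ⊆ attr(G₂)`. -/
inductive Plan (V : Type*)
  | done : Plan V
  | heavy (X : V) (p : Plan V) : Plan V
  | light (X : Finset V) (p : Plan V) : Plan V
  | splitOut (S : Finset V) (m₁ m₂ : ℕ → Bool) (p₁ p₂ p₃ : Plan V) : Plan V
  | splitProj (S : Finset V) (m₁ m₂ : ℕ → Bool) (p₁ p₂ : Plan V) : Plan V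

namespace Plan

variable {V D : Type*} [Fintype V] [DecidableEq V] [DecidableEq D]

/-- The relation computed by a plan for the problem `π_O(⋈ Rs)`. -/
noncomputable def out : Plan V → List (Table V D) → Finset V → Table V D
  | done, Rs, O => ⟨O, (loopRows Rs emptyTup).image (restrict O)⟩
  | heavy X p, Rs, O =>
      ⟨O, (heavyVals Rs X).biUnion fun x =>
        (out p (heavyReduce Rs X x) (O.erase X)).rows.image (merge (restrict O x))⟩
  | light X p, Rs, O => out p (lightReduce Rs X) O
  | splitOut S m₁ m₂ p₁ p₂ p₃, Rs, O =>
      let G₁ := pick m₁ Rs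
      let G₂ := pick m₂ Rs
      let RS := out p₁ G₁ S
      let O₂ := out p₂ (RS :: G₂) (O ∩ (S ∪ attrs G₂))
      let RS' : Table V D := ⟨S, RS.rows ∩ (O₂.proj S).rows⟩
      let O₁ := out p₃ (RS' :: G₁) (O ∩ attrs G₁)
      ⟨O, loopRows [RS', O₁, O₂] emptyTup⟩
  | splitProj S m₁ m₂ p₁ p₂, Rs, O =>
      out p₂ (out p₁ (pick m₁ Rs) S :: pick m₂ Rs) O

/-- The number of steps a plan takes on the problem `π_O(⋈ Rs)`. -/
noncomputable def steps : Plan V → List (Table V D) → Finset V → ℕ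
  | done, Rs, _ => joinSteps Rs
  | heavy X p, Rs, O =>
      2 * tableSize (heavyRels Rs X) + joinSteps ((heavyRels Rs X).map (Table.proj {X}))
        + ∑ x ∈ heavyVals Rs X,
            (tableSize ((heavyRels Rs X).map (heavySelect X x))
              + steps p (heavyReduce Rs X x) (O.erase X)
              + (out p (heavyReduce Rs X x) (O.erase X)).rows.card)
  | light X p, Rs, O => lightSteps Rs X + steps p (lightReduce Rs X) O
  | splitOut S m₁ m₂ p₁ p₂ p₃, Rs, O =>
      let G₁ := pick m₁ Rs
      let G₂ := pick m₂ Rs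
      let RS := out p₁ G₁ S
      let O₂ := out p₂ (RS :: G₂) (O ∩ (S ∪ attrs G₂))
      let RS' : Table V D := ⟨S, RS.rows ∩ (O₂.proj S).rows⟩
      let O₁ := out p₃ (RS' :: G₁) (O ∩ attrs G₁)
      steps p₁ G₁ S + steps p₂ (RS :: G₂) (O ∩ (S ∪ attrs G₂)) + tableSize [RS, O₂]
        + steps p₃ (RS' :: G₁) (O ∩ attrs G₁) + joinSteps [RS', O₁, O₂]
  | splitProj S m₁ m₂ p₁ p₂, Rs, O =>
      steps p₁ (pick m₁ Rs) S + steps p₂ (out p₁ (pick m₁ Rs) S :: pick m₂ Rs) O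

/-- The conditions on the two parts of a Split: every relation is in a part, attributes common to
both parts lie in `S`, and `S` consists of attributes of the first part. -/
def Separates (S : Finset V) (m₁ m₂ : ℕ → Bool) (l : List (Finset V)) : Prop :=
  (∀ i < l.length, m₁ i = true ∨ m₂ i = true) ∧
  unionAll (pick m₁ l) ∩ unionAll (pick m₂ l) ⊆ S ∧ S ⊆ unionAll (pick m₁ l)

/-- A plan is applicable to relations with schemas `l` and output attributes `O`: the input
conditions of all its transforms hold, and each branch ends with a single relation. -/
def Valid : Plan V → List (Finset V) → Finset V → Prop
  | done, l, O => ∃ s, l = [s] ∧ O ⊆ s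
  | heavy X p, l, O => X ∈ unionAll l ∧ Valid p (l.map fun s => s.erase X) (O.erase X)
  | light X p, l, O => X ⊆ unionAll l ∧ Valid p (X :: l.filter fun s => ¬ s ⊆ X) O
  | splitOut S m₁ m₂ p₁ p₂ p₃, l, O =>
      Separates S m₁ m₂ l ∧ S ⊆ O ∧ Valid p₁ (pick m₁ l) S ∧
      Valid p₂ (S :: pick m₂ l) (O ∩ (S ∪ unionAll (pick m₂ l))) ∧
      Valid p₃ (S :: pick m₁ l) (O ∩ unionAll (pick m₁ l))
  | splitProj S m₁ m₂ p₁ p₂, l, O =>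
      Separates S m₁ m₂ l ∧ O ⊆ unionAll (pick m₂ l) ∧ Valid p₁ (pick m₁ l) S ∧
      Valid p₂ (S :: pick m₂ l) O

/-- The plan uses Split and Light transforms only. -/
def SplitLight : Plan V → Prop
  | done => True
  | heavy _ _ => False
  | light _ p => SplitLight p
  | splitOut _ _ _ p₁ p₂ p₃ => SplitLight p₁ ∧ SplitLight p₂ ∧ SplitLight p₃
  | splitProj _ _ _ p₁ p₂ => SplitLight p₁ ∧ SplitLight p₂

/-- The relation at position `k` is an ear with witness at position `j`: each of its attributes
occurs in no other relation or occurs in the witness. -/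
def IsEar (l : List (Finset V)) (k j : Fin l.length) : Prop :=
  k ≠ j ∧ ∀ a ∈ l.get k, a ∈ l.get j ∨ ∀ i, i ≠ k → a ∉ l.get i

/-- Repeated Split on ears. `G₁` is an ear `R₁` with witness `R₂`, and `S = attr(R₁) ∩ attr(R₂)`;
wherever `R_S` has been added next to a relation that contains its schema, it is absorbed into that
relation by the Light transform on the schema of the latter. -/
inductive EarPlan : Plan V → List (Finset V) → Prop
  | single (s : Finset V) : EarPlan done [s]
  | step (l : List (Finset V)) (k j : Fin l.length) (p : Plan V) (hear : IsEar l k j)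
      (hp : EarPlan p (l.get j ::
        ((l.get k ∩ l.get j) :: l.eraseIdx k).filter fun s => ¬ s ⊆ l.get j)) :
      EarPlan (splitOut (l.get k ∩ l.get j) (fun i => i == k.1) (fun i => i != k.1)
        done (light (l.get j) p) (light (l.get k) done)) l

end Plan

/-! ## Queries, instances, degree uniformization, and DARTS -/

/-- A join query: the schemas of its `m` relations; every attribute occurs in some relation. -/
structure Query (V : Type*) (m : ℕ) where
  schema : Fin m → Finset V
  covered : ∀ a, ∃ i, a ∈ schema i

/-- An input of the query: a nonempty finite relation for each schema. -/
structure Inst {V : Type*} {m : ℕ} (q : Query V m) (D : Type*) where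
  rows : Fin m → Finset (Tup V D)
  wf : ∀ i, ∀ t ∈ rows i, ∀ a, (t a).isSome ↔ a ∈ q.schema i
  nonempty : ∀ i, (rows i).Nonempty

/-- A degree configuration: the index `l` of the bucket `[2^l, 2^(l+1))` for each relation and each
set of its attributes (and `0` for other sets). -/
abbrev Config (V : Type*) (m : ℕ) := Fin m → Finset V → ℕ

section Darts

variable {V : Type*} [Fintype V] [DecidableEq V] {m : ℕ} {q : Query V m}
  {D : Type*} [DecidableEq D]

/-- The list of the schemas of a query. -/
def Query.schemas (q : Query V m) : List (Finset V) := List.ofFn q.schema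

/-- The join: all tuples over `V` whose projection to each schema is in the relation. -/
def joinSet (q : Query V m) (R : Fin m → Finset (Tup V D)) : Set (Tup V D) :=
  {t | (∀ a, (t a).isSome) ∧ ∀ i, restrict (q.schema i) t ∈ R i}

/-- Input size. -/
def Inst.IN (I : Inst q D) : ℕ := ∑ i, (I.rows i).card

/-- Output size. -/
noncomputable def Inst.OUT (I : Inst q D) : ℕ := (joinSet q I.rows).ncard

/-- The set of all degree configurations (bucket range `2`). -/
def Inst.configs (I : Inst q D) : Finset (Config V m) :=
  (Fintype.piFinset fun i => Fintype.piFinset fun A =>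
    if A ⊆ q.schema i then Finset.range (Nat.log 2 (I.rows i).card + 1) else {0}).filter
  fun c => ∀ i, c i (q.schema i) = 0 ∧ c i ∅ = Nat.log 2 (I.rows i).card ∧
    ∀ A' A, A' ⊆ A → A ⊆ q.schema i → c i A ≤ c i A'

/-- `R(c)`: the tuples all of whose degrees are in the buckets prescribed by `c`. -/
def Inst.part (I : Inst q D) (c : Config V m) (i : Fin m) : Finset (Tup V D) :=
  (I.rows i).filter fun t =>
    ∀ A ∈ (q.schema i).powerset, Nat.log 2 (deg (restrict A t) (I.rows i) A) = c i A

/-- The relations `R(c)` as a list. -/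
def Inst.parts (I : Inst q D) (c : Config V m) : List (Table V D) :=
  List.ofFn fun i => ⟨q.schema i, I.part c i⟩

/-- The degree configurations for which no `R(c)` is empty. -/
def Inst.liveConfigs (I : Inst q D) : Finset (Config V m) :=
  I.configs.filter fun c => ∀ i, (I.part c i).Nonempty

/-- The output of the join procedure with degree uniformization, where the configuration `c` is
processed by the plan `choice c`. -/
noncomputable def runOut (choice : Config V m → Plan V) (I : Inst q D) : Finset (Tup V D) :=
  I.liveConfigs.biUnion fun c => ((choice c).out (I.parts c) Finset.univ).rows

/-- Its number of steps: two scans of `R` for each `A ⊆ attr(R)`, to compute the degrees and the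
bucket of each tuple; then, for each configuration, fetching the relations `R(c)` and, unless one
of them is empty, running the plan and writing the result to the output. -/
noncomputable def runSteps (choice : Config V m → Plan V) (I : Inst q D) : ℕ :=
  (∑ i, ∑ _A ∈ (q.schema i).powerset, 2 * (I.rows i).card)
  + (∑ c ∈ I.configs, (1 + ∑ i, (1 + (I.part c i).card)))
  + ∑ c ∈ I.liveConfigs, ((choice c).steps (I.parts c) Finset.univ
      + ((choice c).out (I.parts c) Finset.univ).rows.card)

/-- The bound that a plan gives on `Q(G)` for the problem `G` with the degree configuration `c`:
the smallest `x` such that, on every input with this configuration, the plan takes at most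
`x + K * OUT` steps. -/
noncomputable def qBound (q : Query V m) (D : Type*) [DecidableEq D] (K : ℕ) (c : Config V m)
    (p : Plan V) : ℕ∞ :=
  ⨆ I : {I : Inst q D // c ∈ I.liveConfigs},
    ((p.steps (I.1.parts c) Finset.univ - K * (joinSet q (I.1.part c)).ncard : ℕ) : ℕ∞)

open Classical in
/-- The plan that DARTS chooses for a degree configuration: among the applicable plans of its
repertoire, one with the smallest bound on `Q(G)`. -/
noncomputable def dartsChoice (q : Query V m) (D : Type*) [DecidableEq D] (K : ℕ)
    (rep : Set (Plan V)) (c : Config V m) : Plan V :=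
  if h : ∃ p, (p ∈ rep ∧ p.Valid q.schemas Finset.univ) ∧
      ∀ p', p' ∈ rep ∧ p'.Valid q.schemas Finset.univ → qBound q D K c p ≤ qBound q D K c p'
  then h.choose else Plan.done

/-! ## Covers, decompositions, and widths -/

/-- `w` is a fractional cover of the attribute set `X` by the relations of the query. -/
def Query.FracCover (q : Query V m) (X : Finset V) (w : Fin m → ℝ) : Prop :=
  (∀ i, 0 ≤ w i) ∧ ∀ a ∈ X, 1 ≤ ∑ i with a ∈ q.schema i, w i

/-- The AGM bound over the attribute set `X`. -/
noncomputable def Inst.agm (I : Inst q D) (X : Finset V) : ℝ :=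
  sInf {x : ℝ | ∃ w, q.FracCover X w ∧ x = ∏ i, ((I.rows i).card : ℝ) ^ w i}

/-- The fractional edge cover number of `X`. -/
noncomputable def Query.rhoStar (q : Query V m) (X : Finset V) : ℝ :=
  sInf {x : ℝ | ∃ w, q.FracCover X w ∧ x = ∑ i, w i}

/-- A generalized hypertree decomposition with `n` nodes. -/
structure GHD (q : Query V m) (n : ℕ) where
  tree : SimpleGraph (Fin n)
  isTree : tree.IsTree
  bag : Fin n → Finset V
  covers : ∀ i, ∃ t, q.schema i ⊆ bag t
  running : ∀ a, (tree.induce {t | a ∈ bag t}).Connected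

/-- The fractional hypertree width of the hypergraph of the query. -/
noncomputable def Query.fhw (q : Query V m) : ℝ :=
  sInf {x : ℝ | ∃ (n : ℕ) (T : GHD q n), x = ⨆ t, q.rhoStar (T.bag t)}

/-- The fractional hypertree width with the sizes of the relations taken into account. -/
noncomputable def Inst.fhw (I : Inst q D) : ℝ :=
  sInf {x : ℝ | ∃ (n : ℕ) (T : GHD q n), x = ⨆ t, Real.logb I.IN (I.agm (T.bag t))}

/-- The query is α-acyclic: it has a join tree. -/
def Query.AlphaAcyclic (q : Query V m) : Prop :=
  ∃ T : SimpleGraph (Fin m), T.IsTree ∧ ∀ a, (T.induce {i | a ∈ q.schema i}).Connected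

end Darts

/-!
Within one degree configuration `c`, every degree is known up to a factor `2`, so the linear
programs of degree-based packing are governed by the numbers `c(R, ∅) - c(R, A)`. Take `v ≥ 0` on
the attributes of `X` with `∑ a ∈ A, v a ≤ (c(R, ∅) - c(R, A)) log 2` for all `R` and `A`, raised
until every attribute lies in a tight pair `(R, A)`. The tight pairs form a cover of `X`, and `v`
solves its linear program: subtracting the bound for `A \ A'` from the equality for `A` leaves the
constraint for `A'`. The upper bounds are at most `log |R|`, hence weak duality against fractional
covers gives `∑ a ∈ X, v a ≤ log AGM(X)`. The constraints in turn bound the nested loop, whatever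
the order in which it joins the relations, so that Light on `X` costs `IN + AGM(X)` up to constants,
and Light on the schema of a relation `R` only `IN + |R|`.

Splitting off an ear is a semijoin, followed by joins that emit only projections of result tuples;
repeated along a join tree this costs `IN + OUT` up to constants.

Given a decomposition, Light on its maximal bags leaves an acyclic join of relations of size at most
the largest AGM bound of a bag, to which repeated Split on ears applies. Inputs of the same
configuration have sizes within a factor `2` and AGM bounds within `2 ^ m`, so this plan bounds `Q`
and with it the cost of the plan chosen by DARTS. There are only polylogarithmically many
configurations, and a tuple of the join belongs to exactly one of them.
-/

/-! ## Acyclic families of schemas -/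

section Acyclicity

variable {V : Type*}

/-- The attributes that `s` shares with the family `M` all lie in `t`. For `t ∈ M` this says that
`s` is an ear of `s ::ₘ M` with witness `t`. -/
def AttachesTo (s t : Finset V) (M : Multiset (Finset V)) : Prop :=
  ∀ a ∈ s, (∃ r ∈ M, a ∈ r) → a ∈ t

/-- Acyclicity in the sense of Graham, Yu and Özsoyoğlu: the family is built from a single schema
by adding ears. -/
inductive GYOAcyclic : Multiset (Finset V) → Prop
  | single (s : Finset V) : GYOAcyclic {s}
  | cons {s t : Finset V} {M : Multiset (Finset V)} (hM : GYOAcyclic M) (ht : t ∈ M)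
      (hst : AttachesTo s t M) : GYOAcyclic (s ::ₘ M)

namespace AttachesTo

variable {s t : Finset V} {M N : Multiset (Finset V)}

theorem anti (h : AttachesTo s t M) (hNM : N ⊆ M) : AttachesTo s t N :=
  fun a ha ⟨r, hr, har⟩ => h a ha ⟨r, hNM hr, har⟩

theorem mono_right {t' : Finset V} (h : AttachesTo s t M) (ht : t ⊆ t') : AttachesTo s t' M :=
  fun a ha hr => ht (h a ha hr)

theorem replace [DecidableEq V] {x y : Finset V} (h : AttachesTo y t M) (hs : s ∈ M)
    (hx : AttachesTo x s (y ::ₘ M)) : AttachesTo y t (x ::ₘ M.erase s) := by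
  rintro a hay ⟨r, hr, har⟩
  rcases Multiset.mem_cons.1 hr with rfl | hr
  · exact h a hay ⟨s, hs, hx a har ⟨y, Multiset.mem_cons_self _ _, hay⟩⟩
  · exact h a hay ⟨r, Multiset.mem_of_mem_erase hr, har⟩

end AttachesTo

namespace GYOAcyclic

variable [DecidableEq V] {M : Multiset (Finset V)} {s t : Finset V}

theorem replace (hM : GYOAcyclic M) (hs : s ∈ M) {x : Finset V} (hsx : s ⊆ x)
    (hx : AttachesTo x s M) : GYOAcyclic (x ::ₘ M.erase s) := by
  induction hM generalizing s x with
  | single y =>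
    obtain rfl : s = y := by simpa using hs
    simpa using GYOAcyclic.single x
  | @cons y t M hM ht hyt ih =>
    have hMy : M ⊆ y ::ₘ M := Multiset.subset_cons M y
    by_cases hsy : s = y
    · subst hsy
      rw [Multiset.erase_cons_head]
      exact .cons hM ht fun a ha hr =>
        hyt a (hx a ha (hr.imp fun r h => ⟨hMy h.1, h.2⟩)) hr
    have hsM : s ∈ M := (Multiset.mem_cons.1 hs).resolve_left hsy
    have hM' := ih hsM hsx (hx.anti hMy)
    have hy : AttachesTo y t (x ::ₘ M.erase s) := hyt.replace hsM hx
    rw [Multiset.erase_cons_tail _ (Ne.symm hsy), Multiset.cons_swap]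
    by_cases hts : t = s
    · exact .cons hM' (Multiset.mem_cons_self _ _) (hy.mono_right (hts ▸ hsx))
    · exact .cons hM' (Multiset.mem_cons_of_mem ((Multiset.mem_erase_of_ne hts).2 ht)) hy

theorem erase (hM : GYOAcyclic M) (hs : s ∈ M) (ht : t ∈ M.erase s) (hst : s ⊆ t) :
    GYOAcyclic (M.erase s) := by
  induction hM generalizing s t with
  | single y =>
    obtain rfl : s = y := by simpa using hs
    simp at ht
  | @cons y u M hM hu hyu ih =>
    by_cases hsy : s = y
    · rwa [hsy, Multiset.erase_cons_head]
    have hsM : s ∈ M := (Multiset.mem_cons.1 hs).resolve_left hsy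
    have hyu' : AttachesTo y u (M.erase s) := hyu.anti (Multiset.erase_subset s M)
    rw [Multiset.erase_cons_tail _ (Ne.symm hsy)] at ht ⊢
    rcases Multiset.mem_cons.1 ht with rfl | ht
    · by_cases hus : u = s
      · exact hM.replace hsM hst (hus ▸ hyu)
      · have hu' := (Multiset.mem_erase_of_ne hus).2 hu
        have hsu : s ⊆ u := fun a ha => hyu a (hst ha) ⟨s, hsM, ha⟩
        exact .cons (ih hsM hu' hsu) hu' hyu'
    · have hM' := ih hsM ht hst
      by_cases hus : u = s
      · exact .cons hM' ht (hyu'.mono_right (hus ▸ hst))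
      · exact .cons hM' ((Multiset.mem_erase_of_ne hus).2 hu) hyu'

theorem erase_cons (hM : GYOAcyclic (t ::ₘ M)) (hs : s ∈ M) (hst : s ⊆ t) :
    GYOAcyclic (t ::ₘ M.erase s) := by
  have herase : (t ::ₘ M).erase s = t ::ₘ M.erase s := by
    by_cases hts : t = s
    · rw [hts, Multiset.erase_cons_head, Multiset.cons_erase hs]
    · exact Multiset.erase_cons_tail _ hts
  have ht : t ∈ (t ::ₘ M).erase s := herase ▸ Multiset.mem_cons_self t _
  exact herase ▸ hM.erase (Multiset.mem_cons_of_mem hs) ht hst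

theorem filter_not_subset (hM : GYOAcyclic (t ::ₘ M)) :
    GYOAcyclic (t ::ₘ M.filter fun s => ¬ s ⊆ t) := by
  induction hn : M.card using Nat.strong_induction_on generalizing M with
  | _ n ih =>
    by_cases h : ∃ s ∈ M, s ⊆ t
    · obtain ⟨s, hs, hst⟩ := h
      have hfilter := ih _ (hn ▸ Multiset.card_erase_lt_of_mem hs) (hM.erase_cons hs hst) rfl
      rwa [← Multiset.cons_erase hs,
        Multiset.filter_cons_of_neg (p := fun s => ¬ s ⊆ t) _ (not_not.2 hst)]
    · push Not at h
      rwa [Multiset.filter_eq_self.2 h]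

omit [DecidableEq V] in
theorem exists_antichain (hM : GYOAcyclic M) :
    ∃ B : Finset (Finset V), GYOAcyclic B.val ∧ B.val ≤ M ∧ (∀ s ∈ M, ∃ t ∈ B, s ⊆ t) ∧
      IsAntichain (· ⊆ ·) (B : Set (Finset V)) := by
  classical
  induction hn : M.card using Nat.strong_induction_on generalizing M with
  | _ n ih =>
    by_cases h : ∃ s ∈ M, ∃ t ∈ M.erase s, s ⊆ t
    · obtain ⟨s, hs, t, ht, hst⟩ := h
      obtain ⟨B, hB, hBM, hcov, hanti⟩ :=
        ih _ (hn ▸ Multiset.card_erase_lt_of_mem hs) (hM.erase hs ht hst) rfl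
      refine ⟨B, hB, hBM.trans (Multiset.erase_le _ _), fun r hr => ?_, hanti⟩
      by_cases hrs : r = s
      · obtain ⟨u, hu, htu⟩ := hcov t ht
        exact ⟨u, hu, hrs ▸ hst.trans htu⟩
      · exact hcov r ((Multiset.mem_erase_of_ne hrs).2 hr)
    · push Not at h
      have hnodup : M.Nodup := Multiset.nodup_iff_ne_cons_cons.2 fun s N hsN =>
        h s (by simp [hsN]) s (by simp [hsN]) subset_rfl
      refine ⟨⟨M, hnodup⟩, hM, le_rfl, fun s hs => ⟨s, hs, subset_rfl⟩, fun s hs t ht hne => ?_⟩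
      exact h s hs t ((Multiset.mem_erase_of_ne hne.symm).2 ht)

end GYOAcyclic

/-- A set of vertices that contains, with the endpoints of a path, the whole path. Unlike
connectedness of the induced subgraph, this also makes sense for the empty set. -/
def PathClosed {ι : Type*} (G : SimpleGraph ι) (S : Set ι) : Prop :=
  ∀ ⦃i j : ι⦄ (p : G.Walk i j), p.IsPath → i ∈ S → j ∈ S → ∀ x ∈ p.support, x ∈ S

namespace PathClosed

variable {ι : Type*} {G : SimpleGraph ι} {S : Set ι}

theorem of_preconnected_induce (hG : G.IsAcyclic) (hS : (G.induce S).Preconnected) :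
    PathClosed G S := by
  intro i j p hp hi hj x hx
  obtain ⟨p', hp'⟩ := (hS ⟨i, hi⟩ ⟨j, hj⟩).exists_isPath
  have hmap : (p'.map (SimpleGraph.Embedding.induce S).toHom).IsPath :=
    (SimpleGraph.Walk.isPath_map_iff_of_injective Subtype.val_injective).2 hp'
  have heq : p = p'.map (SimpleGraph.Embedding.induce S).toHom :=
    congrArg Subtype.val ((hG.subsingleton_path i j).elim ⟨p, hp⟩ ⟨_, hmap⟩)
  have hsupport : p.support = p'.support.map Subtype.val :=
    heq ▸ SimpleGraph.Walk.support_map (SimpleGraph.Embedding.induce S).toHom p'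
  obtain ⟨y, -, rfl⟩ := List.mem_map.1 (hsupport ▸ hx)
  exact y.2

theorem induce (hS : PathClosed G S) (W : Set ι) :
    PathClosed (G.induce W) ((↑) ⁻¹' S) := by
  intro i j p hp hi hj x hx
  refine hS (p.map (SimpleGraph.Embedding.induce W).toHom)
    ((SimpleGraph.Walk.isPath_map_iff_of_injective Subtype.val_injective).2 hp) hi hj x ?_
  exact (SimpleGraph.Walk.support_map (SimpleGraph.Embedding.induce W).toHom p).symm ▸
    List.mem_map_of_mem hx

theorem mem_of_unique_neighbor (hS : PathClosed G S) (hG : G.Connected) {u v x : ι}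
    (hu : ∀ w, G.Adj v w → w = u) (hv : v ∈ S) (hx : x ∈ S) (hxv : x ≠ v) : u ∈ S := by
  obtain ⟨p, hp⟩ := hG.exists_isPath v x
  have hnil : ¬ p.Nil := SimpleGraph.Walk.not_nil_of_ne hxv.symm
  exact hu _ (p.adj_snd hnil) ▸ hS p hp hv hx p.snd (p.getVert_mem_support 1)

end PathClosed

theorem map_univ_val_eq_cons {ι α : Type*} [Fintype ι] [DecidableEq ι] (f : ι → α) (v : ι) :
    Finset.univ.val.map f = f v ::ₘ
      (Finset.univ : Finset ({v}ᶜ : Set ι)).val.map fun x : ({v}ᶜ : Set ι) => f x := by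
  have hcompl : (Finset.univ : Finset ({v}ᶜ : Set ι)).map (Function.Embedding.subtype _)
      = Finset.univ.erase v := by
    ext x
    simp
  have hmap : (Finset.univ : Finset ({v}ᶜ : Set ι)).val.map (fun x : ({v}ᶜ : Set ι) => f x)
      = (Finset.univ.erase v).val.map f := by
    rw [← hcompl, Finset.map_val, Multiset.map_map]
    rfl
  rw [hmap, ← Multiset.map_cons, Finset.erase_val, Multiset.cons_erase (Finset.mem_univ v)]

namespace GYOAcyclic

variable {ι : Type*} [Fintype ι] {T : SimpleGraph ι} {χ : ι → Finset V}

theorem of_isTree_of_pathClosed (hT : T.IsTree) (hχ : ∀ a, PathClosed T {i | a ∈ χ i}) :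
    GYOAcyclic (Finset.univ.val.map χ) := by
  classical
  induction hn : Fintype.card ι using Nat.strong_induction_on generalizing ι with
  | _ n ih =>
    rcases subsingleton_or_nontrivial ι with hι | hι
    · obtain ⟨x⟩ := hT.connected.nonempty
      have : Unique ι := uniqueOfSubsingleton x
      simpa using GYOAcyclic.single (χ default)
    obtain ⟨v, hv⟩ := hT.exists_vert_degree_one_of_nontrivial
    obtain ⟨u, huv, hu⟩ := SimpleGraph.degree_eq_one_iff_existsUnique_adj.1 hv
    have hT' : (T.induce {v}ᶜ).IsTree :=
      ⟨hT.connected.induce_compl_singleton_of_degree_eq_one hv, hT.isAcyclic.induce _⟩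
    have hcard : Fintype.card ({v}ᶜ : Set ι) < n :=
      hn ▸ Fintype.card_subtype_lt (x := v) (by simp)
    have ih' := ih (Fintype.card ({v}ᶜ : Set ι)) hcard hT'
      (χ := fun x : ({v}ᶜ : Set ι) => χ x) (fun a => (hχ a).induce {v}ᶜ) rfl
    rw [map_univ_val_eq_cons χ v]
    refine .cons ih' (Multiset.mem_map.2 ⟨⟨u, huv.ne'⟩, Finset.mem_univ_val _, rfl⟩) ?_
    rintro a hav ⟨r, hr, har⟩
    obtain ⟨x, -, rfl⟩ := Multiset.mem_map.1 hr
    exact (hχ a).mem_of_unique_neighbor hT.connected hu hav har x.2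

theorem of_isTree (hT : T.IsTree) (hχ : ∀ a, (T.induce {i | a ∈ χ i}).Connected) :
    GYOAcyclic (Finset.univ.val.map χ) :=
  of_isTree_of_pathClosed hT fun a => .of_preconnected_induce hT.isAcyclic (hχ a).preconnected

end GYOAcyclic

end Acyclicity

/-! ## Tuples and joins -/

section Tuples

variable {V D : Type*} {A B : Finset V} {t u r : Tup V D} {a : V}

/-- `t` is a tuple over `A`: it has a value exactly at the attributes in `A`. -/
def HasSchema (A : Finset V) (t : Tup V D) : Prop := ∀ a, (t a).isSome ↔ a ∈ A

/-- `u` agrees with `t` wherever `t` has a value. -/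
def Extends (u t : Tup V D) : Prop := ∀ a, (t a).isSome → u a = t a

theorem extends_emptyTup (u : Tup V D) : Extends u emptyTup := fun a ha => by
  simp [emptyTup] at ha

theorem isSome_merge : (merge t r a).isSome ↔ (t a).isSome ∨ (r a).isSome := by
  simp [merge, Option.isSome_or]

theorem merge_apply_left (h : (t a).isSome) : merge t r a = t a := by
  obtain ⟨x, hx⟩ := Option.isSome_iff_exists.1 h
  simp [merge, hx]

theorem merge_apply_of_none (h : t a = none) : merge t r a = r a := by
  simp [merge, h]

theorem Compat.merge_apply_right (h : Compat t r) (ha : (r a).isSome) : merge t r a = r a := by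
  rcases h a with hnone | hnone | heq
  · exact merge_apply_of_none hnone
  · simp [hnone] at ha
  · exact (merge_apply_left (heq ▸ ha)).trans heq

theorem Extends.compat (ht : Extends u t) (hr : Extends u r) : Compat t r := fun a => by
  by_cases hta : (t a).isSome
  · by_cases hra : (r a).isSome
    · exact .inr (.inr ((ht a hta).symm.trans (hr a hra)))
    · exact .inr (.inl (by simpa using hra))
  · exact .inl (by simpa using hta)

theorem Compat.extends_merge_iff (h : Compat t r) :
    Extends u (merge t r) ↔ Extends u t ∧ Extends u r := by
  refine ⟨fun hu => ⟨fun a ha => ?_, fun a ha => ?_⟩, fun ⟨ht, hr⟩ a ha => ?_⟩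
  · rw [hu a (isSome_merge.2 (.inl ha)), merge_apply_left ha]
  · rw [hu a (isSome_merge.2 (.inr ha)), h.merge_apply_right ha]
  · rcases isSome_merge.1 ha with hta | hra
    · rw [merge_apply_left hta, ht a hta]
    · rw [h.merge_apply_right hra, hr a hra]

variable [DecidableEq V]

theorem restrict_apply (ha : a ∈ A) : restrict A t a = t a := if_pos ha

theorem restrict_apply_of_notMem (ha : a ∉ A) : restrict A t a = none := if_neg ha

theorem isSome_restrict : (restrict A t a).isSome ↔ a ∈ A ∧ (t a).isSome := by
  by_cases h : a ∈ A <;> simp [restrict, h]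

theorem restrict_eq_iff : restrict A t = restrict A u ↔ ∀ a ∈ A, t a = u a := by
  refine ⟨fun h a ha => ?_, fun h => funext fun a => ?_⟩
  · simpa only [restrict_apply ha] using congrFun h a
  · by_cases ha : a ∈ A
    · rw [restrict_apply ha, restrict_apply ha, h a ha]
    · rw [restrict_apply_of_notMem ha, restrict_apply_of_notMem ha]

theorem restrict_restrict (h : A ⊆ B) (t : Tup V D) :
    restrict A (restrict B t) = restrict A t :=
  restrict_eq_iff.2 fun _ ha => restrict_apply (h ha)

namespace HasSchema

theorem restrict_eq_self_of_subset (h : HasSchema A t) (hAB : A ⊆ B) : restrict B t = t :=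
  funext fun a => by
    by_cases ha : a ∈ B
    · exact restrict_apply ha
    · rw [restrict_apply_of_notMem ha]
      exact (Option.not_isSome_iff_eq_none.1 (mt (h a).1 (mt (@hAB a) ha))).symm

theorem restrict_eq_self (h : HasSchema A t) : restrict A t = t :=
  h.restrict_eq_self_of_subset subset_rfl

theorem restrict (h : HasSchema B t) (hAB : A ⊆ B) : HasSchema A (restrict A t) := fun a => by
  rw [isSome_restrict, h a]
  exact ⟨And.left, fun ha => ⟨ha, hAB ha⟩⟩

theorem restrict_eq_iff_extends (h : HasSchema A t) : _root_.restrict A u = t ↔ Extends u t := by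
  rw [← h.restrict_eq_self, restrict_eq_iff, h.restrict_eq_self]
  simp only [Extends, h _]

end HasSchema

end Tuples

section Joins

variable {V D : Type*}

/-- Every row of the table is a tuple over its schema. -/
def Table.WF (R : Table V D) : Prop := ∀ r ∈ R.rows, HasSchema R.schema r

variable [DecidableEq V]

theorem mem_unionAll {l : List (Finset V)} {a : V} : a ∈ unionAll l ↔ ∃ s ∈ l, a ∈ s := by
  induction l with
  | nil => simp [unionAll]
  | cons s l ih =>
    have hcons : unionAll (s :: l) = s ∪ unionAll l := rfl
    simp [hcons, ih]

theorem mem_attrs {Rs : List (Table V D)} {a : V} : a ∈ attrs Rs ↔ ∃ R ∈ Rs, a ∈ R.schema := by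
  simp [attrs, mem_unionAll]

theorem subset_attrs {Rs : List (Table V D)} {R : Table V D} (h : R ∈ Rs) :
    R.schema ⊆ attrs Rs := fun _ ha => mem_attrs.2 ⟨R, h, ha⟩

theorem attrs_mono {Rs Rs' : List (Table V D)} (h : Rs ⊆ Rs') : attrs Rs ⊆ attrs Rs' :=
  fun _ ha => have ⟨_, hR, haR⟩ := mem_attrs.1 ha; subset_attrs (h hR) haR

theorem attrs_cons (R : Table V D) (Rs : List (Table V D)) :
    attrs (R :: Rs) = R.schema ∪ attrs Rs := rfl

/-- The projection of `t` to each schema is a row of the relation, so that `t` restricts to a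
member of the join; `t` may have values at further attributes. -/
def Satisfies (Rs : List (Table V D)) (t : Tup V D) : Prop :=
  ∀ R ∈ Rs, restrict R.schema t ∈ R.rows

variable {Rs Rs' : List (Table V D)} {R : Table V D} {t u : Tup V D}

theorem satisfies_cons : Satisfies (R :: Rs) t ↔ restrict R.schema t ∈ R.rows ∧ Satisfies Rs t :=
  List.forall_mem_cons

theorem Satisfies.congr (ht : Satisfies Rs t) (h : ∀ a ∈ attrs Rs, t a = u a) : Satisfies Rs u :=
  fun R hR => restrict_eq_iff.2 (fun a ha => h a (subset_attrs hR ha)) ▸ ht R hR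

theorem Satisfies.isSome (ht : Satisfies Rs t) (hwf : ∀ R ∈ Rs, R.WF) {a : V}
    (ha : a ∈ attrs Rs) : (t a).isSome := by
  obtain ⟨R, hR, haR⟩ := mem_attrs.1 ha
  exact (isSome_restrict.1 ((hwf R hR _ (ht R hR) a).2 haR)).2

theorem Satisfies.hasSchema_restrict (ht : Satisfies Rs t) (hwf : ∀ R ∈ Rs, R.WF) {A : Finset V}
    (hA : A ⊆ attrs Rs) : HasSchema A (restrict A t) := fun _ =>
  isSome_restrict.trans ⟨And.left, fun ha => ⟨ha, ht.isSome hwf (hA ha)⟩⟩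

variable [DecidableEq D]

variable [Fintype V]

theorem Table.WF.proj (hR : R.WF) (A : Finset V) : (R.proj A).WF := by
  intro r hr
  obtain ⟨t, ht, rfl⟩ := Finset.mem_image.1 hr
  intro a
  rw [isSome_restrict, hR t ht a]
  simp [Table.proj, and_comm]

theorem mem_loopRows (hwf : ∀ R ∈ Rs, R.WF) :
    u ∈ loopRows Rs t ↔
      Extends u t ∧ (∀ a, (u a).isSome ↔ (t a).isSome ∨ a ∈ attrs Rs) ∧ Satisfies Rs u := by
  induction Rs generalizing t with
  | nil =>
    simp only [loopRows, Finset.mem_singleton, mem_attrs, Satisfies, List.not_mem_nil,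
      false_and, exists_false, or_false, IsEmpty.forall_iff, implies_true, and_true]
    refine ⟨by rintro rfl; exact ⟨fun _ _ => rfl, fun _ => Iff.rfl⟩, fun ⟨hut, hdom⟩ => ?_⟩
    ext1 a
    by_cases ha : (t a).isSome
    · exact hut a ha
    · rw [Option.not_isSome_iff_eq_none.1 ha,
        Option.not_isSome_iff_eq_none.1 (mt (hdom a).1 ha)]
  | cons R Rs ih =>
    have hR := hwf R List.mem_cons_self
    simp only [loopRows, Finset.mem_biUnion, Finset.mem_filter,
      ih fun R h => hwf R (List.mem_cons_of_mem _ h), satisfies_cons, attrs_cons, Finset.mem_union]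
    constructor
    · rintro ⟨r, ⟨hr, hc⟩, hu, hdom, hRs⟩
      obtain ⟨hut, hur⟩ := hc.extends_merge_iff.1 hu
      refine ⟨hut, fun a => ?_, ?_, hRs⟩
      · rw [hdom, isSome_merge, hR r hr a, or_assoc]
      · rwa [(hR r hr).restrict_eq_iff_extends.2 hur]
    · rintro ⟨hut, hdom, hr, hRs⟩
      have hur := (hR _ hr).restrict_eq_iff_extends.1 rfl
      have hc := hut.compat hur
      refine ⟨_, ⟨hr, hc⟩, hc.extends_merge_iff.2 ⟨hut, hur⟩, fun a => ?_, hRs⟩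
      rw [hdom, isSome_merge, hR _ hr a, or_assoc]

/-- The join of the relations. -/
abbrev joinRows (Rs : List (Table V D)) : Finset (Tup V D) := loopRows Rs emptyTup

theorem mem_joinRows (hwf : ∀ R ∈ Rs, R.WF) :
    u ∈ joinRows Rs ↔ HasSchema (attrs Rs) u ∧ Satisfies Rs u := by
  simp [mem_loopRows hwf, extends_emptyTup, HasSchema, emptyTup]

/-- The problem `π_O(⋈ Rs)`, solved. -/
def projJoin (Rs : List (Table V D)) (O : Finset V) : Table V D :=
  ⟨O, (joinRows Rs).image (restrict O)⟩

theorem mem_projJoin (hwf : ∀ R ∈ Rs, R.WF) {O : Finset V} (hO : O ⊆ attrs Rs) :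
    u ∈ (projJoin Rs O).rows ↔ ∃ t, Satisfies Rs t ∧ restrict O t = u := by
  simp only [projJoin, Finset.mem_image, mem_joinRows hwf]
  refine ⟨fun ⟨t, ht, hu⟩ => ⟨t, ht.2, hu⟩, fun ⟨t, ht, hu⟩ =>
    ⟨restrict (attrs Rs) t, ⟨ht.hasSchema_restrict hwf subset_rfl, ?_⟩, ?_⟩⟩
  · exact ht.congr fun a ha => (restrict_apply ha).symm
  · rwa [restrict_restrict hO]

theorem mem_joinRows_iff_mem_projJoin (hwf : ∀ R ∈ Rs, R.WF) :
    u ∈ joinRows Rs ↔ u ∈ (projJoin Rs (attrs Rs)).rows := by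
  refine ⟨fun hu => Finset.mem_image.2 ⟨u, hu, ?_⟩, fun hu => ?_⟩
  · exact ((mem_joinRows hwf).1 hu).1.restrict_eq_self
  · obtain ⟨t, ht, rfl⟩ := Finset.mem_image.1 hu
    rwa [((mem_joinRows hwf).1 ht).1.restrict_eq_self]

theorem projJoin_attrs (hwf : ∀ R ∈ Rs, R.WF) : projJoin Rs (attrs Rs) = ⟨attrs Rs, joinRows Rs⟩ :=
  congrArg (Table.mk _) (Finset.ext fun _ => (mem_joinRows_iff_mem_projJoin hwf).symm)

theorem projJoin_wf (hwf : ∀ R ∈ Rs, R.WF) {O : Finset V} (hO : O ⊆ attrs Rs) :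
    (projJoin Rs O).WF := by
  intro u hu
  obtain ⟨t, ht, rfl⟩ := (mem_projJoin hwf hO).1 hu
  exact ht.hasSchema_restrict hwf hO

theorem projJoin_congr (hwf : ∀ R ∈ Rs, R.WF) (hwf' : ∀ R ∈ Rs', R.WF)
    (hattrs : attrs Rs' = attrs Rs) (h : ∀ t, Satisfies Rs' t ↔ Satisfies Rs t) (O : Finset V) :
    projJoin Rs' O = projJoin Rs O := by
  have hjoin : joinRows Rs' = joinRows Rs := by
    ext u
    rw [mem_joinRows hwf, mem_joinRows hwf', hattrs, h]
  rw [projJoin, projJoin, hjoin]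

theorem projJoin_rows_proj {A O : Finset V} (h : A ⊆ O) :
    ((projJoin Rs O).proj A).rows = (projJoin Rs A).rows := by
  simp only [projJoin, Table.proj, Finset.image_image]
  exact Finset.image_congr fun t _ => restrict_restrict h t

end Joins

/-! ## The steps of the nested loop -/

section Steps

variable {V D : Type*} [Fintype V] [DecidableEq D] {Rs : List (Table V D)} {R : Table V D}

theorem joinRows_singleton (hR : R.WF) : joinRows [R] = R.rows := by
  classical
  ext u
  rw [mem_joinRows (by simpa using hR)]
  simp only [attrs_cons, Satisfies, List.forall_mem_singleton]
  change HasSchema (R.schema ∪ ∅) u ∧ _ ↔ _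
  rw [Finset.union_empty]
  exact ⟨fun ⟨hu, h⟩ => hu.restrict_eq_self ▸ h,
    fun h => ⟨hR u h, (hR u h).restrict_eq_self.symm ▸ h⟩⟩

theorem card_loopRows_cons (hwf : ∀ R' ∈ R :: Rs, R'.WF) (t : Tup V D) :
    (loopRows (R :: Rs) t).card
      = ∑ r ∈ R.rows with Compat t r, (loopRows Rs (merge t r)).card := by
  classical
  obtain ⟨hR, hRs⟩ := List.forall_mem_cons.1 hwf
  have restrict_eq {u r : Tup V D} (hr : r ∈ R.rows.filter (Compat t))
      (hu : u ∈ loopRows Rs (merge t r)) : restrict R.schema u = r := by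
    obtain ⟨hr, hc⟩ := Finset.mem_filter.1 hr
    exact (hR r hr).restrict_eq_iff_extends.2
      (hc.extends_merge_iff.1 ((mem_loopRows hRs).1 hu).1).2
  rw [loopRows, Finset.card_biUnion]
  exact fun r hr r' hr' hne => Finset.disjoint_left.2 fun u hu hu' =>
    hne ((restrict_eq hr hu).symm.trans (restrict_eq hr' hu'))

theorem loopSteps_concat (hwf : ∀ R' ∈ Rs ++ [R], R'.WF) (t : Tup V D) :
    loopSteps (Rs ++ [R]) t = loopSteps Rs t + (loopRows (Rs ++ [R]) t).card := by
  induction Rs generalizing t with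
  | nil =>
    rw [List.nil_append, card_loopRows_cons hwf]
    simp [loopSteps, loopRows]
  | cons R' Rs ih =>
    rw [List.cons_append] at hwf ⊢
    simp only [card_loopRows_cons hwf, loopSteps, ih (List.forall_mem_cons.1 hwf).2,
      Finset.sum_add_distrib, add_assoc]

theorem loopSteps_singleton (hR : R.WF) : loopSteps [R] emptyTup = 1 + R.rows.card := by
  rw [← joinRows_singleton hR]
  exact loopSteps_concat (Rs := []) (by simpa using hR) emptyTup

theorem card_loopRows_le_loopSteps (Rs : List (Table V D)) (t : Tup V D) :
    (loopRows Rs t).card ≤ loopSteps Rs t := by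
  induction Rs generalizing t with
  | nil => simp [loopRows, loopSteps]
  | cons R Rs ih =>
    exact (Finset.card_biUnion_le.trans (Finset.sum_le_sum fun r _ => ih _)).trans
      (Nat.le_add_left _ _)

end Steps

/-! ## Correctness of the transforms -/

section Split

variable {V D : Type*} [DecidableEq V] {Rs G₁ G₂ : List (Table V D)} {S : Finset V}
  {t t₁ t₂ : Tup V D}

/-- The input condition of Split: the relations are those of `G₁` and `G₂`, and `S` separates the
two parts. -/
structure IsSplit (Rs G₁ G₂ : List (Table V D)) (S : Finset V) : Prop where
  mem_iff : ∀ R, R ∈ Rs ↔ R ∈ G₁ ∨ R ∈ G₂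
  inter_subset : attrs G₁ ∩ attrs G₂ ⊆ S
  subset_attrs : S ⊆ attrs G₁

namespace IsSplit

theorem satisfies_iff (h : IsSplit Rs G₁ G₂ S) :
    Satisfies Rs t ↔ Satisfies G₁ t ∧ Satisfies G₂ t := by
  simp only [Satisfies, h.mem_iff, or_imp, forall_and]

theorem left_subset (h : IsSplit Rs G₁ G₂ S) : G₁ ⊆ Rs := fun R hR => (h.mem_iff R).2 (.inl hR)

theorem right_subset (h : IsSplit Rs G₁ G₂ S) : G₂ ⊆ Rs := fun R hR => (h.mem_iff R).2 (.inr hR)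

theorem attrs_subset (h : IsSplit Rs G₁ G₂ S) : attrs Rs ⊆ attrs G₁ ∪ attrs G₂ := fun a ha => by
  obtain ⟨R, hR, haR⟩ := mem_attrs.1 ha
  exact Finset.mem_union.2 (((h.mem_iff R).1 hR).imp (fun hR => _root_.subset_attrs hR haR)
    fun hR => _root_.subset_attrs hR haR)

theorem union_subset_attrs (h : IsSplit Rs G₁ G₂ S) : S ∪ attrs G₂ ⊆ attrs Rs :=
  Finset.union_subset (h.subset_attrs.trans (attrs_mono h.left_subset))
    (attrs_mono h.right_subset)

theorem exists_glue (h : IsSplit Rs G₁ G₂ S) (h₁ : Satisfies G₁ t₁) (h₂ : Satisfies G₂ t₂)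
    (heq : restrict S t₁ = restrict S t₂) :
    ∃ t, Satisfies Rs t ∧ (∀ a ∈ attrs G₁, t a = t₁ a) ∧ ∀ a ∈ S ∪ attrs G₂, t a = t₂ a := by
  let t : Tup V D := fun a => if a ∈ attrs G₁ then t₁ a else t₂ a
  have eq_left : ∀ a ∈ attrs G₁, t a = t₁ a := fun a ha => if_pos ha
  have eq_right : ∀ a ∈ S ∪ attrs G₂, t a = t₂ a := by
    intro a ha
    by_cases ha₁ : a ∈ attrs G₁
    · have haS : a ∈ S := (Finset.mem_union.1 ha).elim id
        fun ha₂ => h.inter_subset (Finset.mem_inter.2 ⟨ha₁, ha₂⟩)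
      exact (eq_left a ha₁).trans (restrict_eq_iff.1 heq a haS)
    · exact if_neg ha₁
  refine ⟨t, h.satisfies_iff.2 ⟨h₁.congr fun a ha => (eq_left a ha).symm,
    h₂.congr fun a ha => (eq_right a (Finset.mem_union_right _ ha)).symm⟩, eq_left, eq_right⟩

variable [Fintype V] [DecidableEq D]

theorem projJoin_subset (h : IsSplit Rs G₁ G₂ S) (hwf : ∀ R ∈ Rs, R.WF) {A : Finset V}
    (hA : A ⊆ attrs G₁) : (projJoin Rs A).rows ⊆ (projJoin G₁ A).rows := by
  intro u hu
  obtain ⟨t, ht, rfl⟩ := (mem_projJoin hwf (hA.trans (attrs_mono h.left_subset))).1 hu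
  exact (mem_projJoin (fun R hR => hwf R (h.left_subset hR)) hA).2
    ⟨t, (h.satisfies_iff.1 ht).1, rfl⟩

theorem projJoin_cons_right (h : IsSplit Rs G₁ G₂ S) (hwf : ∀ R ∈ Rs, R.WF) {A : Finset V}
    (hA : A ⊆ S ∪ attrs G₂) : projJoin (projJoin G₁ S :: G₂) A = projJoin Rs A := by
  have hwf₁ : ∀ R ∈ G₁, R.WF := fun R hR => hwf R (h.left_subset hR)
  have hwf₂ : ∀ R ∈ projJoin G₁ S :: G₂, R.WF := List.forall_mem_cons.2
    ⟨projJoin_wf hwf₁ h.subset_attrs, fun R hR => hwf R (h.right_subset hR)⟩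
  refine congrArg (Table.mk A) (Finset.ext fun u => ?_)
  refine (mem_projJoin hwf₂ hA).trans (.trans ?_
    (mem_projJoin hwf (hA.trans h.union_subset_attrs)).symm)
  simp only [satisfies_cons]
  constructor
  · rintro ⟨t₂, ⟨hS, ht₂⟩, rfl⟩
    obtain ⟨t₁, ht₁, heq⟩ := (mem_projJoin hwf₁ h.subset_attrs).1 hS
    obtain ⟨t, ht, -, ht_right⟩ := h.exists_glue ht₁ ht₂ heq
    exact ⟨t, ht, restrict_eq_iff.2 fun a ha => ht_right a (hA ha)⟩
  · rintro ⟨t, ht, rfl⟩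
    obtain ⟨ht₁, ht₂⟩ := h.satisfies_iff.1 ht
    exact ⟨t, ⟨(mem_projJoin hwf₁ h.subset_attrs).2 ⟨t, ht₁, rfl⟩, ht₂⟩, rfl⟩

theorem projJoin_cons_left (h : IsSplit Rs G₁ G₂ S) (hwf : ∀ R ∈ Rs, R.WF) {A : Finset V}
    (hA : A ⊆ attrs G₁) : projJoin (projJoin Rs S :: G₁) A = projJoin Rs A := by
  have hS : S ⊆ attrs Rs := h.subset_attrs.trans (attrs_mono h.left_subset)
  have hwf₁ : ∀ R ∈ projJoin Rs S :: G₁, R.WF := List.forall_mem_cons.2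
    ⟨projJoin_wf hwf hS, fun R hR => hwf R (h.left_subset hR)⟩
  refine congrArg (Table.mk A) (Finset.ext fun u => ?_)
  refine (mem_projJoin hwf₁ (hA.trans Finset.subset_union_right)).trans (.trans ?_
    (mem_projJoin hwf (hA.trans (attrs_mono h.left_subset))).symm)
  simp only [satisfies_cons]
  constructor
  · rintro ⟨t₁, ⟨hS₁, ht₁⟩, rfl⟩
    obtain ⟨t₂, ht₂, heq⟩ := (mem_projJoin hwf hS).1 hS₁
    obtain ⟨t, ht, ht_left, -⟩ := h.exists_glue ht₁ (h.satisfies_iff.1 ht₂).2 heq.symm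
    exact ⟨t, ht, restrict_eq_iff.2 fun a ha => ht_left a (hA ha)⟩
  · rintro ⟨t, ht, rfl⟩
    exact ⟨t, ⟨(mem_projJoin hwf hS).2 ⟨t, ht, rfl⟩, (h.satisfies_iff.1 ht).1⟩, rfl⟩

theorem mem_projJoin_iff (h : IsSplit Rs G₁ G₂ S) (hwf : ∀ R ∈ Rs, R.WF) {O : Finset V}
    (hSO : S ⊆ O) (hO : O ⊆ attrs Rs) {u : Tup V D} :
    u ∈ (projJoin Rs O).rows ↔ HasSchema O u ∧
      restrict (O ∩ attrs G₁) u ∈ (projJoin Rs (O ∩ attrs G₁)).rows ∧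
      restrict (O ∩ (S ∪ attrs G₂)) u ∈ (projJoin Rs (O ∩ (S ∪ attrs G₂))).rows := by
  rw [mem_projJoin hwf hO, mem_projJoin hwf (Finset.inter_subset_left.trans hO),
    mem_projJoin hwf (Finset.inter_subset_left.trans hO)]
  constructor
  · rintro ⟨t, ht, rfl⟩
    exact ⟨ht.hasSchema_restrict hwf hO,
      ⟨t, ht, (restrict_restrict Finset.inter_subset_left t).symm⟩,
      ⟨t, ht, (restrict_restrict Finset.inter_subset_left t).symm⟩⟩
  · rintro ⟨hu, ⟨t₁, ht₁, heq₁⟩, t₂, ht₂, heq₂⟩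
    have eq₁ : ∀ a ∈ O ∩ attrs G₁, t₁ a = u a := restrict_eq_iff.1 heq₁
    have eq₂ : ∀ a ∈ O ∩ (S ∪ attrs G₂), t₂ a = u a := restrict_eq_iff.1 heq₂
    have agree : restrict S t₁ = restrict S t₂ := restrict_eq_iff.2 fun a ha =>
      (eq₁ a (Finset.mem_inter.2 ⟨hSO ha, h.subset_attrs ha⟩)).trans
        (eq₂ a (Finset.mem_inter.2 ⟨hSO ha, Finset.mem_union_left _ ha⟩)).symm
    obtain ⟨t, ht, ht_left, ht_right⟩ :=
      h.exists_glue (h.satisfies_iff.1 ht₁).1 (h.satisfies_iff.1 ht₂).2 agree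
    refine ⟨t, ht, hu.restrict_eq_self ▸ restrict_eq_iff.2 fun a ha => ?_⟩
    rcases Finset.mem_union.1 (h.attrs_subset (hO ha)) with ha₁ | ha₂
    · exact (ht_left a ha₁).trans (eq₁ a (Finset.mem_inter.2 ⟨ha, ha₁⟩))
    · have ha₂ := Finset.mem_union_right S ha₂
      exact (ht_right a ha₂).trans (eq₂ a (Finset.mem_inter.2 ⟨ha, ha₂⟩))

theorem joinRows_recombine (h : IsSplit Rs G₁ G₂ S) (hwf : ∀ R ∈ Rs, R.WF) {O : Finset V}
    (hSO : S ⊆ O) (hO : O ⊆ attrs Rs) :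
    joinRows [projJoin Rs S, projJoin Rs (O ∩ attrs G₁), projJoin Rs (O ∩ (S ∪ attrs G₂))]
      = (projJoin Rs O).rows := by
  have wf_of_subset {A : Finset V} (hA : A ⊆ O) : (projJoin Rs A).WF :=
    projJoin_wf hwf (hA.trans hO)
  have hattrs : S ∪ (O ∩ attrs G₁ ∪ (O ∩ (S ∪ attrs G₂) ∪ ∅)) = O := by
    rw [Finset.union_empty, ← Finset.inter_union_distrib_left, Finset.inter_eq_left.2,
      Finset.union_eq_right.2 hSO]
    exact (hO.trans h.attrs_subset).trans
      (Finset.union_subset_union_right Finset.subset_union_right)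
  have restrict_mem {u : Tup V D} (hu : u ∈ (projJoin Rs O).rows) :
      restrict S u ∈ (projJoin Rs S).rows :=
    projJoin_rows_proj (Rs := Rs) hSO ▸ Finset.mem_image_of_mem (restrict S) hu
  ext u
  rw [mem_joinRows (List.forall_mem_cons.2 ⟨wf_of_subset hSO, List.forall_mem_cons.2
    ⟨wf_of_subset Finset.inter_subset_left,
      List.forall_mem_singleton.2 (wf_of_subset Finset.inter_subset_left)⟩⟩)]
  simp only [satisfies_cons]
  change HasSchema (S ∪ (O ∩ attrs G₁ ∪ (O ∩ (S ∪ attrs G₂) ∪ ∅))) u ∧ _ ↔ _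
  rw [hattrs]
  refine ⟨fun ⟨hu, _, hu₁, hu₂, _⟩ => (h.mem_projJoin_iff hwf hSO hO).2 ⟨hu, hu₁, hu₂⟩,
    fun hu => ?_⟩
  obtain ⟨hdom, hu₁, hu₂⟩ := (h.mem_projJoin_iff hwf hSO hO).1 hu
  exact ⟨hdom, restrict_mem hu, hu₁, hu₂, by simp [Satisfies]⟩

end IsSplit

end Split

section Light

variable {V D : Type*} [Fintype V] [DecidableEq V] [DecidableEq D] {Rs : List (Table V D)}
  {X : Finset V} {t u : Tup V D}

theorem subset_of_mem_bestCover {p : Fin Rs.length × Finset V} (hp : p ∈ bestCover Rs X) :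
    p.2 ⊆ (Rs.get p.1).schema ∩ X := by
  rw [bestCover] at hp
  split at hp
  case isTrue h => exact h.choose_spec.1.1 p hp
  case isFalse => exact absurd hp (Finset.notMem_empty p)

theorem mem_lightTables {C : Finset (Fin Rs.length × Finset V)} {T : Table V D} :
    T ∈ lightTables Rs X C ↔
      (∃ p ∈ C, (Rs.get p.1).proj p.2 = T) ∨ ∃ R ∈ Rs, R.proj X = T := by
  simp [lightTables]

theorem lightTables_wf (hwf : ∀ R ∈ Rs, R.WF) (X : Finset V)
    (C : Finset (Fin Rs.length × Finset V)) : ∀ T ∈ lightTables Rs X C, T.WF := by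
  intro T hT
  rcases mem_lightTables.1 hT with ⟨p, -, rfl⟩ | ⟨R, hR, rfl⟩
  · exact (hwf _ (List.get_mem _ _)).proj _
  · exact (hwf R hR).proj _

theorem attrs_lightTables (hX : X ⊆ attrs Rs) :
    attrs (lightTables Rs X (bestCover Rs X)) = X := by
  ext a
  refine ⟨fun ha => ?_, fun ha => ?_⟩
  · obtain ⟨T, hT, haT⟩ := mem_attrs.1 ha
    rcases mem_lightTables.1 hT with ⟨p, hp, rfl⟩ | ⟨R, -, rfl⟩
    · exact Finset.mem_of_mem_inter_right
        (subset_of_mem_bestCover hp (Finset.mem_of_mem_inter_right haT))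
    · exact Finset.mem_of_mem_inter_right haT
  · obtain ⟨R, hR, haR⟩ := mem_attrs.1 (hX ha)
    exact mem_attrs.2 ⟨_, mem_lightTables.2 (.inr ⟨R, hR, rfl⟩), Finset.mem_inter.2 ⟨haR, ha⟩⟩

theorem mem_lightRel (hwf : ∀ R ∈ Rs, R.WF) (hX : X ⊆ attrs Rs) :
    u ∈ (lightRel Rs X).rows ↔ HasSchema X u ∧
      ∀ R ∈ Rs, ∃ r ∈ R.rows, restrict X r = restrict (R.schema ∩ X) u := by
  rw [lightRel, mem_joinRows (lightTables_wf hwf X _), attrs_lightTables hX]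
  refine and_congr_right fun _ => ⟨fun h R hR => ?_, fun h T hT => ?_⟩
  · exact Finset.mem_image.1 (h _ (mem_lightTables.2 (.inr ⟨R, hR, rfl⟩)))
  · rcases mem_lightTables.1 hT with ⟨p, hp, rfl⟩ | ⟨R, hR, rfl⟩
    · obtain ⟨r, hr, heq⟩ := h _ (List.get_mem Rs p.1)
      have hsub := subset_of_mem_bestCover hp
      refine Finset.mem_image.2 ⟨r, hr, ?_⟩
      change _ = restrict ((Rs.get p.1).schema ∩ p.2) u
      rw [Finset.inter_eq_right.2 (hsub.trans Finset.inter_subset_left),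
        ← restrict_restrict (hsub.trans Finset.inter_subset_right) r, heq, restrict_restrict hsub]
    · exact Finset.mem_image.2 (h R hR)

theorem lightRel_wf (hwf : ∀ R ∈ Rs, R.WF) (hX : X ⊆ attrs Rs) : (lightRel Rs X).WF :=
  fun _ hr => ((mem_lightRel hwf hX).1 hr).1

theorem mem_lightReduce {T : Table V D} :
    T ∈ lightReduce Rs X ↔ T = lightRel Rs X ∨ (T ∈ Rs ∧ ¬ T.schema ⊆ X) := by
  simp [lightReduce]

theorem lightReduce_wf (hwf : ∀ R ∈ Rs, R.WF) (hX : X ⊆ attrs Rs) :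
    ∀ T ∈ lightReduce Rs X, T.WF := by
  intro T hT
  rcases mem_lightReduce.1 hT with rfl | ⟨hT, -⟩
  · exact lightRel_wf hwf hX
  · exact hwf T hT

theorem map_schema_lightReduce (Rs : List (Table V D)) (X : Finset V) :
    (lightReduce Rs X).map Table.schema
      = X :: (Rs.map Table.schema).filter fun s => ¬ s ⊆ X := by
  rw [lightReduce, List.map_cons, List.filter_map]
  rfl

theorem attrs_lightReduce (hX : X ⊆ attrs Rs) : attrs (lightReduce Rs X) = attrs Rs := by
  ext a
  refine ⟨fun ha => ?_, fun ha => ?_⟩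
  · obtain ⟨T, hT, haT⟩ := mem_attrs.1 ha
    rcases mem_lightReduce.1 hT with rfl | ⟨hT, -⟩
    · exact hX haT
    · exact subset_attrs hT haT
  · obtain ⟨R, hR, haR⟩ := mem_attrs.1 ha
    by_cases hRX : R.schema ⊆ X
    · exact mem_attrs.2 ⟨_, mem_lightReduce.2 (.inl rfl), hRX haR⟩
    · exact mem_attrs.2 ⟨R, mem_lightReduce.2 (.inr ⟨hR, hRX⟩), haR⟩

theorem restrict_schema_mem_of_mem_lightRel (hwf : ∀ R ∈ Rs, R.WF) (hX : X ⊆ attrs Rs)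
    {R : Table V D} (hR : R ∈ Rs) (hRX : R.schema ⊆ X) {u : Tup V D}
    (hu : u ∈ (lightRel Rs X).rows) : restrict R.schema u ∈ R.rows := by
  obtain ⟨r, hr, heq⟩ := ((mem_lightRel hwf hX).1 hu).2 R hR
  rw [Finset.inter_eq_left.2 hRX, (hwf R hR r hr).restrict_eq_self_of_subset hRX] at heq
  exact heq ▸ hr

theorem satisfies_lightReduce (hwf : ∀ R ∈ Rs, R.WF) (hX : X ⊆ attrs Rs) :
    Satisfies (lightReduce Rs X) t ↔ Satisfies Rs t := by
  refine ⟨fun h R hR => ?_, fun h T hT => ?_⟩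
  · by_cases hRX : R.schema ⊆ X
    · rw [← restrict_restrict hRX]
      exact restrict_schema_mem_of_mem_lightRel hwf hX hR hRX (h _ (mem_lightReduce.2 (.inl rfl)))
    · exact h R (mem_lightReduce.2 (.inr ⟨hR, hRX⟩))
  · rcases mem_lightReduce.1 hT with rfl | ⟨hT, -⟩
    · refine (mem_lightRel hwf hX).2 ⟨h.hasSchema_restrict hwf hX, fun R hR => ⟨_, h R hR, ?_⟩⟩
      change _ = restrict _ (restrict X t)
      rw [restrict_restrict Finset.inter_subset_right]
      ext1 a
      simp only [restrict, Finset.mem_inter]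
      split_ifs <;> simp_all
    · exact h T hT

theorem projJoin_lightReduce (hwf : ∀ R ∈ Rs, R.WF) (hX : X ⊆ attrs Rs) (O : Finset V) :
    projJoin (lightReduce Rs X) O = projJoin Rs O :=
  projJoin_congr hwf (lightReduce_wf hwf hX) (attrs_lightReduce hX)
    (fun _ => satisfies_lightReduce hwf hX) O

theorem joinRows_lightReduce (hwf : ∀ R ∈ Rs, R.WF) (hX : X ⊆ attrs Rs) :
    joinRows (lightReduce Rs X) = joinRows Rs := by
  have h := projJoin_lightReduce hwf hX (attrs (lightReduce Rs X))
  rw [projJoin_attrs (lightReduce_wf hwf hX), attrs_lightReduce hX, projJoin_attrs hwf] at h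
  exact congrArg Table.rows h

end Light

section Heavy

variable {V D : Type*} [DecidableEq V] {Rs : List (Table V D)} {X : V} {x t : Tup V D}

theorem merge_restrict_of_hasSchema_singleton (hx : HasSchema {X} x) (O : Finset V)
    (t : Tup V D) :
    merge (restrict O x) (restrict (O.erase X) t) = restrict O (merge x t) := by
  ext1 a
  by_cases haX : a = X
  · subst haX
    have hxa := Option.isSome_iff_exists.1 ((hx a).2 (Finset.mem_singleton_self a))
    obtain ⟨d, hd⟩ := hxa
    by_cases haO : a ∈ O <;> simp [merge, restrict, haO, hd]
  · have hxa : x a = none := by simpa [haX] using hx a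
    by_cases haO : a ∈ O <;> simp [merge, restrict, haO, haX, hxa]

theorem merge_restrict_singleton (X : V) (t : Tup V D) : merge (restrict {X} t) t = t := by
  ext1 a
  by_cases ha : a ∈ ({X} : Finset V) <;> simp [merge, restrict, ha]

variable [Fintype V] [DecidableEq D]

theorem map_schema_heavyReduce (Rs : List (Table V D)) (X : V) (x : Tup V D) :
    (heavyReduce Rs X x).map Table.schema = (Rs.map Table.schema).map fun s => s.erase X := by
  simp only [heavyReduce, List.map_map]
  refine List.map_congr_left fun R _ => ?_
  by_cases h : X ∈ R.schema <;> simp [h, heavySelect]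

theorem attrs_heavyReduce (Rs : List (Table V D)) (X : V) (x : Tup V D) :
    attrs (heavyReduce Rs X x) = (attrs Rs).erase X := by
  ext a
  rw [attrs, map_schema_heavyReduce, mem_unionAll, Finset.mem_erase, mem_attrs]
  simp only [List.mem_map, exists_exists_and_eq_and, Finset.mem_erase]
  tauto

theorem heavyReduce_wf (hwf : ∀ R ∈ Rs, R.WF) (X : V) (x : Tup V D) :
    ∀ T ∈ heavyReduce Rs X x, T.WF := by
  intro T hT
  obtain ⟨R, hR, rfl⟩ := List.mem_map.1 hT
  split
  · intro u hu
    obtain ⟨r, hr, rfl⟩ := Finset.mem_image.1 hu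
    exact (hwf R hR r (Finset.mem_of_mem_filter r hr)).restrict (Finset.erase_subset _ _)
  · exact hwf R hR

theorem mem_heavyVals (hwf : ∀ R ∈ Rs, R.WF) (hX : X ∈ attrs Rs) :
    x ∈ heavyVals Rs X ↔ HasSchema {X} x ∧
      ∀ R ∈ Rs, X ∈ R.schema → x ∈ R.rows.image (restrict {X}) := by
  have mem_heavyRels (R) : R ∈ heavyRels Rs X ↔ R ∈ Rs ∧ X ∈ R.schema := by simp [heavyRels]
  have hattrs : attrs ((heavyRels Rs X).map (Table.proj {X})) = {X} := by
    ext a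
    simp only [mem_attrs, List.mem_map, exists_exists_and_eq_and, mem_heavyRels]
    refine ⟨fun ⟨_, _, ha⟩ => Finset.mem_of_mem_inter_right ha, fun ha => ?_⟩
    obtain rfl := Finset.mem_singleton.1 ha
    obtain ⟨R, hR, haR⟩ := mem_attrs.1 hX
    exact ⟨R, ⟨hR, haR⟩, Finset.mem_inter.2 ⟨haR, ha⟩⟩
  have hwf' : ∀ T ∈ (heavyRels Rs X).map (Table.proj {X}), T.WF := by
    simp only [List.forall_mem_map, mem_heavyRels]
    exact fun R hR => (hwf R hR.1).proj _
  rw [heavyVals, mem_joinRows hwf', hattrs]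
  refine and_congr_right fun hx => ?_
  simp only [Satisfies, List.forall_mem_map, mem_heavyRels, and_imp]
  refine forall₃_congr fun R _ hXR => ?_
  change restrict (R.schema ∩ {X}) x ∈ R.rows.image (restrict {X}) ↔ _
  rw [Finset.inter_eq_right.2 (Finset.singleton_subset_iff.2 hXR), hx.restrict_eq_self]

theorem restrict_mem_heavySelect {R : Table V D} (hR : R.WF) (hX : X ∈ R.schema)
    (hx : HasSchema {X} x) :
    restrict (R.schema.erase X) t ∈ (heavySelect X x R).rows ↔
      restrict R.schema (merge x t) ∈ R.rows := by
  have hxX : (x X).isSome := (hx X).2 (Finset.mem_singleton_self X)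
  have x_eq_none {a : V} (ha : a ≠ X) : x a = none := by simpa [ha] using hx a
  simp only [heavySelect, Finset.mem_image, Finset.mem_filter, restrict_eq_iff]
  refine ⟨fun ⟨r, ⟨hr, hc⟩, heq⟩ => ?_, fun h => ⟨_, ⟨h, fun a => ?_⟩, fun a ha => ?_⟩⟩
  · suffices restrict R.schema (merge x t) = restrict R.schema r by
      rwa [this, (hR r hr).restrict_eq_self]
    refine restrict_eq_iff.2 fun a ha => ?_
    by_cases haX : a = X
    · subst haX
      rw [← hc.merge_apply_right ((hR r hr a).2 ha), merge_apply_left hxX, merge_apply_left hxX]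
    · rw [merge_apply_of_none (x_eq_none haX), heq a (Finset.mem_erase.2 ⟨haX, ha⟩)]
  · by_cases haX : a = X
    · subst haX
      rw [restrict_apply hX, merge_apply_left hxX]
      exact .inr (.inr rfl)
    · exact .inl (x_eq_none haX)
  · obtain ⟨haX, haR⟩ := Finset.mem_erase.1 ha
    rw [restrict_apply haR, merge_apply_of_none (x_eq_none haX)]

theorem satisfies_heavyReduce (hwf : ∀ R ∈ Rs, R.WF) (hx : HasSchema {X} x) :
    Satisfies (heavyReduce Rs X x) t ↔ Satisfies Rs (merge x t) := by
  simp only [Satisfies, heavyReduce, List.forall_mem_map]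
  refine forall₂_congr fun R hR => ?_
  split
  case isTrue hXR => exact restrict_mem_heavySelect (hwf R hR) hXR hx
  case isFalse hXR =>
    rw [restrict_eq_iff.2 fun a ha => (merge_apply_of_none ?_).symm]
    have haX : a ≠ X := fun h => hXR (h ▸ ha)
    simpa [haX] using hx a

theorem biUnion_heavyReduce (hwf : ∀ R ∈ Rs, R.WF) (hX : X ∈ attrs Rs) {O : Finset V}
    (hO : O ⊆ attrs Rs) :
    ((heavyVals Rs X).biUnion fun x =>
      (projJoin (heavyReduce Rs X x) (O.erase X)).rows.image (merge (restrict O x)))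
      = (projJoin Rs O).rows := by
  have hO' (x) : O.erase X ⊆ attrs (heavyReduce Rs X x) :=
    attrs_heavyReduce Rs X x ▸ Finset.erase_subset_erase X hO
  ext u
  simp only [Finset.mem_biUnion, Finset.mem_image, mem_projJoin (heavyReduce_wf hwf X _) (hO' _),
    mem_projJoin hwf hO]
  constructor
  · rintro ⟨x, hx, _, ⟨t, ht, rfl⟩, rfl⟩
    have hxX := ((mem_heavyVals hwf hX).1 hx).1
    exact ⟨_, (satisfies_heavyReduce hwf hxX).1 ht,
      (merge_restrict_of_hasSchema_singleton hxX O t).symm⟩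
  · rintro ⟨t, ht, rfl⟩
    have hx : HasSchema {X} (restrict {X} t) :=
      ht.hasSchema_restrict hwf (Finset.singleton_subset_iff.2 hX)
    refine ⟨restrict {X} t, (mem_heavyVals hwf hX).2 ⟨hx, fun R hR hXR => ?_⟩,
      _, ⟨t, ?_, rfl⟩, ?_⟩
    · exact Finset.mem_image.2
        ⟨_, ht R hR, restrict_restrict (Finset.singleton_subset_iff.2 hXR) t⟩
    · rwa [satisfies_heavyReduce hwf hx, merge_restrict_singleton]
    · rw [merge_restrict_of_hasSchema_singleton hx, merge_restrict_singleton]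

end Heavy

section Plans

theorem pick_map {α β : Type*} (f : α → β) (m : ℕ → Bool) (l : List α) :
    pick m (l.map f) = (pick m l).map f := by
  induction l generalizing m with
  | nil => rfl
  | cons a l ih =>
    simp only [List.map_cons, pick, ih]
    split <;> rfl

theorem mem_pick {α : Type*} {m : ℕ → Bool} {l : List α} {x : α} :
    x ∈ pick m l ↔ ∃ i, ∃ h : i < l.length, m i = true ∧ l[i] = x := by
  induction l generalizing m with
  | nil => simp [pick]
  | cons a l ih =>
    have succ_iff : (∃ i, ∃ h : i < (a :: l).length, m i = true ∧ (a :: l)[i] = x) ↔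
        (m 0 = true ∧ a = x) ∨ x ∈ pick (fun n => m (n + 1)) l := by
      rw [ih]
      refine ⟨fun ⟨i, hi, hm, hx⟩ => ?_, ?_⟩
      · cases i with
        | zero => exact .inl ⟨hm, hx⟩
        | succ i => exact .inr ⟨i, by simpa using hi, hm, by simpa using hx⟩
      · rintro (⟨hm, hx⟩ | ⟨i, hi, hm, hx⟩)
        · exact ⟨0, by simp, hm, hx⟩
        · exact ⟨i + 1, by simpa using hi, hm, by simpa using hx⟩
    rw [succ_iff, pick]
    by_cases hm : m 0 = true
    · simp only [hm, if_true, true_and, List.mem_cons, eq_comm]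
    · simp only [hm, if_false, false_and, false_or, Bool.false_eq_true]

variable {V D : Type*} [DecidableEq V]

theorem unionAll_pick (m : ℕ → Bool) (Rs : List (Table V D)) :
    unionAll (pick m (Rs.map Table.schema)) = attrs (pick m Rs) := by
  rw [attrs, pick_map]

theorem Plan.Separates.isSplit {S : Finset V} {m₁ m₂ : ℕ → Bool} {Rs : List (Table V D)}
    (h : Plan.Separates S m₁ m₂ (Rs.map Table.schema)) :
    IsSplit Rs (pick m₁ Rs) (pick m₂ Rs) S := by
  obtain ⟨hcover, hinter, hsubset⟩ := h
  rw [unionAll_pick] at hinter hsubset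
  rw [unionAll_pick] at hinter
  refine ⟨fun R => ?_, hinter, hsubset⟩
  simp only [mem_pick]
  constructor
  · intro hR
    obtain ⟨i, hi, rfl⟩ := List.mem_iff_getElem.1 hR
    exact (hcover i (by simpa using hi)).imp (⟨i, hi, ·, rfl⟩) (⟨i, hi, ·, rfl⟩)
  · rintro (⟨i, hi, -, rfl⟩ | ⟨i, hi, -, rfl⟩) <;> exact List.getElem_mem hi

variable [Fintype V] [DecidableEq D]

variable {Rs : List (Table V D)} {S O : Finset V} {m₁ m₂ : ℕ → Bool} {p₁ p₂ p₃ : Plan V}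

theorem splitOut_reduced (hs : IsSplit Rs (pick m₁ Rs) (pick m₂ Rs) S) (hwf : ∀ R ∈ Rs, R.WF)
    {A : Finset V} (hSA : S ⊆ A) :
    (⟨S, (projJoin (pick m₁ Rs) S).rows ∩ ((projJoin Rs A).proj S).rows⟩ : Table V D)
      = projJoin Rs S := by
  rw [projJoin_rows_proj hSA, Finset.inter_eq_right.2 (hs.projJoin_subset hwf hs.subset_attrs)]
  rfl

theorem Plan.splitOut_spec (hs : IsSplit Rs (pick m₁ Rs) (pick m₂ Rs) S)
    (hwf : ∀ R ∈ Rs, R.WF) (hSO : S ⊆ O) (hO : O ⊆ attrs Rs)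
    (h₁ : p₁.out (pick m₁ Rs) S = projJoin (pick m₁ Rs) S)
    (h₂ : p₂.out (projJoin (pick m₁ Rs) S :: pick m₂ Rs) (O ∩ (S ∪ attrs (pick m₂ Rs)))
      = projJoin (projJoin (pick m₁ Rs) S :: pick m₂ Rs) (O ∩ (S ∪ attrs (pick m₂ Rs))))
    (h₃ : p₃.out (projJoin Rs S :: pick m₁ Rs) (O ∩ attrs (pick m₁ Rs))
      = projJoin (projJoin Rs S :: pick m₁ Rs) (O ∩ attrs (pick m₁ Rs))) :
    (splitOut S m₁ m₂ p₁ p₂ p₃).out Rs O = projJoin Rs O ∧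
    (splitOut S m₁ m₂ p₁ p₂ p₃).steps Rs O =
      p₁.steps (pick m₁ Rs) S
        + p₂.steps (projJoin (pick m₁ Rs) S :: pick m₂ Rs) (O ∩ (S ∪ attrs (pick m₂ Rs)))
        + tableSize [projJoin (pick m₁ Rs) S, projJoin Rs (O ∩ (S ∪ attrs (pick m₂ Rs)))]
        + p₃.steps (projJoin Rs S :: pick m₁ Rs) (O ∩ attrs (pick m₁ Rs))
        + joinSteps [projJoin Rs S, projJoin Rs (O ∩ attrs (pick m₁ Rs)),
            projJoin Rs (O ∩ (S ∪ attrs (pick m₂ Rs)))] := by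
  have hSA : S ⊆ O ∩ (S ∪ attrs (pick m₂ Rs)) :=
    Finset.subset_inter hSO Finset.subset_union_left
  rw [hs.projJoin_cons_right hwf Finset.inter_subset_right] at h₂
  rw [hs.projJoin_cons_left hwf Finset.inter_subset_right] at h₃
  simp only [out, steps, h₁, h₂, splitOut_reduced hs hwf hSA, h₃, hs.joinRows_recombine hwf hSO hO,
    and_true]
  rfl

theorem Plan.valid_splitOut_iff : (splitOut S m₁ m₂ p₁ p₂ p₃).Valid (Rs.map Table.schema) O ↔
    Separates S m₁ m₂ (Rs.map Table.schema) ∧ S ⊆ O ∧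
    p₁.Valid ((pick m₁ Rs).map Table.schema) S ∧
    p₂.Valid ((projJoin (pick m₁ Rs) S :: pick m₂ Rs).map Table.schema)
      (O ∩ (S ∪ attrs (pick m₂ Rs))) ∧
    p₃.Valid ((projJoin Rs S :: pick m₁ Rs).map Table.schema) (O ∩ attrs (pick m₁ Rs)) := by
  rw [Valid, unionAll_pick, unionAll_pick, pick_map, pick_map]
  rfl

theorem Plan.out_eq (p : Plan V) (hwf : ∀ R ∈ Rs, R.WF) (hO : O ⊆ attrs Rs)
    (hv : p.Valid (Rs.map Table.schema) O) : p.out Rs O = projJoin Rs O := by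
  induction p generalizing Rs O with
  | done => rfl
  | heavy X p ih =>
    have ih' (x) := ih (heavyReduce_wf hwf X x)
      (attrs_heavyReduce Rs X x ▸ Finset.erase_subset_erase X hO)
      (map_schema_heavyReduce Rs X x ▸ hv.2)
    simp only [Plan.out, ih', biUnion_heavyReduce hwf hv.1 hO]
    rfl
  | light X p ih =>
    have hX : X ⊆ attrs Rs := hv.1
    rw [Plan.out, ih (lightReduce_wf hwf hX) (by rwa [attrs_lightReduce hX])
      (map_schema_lightReduce Rs X ▸ hv.2)]
    exact projJoin_lightReduce hwf hX O
  | splitOut S m₁ m₂ p₁ p₂ p₃ ih₁ ih₂ ih₃ =>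
    obtain ⟨hsep, hSO, hv₁, hv₂, hv₃⟩ := valid_splitOut_iff.1 hv
    have hs := hsep.isSplit
    have hwf₁ : ∀ R ∈ pick m₁ Rs, R.WF := fun R hR => hwf R (hs.left_subset hR)
    have hwf₂ : ∀ R ∈ pick m₂ Rs, R.WF := fun R hR => hwf R (hs.right_subset hR)
    have hRS := projJoin_wf hwf₁ hs.subset_attrs
    have hRS' := projJoin_wf hwf (hSO.trans hO)
    exact (splitOut_spec hs hwf hSO hO (ih₁ hwf₁ hs.subset_attrs hv₁)
      (ih₂ (List.forall_mem_cons.2 ⟨hRS, hwf₂⟩) Finset.inter_subset_right hv₂)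
      (ih₃ (List.forall_mem_cons.2 ⟨hRS', hwf₁⟩)
        (Finset.inter_subset_right.trans Finset.subset_union_right) hv₃)).1
  | splitProj S m₁ m₂ p₁ p₂ ih₁ ih₂ =>
    obtain ⟨hsep, hO₂, hv₁, hv₂⟩ := hv
    have hs := hsep.isSplit
    rw [unionAll_pick] at hO₂
    rw [pick_map] at hv₁ hv₂
    have hwf₁ : ∀ R ∈ pick m₁ Rs, R.WF := fun R hR => hwf R (hs.left_subset hR)
    have hwf₂ : ∀ R ∈ pick m₂ Rs, R.WF := fun R hR => hwf R (hs.right_subset hR)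
    have hO' : O ⊆ S ∪ attrs (pick m₂ Rs) := hO₂.trans Finset.subset_union_right
    rw [Plan.out, ih₁ hwf₁ hs.subset_attrs hv₁, ih₂ (List.forall_mem_cons.2
      ⟨projJoin_wf hwf₁ hs.subset_attrs, hwf₂⟩) hO' hv₂, hs.projJoin_cons_right hwf hO']

theorem Plan.steps_splitOut (hwf : ∀ R ∈ Rs, R.WF) (hO : O ⊆ attrs Rs)
    (hv : (splitOut S m₁ m₂ p₁ p₂ p₃).Valid (Rs.map Table.schema) O) :
    (splitOut S m₁ m₂ p₁ p₂ p₃).steps Rs O =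
      p₁.steps (pick m₁ Rs) S
        + p₂.steps (projJoin (pick m₁ Rs) S :: pick m₂ Rs) (O ∩ (S ∪ attrs (pick m₂ Rs)))
        + tableSize [projJoin (pick m₁ Rs) S, projJoin Rs (O ∩ (S ∪ attrs (pick m₂ Rs)))]
        + p₃.steps (projJoin Rs S :: pick m₁ Rs) (O ∩ attrs (pick m₁ Rs))
        + joinSteps [projJoin Rs S, projJoin Rs (O ∩ attrs (pick m₁ Rs)),
            projJoin Rs (O ∩ (S ∪ attrs (pick m₂ Rs)))] := by
  obtain ⟨hsep, hSO, hv₁, hv₂, hv₃⟩ := valid_splitOut_iff.1 hv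
  have hs := hsep.isSplit
  have hwf₁ : ∀ R ∈ pick m₁ Rs, R.WF := fun R hR => hwf R (hs.left_subset hR)
  have hwf₂ : ∀ R ∈ pick m₂ Rs, R.WF := fun R hR => hwf R (hs.right_subset hR)
  have hRS : (projJoin (pick m₁ Rs) S).WF := projJoin_wf hwf₁ hs.subset_attrs
  have hRS' : (projJoin Rs S).WF := projJoin_wf hwf (hSO.trans hO)
  exact (splitOut_spec hs hwf hSO hO (out_eq p₁ hwf₁ hs.subset_attrs hv₁)
    (out_eq p₂ (List.forall_mem_cons.2 ⟨hRS, hwf₂⟩) Finset.inter_subset_right hv₂)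
    (out_eq p₃ (List.forall_mem_cons.2 ⟨hRS', hwf₁⟩)
      (Finset.inter_subset_right.trans Finset.subset_union_right) hv₃)).2

end Plans

/-! ## Degree-based packing -/

section NestedLoop

variable {V D : Type*} [Fintype V] [DecidableEq V] [DecidableEq D] {R R' : Table V D}
  {Rs F : List (Table V D)} {X B : Finset V} {t : Tup V D} {u : V → ℝ}

theorem maxDeg_mono (h : R'.rows ⊆ R.rows) (A : Finset V) : maxDeg R' A ≤ maxDeg R A :=
  Finset.sup_le fun _ ht => (Finset.card_le_card (Finset.filter_subset_filter _ h)).trans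
    (Finset.le_sup (f := fun t => deg (restrict A t) R.rows A) (h ht))

theorem Table.WF.maxDeg_schema_le (hR : R.WF) : maxDeg R R.schema ≤ 1 := by
  refine Finset.sup_le fun t _ => Finset.card_le_one.2 fun a ha b hb => ?_
  rw [Finset.mem_filter] at ha hb
  rw [← (hR a ha.1).restrict_eq_self, ← (hR b hb.1).restrict_eq_self, ha.2, hb.2]

theorem Table.WF.card_filter_compat_le (hR : R.WF) (ht : ∀ a ∈ B, (t a).isSome) :
    (R.rows.filter (Compat t)).card ≤ maxDeg R (R.schema ∩ B) := by
  rcases (R.rows.filter (Compat t)).eq_empty_or_nonempty with hempty | ⟨r₀, h₀⟩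
  · simp [hempty]
  have restrict_eq : ∀ r ∈ R.rows.filter (Compat t),
      restrict (R.schema ∩ B) r = restrict (R.schema ∩ B) t := fun r hr => by
    obtain ⟨hrR, hcompat⟩ := Finset.mem_filter.1 hr
    refine restrict_eq_iff.2 fun a ha => ?_
    obtain ⟨haR, haB⟩ := Finset.mem_inter.1 ha
    rw [← hcompat.merge_apply_right ((hR r hrR a).2 haR), merge_apply_left (ht a haB)]
  refine le_trans (Finset.card_le_card fun r hr => ?_)
    (Finset.le_sup (f := fun t => deg (restrict (R.schema ∩ B) t) R.rows (R.schema ∩ B))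
      (Finset.mem_filter.1 h₀).1)
  exact Finset.mem_filter.2
    ⟨(Finset.mem_filter.1 hr).1, (restrict_eq r hr).trans (restrict_eq r₀ h₀).symm⟩

omit [DecidableEq V] in
theorem loopSteps_cons_le {M : ℝ}
    (h : ∀ r ∈ R.rows.filter (Compat t), (loopSteps Rs (merge t r) : ℝ) ≤ M) :
    (loopSteps (R :: Rs) t : ℝ) ≤ 1 + (R.rows.filter (Compat t)).card * M := by
  rw [loopSteps, ← nsmul_eq_mul]
  push_cast
  gcongr
  exact Finset.sum_le_card_nsmul _ _ _ h

omit [DecidableEq V] in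
theorem loopSteps_le_of_schema_subset (hF : ∀ T ∈ F, T.WF) (hFB : ∀ T ∈ F, T.schema ⊆ B)
    (ht : ∀ a ∈ B, (t a).isSome) : (loopSteps F t : ℝ) ≤ F.length + 1 := by
  classical
  induction F generalizing t with
  | nil => simp [loopSteps]
  | cons R F ih =>
    rw [List.forall_mem_cons] at hF hFB
    have hcard : ((R.rows.filter (Compat t)).card : ℝ) ≤ 1 := by
      have := hF.1.card_filter_compat_le ht
      rw [Finset.inter_eq_left.2 hFB.1] at this
      exact_mod_cast this.trans hF.1.maxDeg_schema_le
    refine (loopSteps_cons_le fun r _ =>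
      ih hF.2 hFB.2 fun a ha => isSome_merge.2 (.inl (ht a ha))).trans ?_
    rw [List.length_cons]
    push_cast
    nlinarith [F.length.cast_nonneg (α := ℝ)]

omit [Fintype V] in
theorem exp_sum_sdiff {A : Finset V} (hA : A ⊆ X) (B : Finset V) (u : V → ℝ) :
    Real.exp (∑ a ∈ X \ B, u a)
      = Real.exp (∑ a ∈ A \ B, u a) * Real.exp (∑ a ∈ X \ (B ∪ A), u a) := by
  rw [← Real.exp_add, ← Finset.sum_sdiff (Finset.sdiff_subset_sdiff hA (le_refl B)), add_comm]
  congr 3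
  ext a
  simp only [Finset.mem_sdiff, Finset.mem_union]
  tauto

/-- Joining the tables `Ts` one after the other binds the attributes of `X`, and a table whose
attributes outside `B` are new multiplies the number of partial tuples by its degree; once `X` is
bound, each filter in `F` keeps at most one row. -/
theorem loopSteps_append_le (hu : ∀ a ∈ X, 0 ≤ u a)
    (hF : ∀ T ∈ F, T.WF) (hFX : ∀ T ∈ F, T.schema ⊆ X)
    {Ts : List (Table V D)} (hTs : ∀ T ∈ Ts, T.WF) (hTX : ∀ T ∈ Ts, T.schema ⊆ X)
    (hdeg : ∀ T ∈ Ts, ∀ A' ⊆ T.schema,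
      (maxDeg T (T.schema \ A') : ℝ) ≤ 2 * Real.exp (∑ a ∈ A', u a))
    (hB : X ⊆ B ∪ attrs Ts) (ht : ∀ a ∈ B, (t a).isSome) :
    (loopSteps (Ts ++ F) t : ℝ)
      ≤ (Ts.length + F.length + 1) * 2 ^ Ts.length * Real.exp (∑ a ∈ X \ B, u a) := by
  have one_le_exp (B) : 1 ≤ Real.exp (∑ a ∈ X \ B, u a) :=
    Real.one_le_exp (Finset.sum_nonneg fun a ha => hu a (Finset.mem_sdiff.1 ha).1)
  induction Ts generalizing B t with
  | nil =>
    have hXB : X ⊆ B := by simpa [attrs, unionAll] using hB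
    have hfilter := loopSteps_le_of_schema_subset hF (fun T hT => (hFX T hT).trans hXB) ht
    simp only [List.nil_append, List.length_nil, pow_zero, Nat.cast_zero, zero_add, mul_one]
    exact hfilter.trans (le_mul_of_one_le_right (by positivity) (one_le_exp B))
  | cons R Ts ih =>
    rw [List.forall_mem_cons] at hTs hTX hdeg
    set E := Real.exp (∑ a ∈ X \ B, u a)
    set E' := Real.exp (∑ a ∈ X \ (B ∪ R.schema), u a)
    set N : ℝ := Ts.length + F.length + 1
    have hrec : ∀ r ∈ R.rows.filter (Compat t),
        (loopSteps (Ts ++ F) (merge t r) : ℝ) ≤ N * 2 ^ Ts.length * E' := fun r hr => by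
      refine ih hTs.2 hTX.2 hdeg.2 (by rwa [attrs_cons, ← Finset.union_assoc] at hB) fun a ha => ?_
      exact isSome_merge.2 ((Finset.mem_union.1 ha).imp (ht a)
        (hTs.1 r (Finset.mem_filter.1 hr).1 a).2)
    have hcard : ((R.rows.filter (Compat t)).card : ℝ)
        ≤ 2 * Real.exp (∑ a ∈ R.schema \ B, u a) := by
      have hcompat := hTs.1.card_filter_compat_le ht
      rw [← Finset.sdiff_sdiff_self_left] at hcompat
      exact (Nat.cast_le.2 hcompat).trans (hdeg.1 _ Finset.sdiff_subset)
    calc (loopSteps (R :: Ts ++ F) t : ℝ)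
        ≤ 1 + (R.rows.filter (Compat t)).card * (N * 2 ^ Ts.length * E') := loopSteps_cons_le hrec
      _ ≤ 1 + 2 * Real.exp (∑ a ∈ R.schema \ B, u a) * (N * 2 ^ Ts.length * E') := by gcongr
      _ = 1 + N * 2 ^ (Ts.length + 1) * E := by rw [show E = _ from exp_sum_sdiff hTX.1 B u]; ring
      _ ≤ 2 ^ (Ts.length + 1) * E + N * 2 ^ (Ts.length + 1) * E := by
        gcongr
        exact one_le_mul_of_one_le_of_one_le (one_le_pow₀ one_le_two) (one_le_exp B)
      _ = _ := by rw [List.length_cons]; push_cast; ring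

end NestedLoop

section Covers

theorem neg_log_two_le_log_half (k : ℕ) : -Real.log 2 ≤ Real.log ((k : ℝ) / 2) := by
  rcases k.eq_zero_or_pos with rfl | hk
  · simp [Real.log_nonneg]
  · rw [← Real.log_inv, ← one_div]
    gcongr
    exact_mod_cast hk

variable {V D : Type*} [Fintype V] [DecidableEq V] [DecidableEq D] {R R' : Table V D}
  {Rs : List (Table V D)} {X A A' : Finset V} {a : V} {v : V → ℝ}
  {C : Finset (Fin Rs.length × Finset V)}

/-- The vector `v` satisfies the constraints that a pair `(R, A)` of a cover contributes to the
linear program, with bucket range `2` and natural logarithms as in `coverValue`. -/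
def Table.PackedBy (R : Table V D) (A : Finset V) (v : V → ℝ) : Prop :=
  ∀ A' ⊆ A, Real.log ((maxDeg (R.proj A) (A \ A') : ℝ) / 2) ≤ ∑ a ∈ A', v a

namespace Table.PackedBy

theorem neg_log_two_le (h : R.PackedBy A v) (ha : a ∈ A) : -Real.log 2 ≤ v a := by
  simpa using (neg_log_two_le_log_half _).trans (h {a} (by simpa using ha))

theorem maxDeg_le (h : R.PackedBy A v) (hA' : A' ⊆ A) :
    (maxDeg (R.proj A) (A \ A') : ℝ) ≤ 2 * Real.exp (∑ a ∈ A', v a) := by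
  rcases (maxDeg (R.proj A) (A \ A')).eq_zero_or_pos with hzero | hpos
  · rw [hzero, Nat.cast_zero]
    positivity
  · rw [← div_le_iff₀' two_pos, ← Real.log_le_iff_le_exp (by positivity)]
    exact h A' hA'

/-- Since `Real.log 0 = 0`, the constraints of an empty table say that the partial sums of `v` are
nonnegative. -/
theorem mono_rows (h : R.PackedBy A v) (hv : ∀ a, 0 ≤ v a) (hR : R'.rows ⊆ R.rows) :
    R'.PackedBy A v := fun A' hA' => by
  have hle := maxDeg_mono (R := R.proj A) (R' := R'.proj A) (Finset.image_subset_image hR) (A \ A')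
  rcases (maxDeg (R'.proj A) (A \ A')).eq_zero_or_pos with hzero | hpos
  · simpa [hzero] using Finset.sum_nonneg fun b _ => hv b
  · refine le_trans (Real.log_le_log (by positivity) ?_) (h A' hA')
    gcongr

end Table.PackedBy

theorem maxDeg_proj_self_le (R : Table V D) (A : Finset V) : maxDeg (R.proj A) A ≤ 1 := by
  refine Finset.sup_le fun t _ => Finset.card_le_one.2 fun b hb c hc => ?_
  have restrict_eq : ∀ r ∈ (R.proj A).rows, restrict A r = r := fun r hr => by
    obtain ⟨s, -, rfl⟩ := Finset.mem_image.1 hr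
    exact restrict_restrict subset_rfl s
  rw [Finset.mem_filter] at hb hc
  rw [← restrict_eq b hb.1, ← restrict_eq c hc.1, hb.2, hc.2]

theorem exists_packedBy (Rs : List (Table V D)) (C : Finset (Fin Rs.length × Finset V)) :
    ∃ v, ∀ p ∈ C, (Rs.get p.1).PackedBy p.2 v := by
  set f : Fin Rs.length × Finset V × Finset V → ℝ := fun q =>
    Real.log ((maxDeg ((Rs.get q.1).proj q.2.1) (q.2.1 \ q.2.2) : ℝ) / 2)
  refine ⟨fun _ => ∑ q, |f q|, fun p _ A' _ => ?_⟩
  rcases A'.eq_empty_or_nonempty with rfl | hne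
  · rw [Finset.sum_empty, Finset.sdiff_empty]
    have : (maxDeg ((Rs.get p.1).proj p.2) p.2 : ℝ) ≤ 1 := by
      exact_mod_cast maxDeg_proj_self_le _ _
    exact Real.log_nonpos (by positivity) (by linarith)
  · calc f (p.1, p.2, A') ≤ |f (p.1, p.2, A')| := le_abs_self _
      _ ≤ ∑ q, |f q| := Finset.single_le_sum (f := fun q => |f q|)
        (fun _ _ => abs_nonneg _) (Finset.mem_univ _)
      _ ≤ ∑ _a ∈ A', ∑ q, |f q| := by
        rw [Finset.sum_const, nsmul_eq_mul]
        exact le_mul_of_one_le_left (Finset.sum_nonneg fun _ _ => abs_nonneg _)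
          (by exact_mod_cast hne.card_pos)

omit [Fintype V] [DecidableEq D] in
theorem IsCover.exists_mem (hC : IsCover Rs X C) (ha : a ∈ X) : ∃ p ∈ C, a ∈ p.2 := by
  rwa [← hC.2, Finset.mem_biUnion] at ha

theorem IsCover.schema_proj (hC : IsCover Rs X C) {p : Fin Rs.length × Finset V} (hp : p ∈ C) :
    ((Rs.get p.1).proj p.2).schema = p.2 :=
  Finset.inter_eq_right.2 ((hC.1 p hp).trans Finset.inter_subset_left)

theorem IsCover.subset_attrs_map_proj (hC : IsCover Rs X C) :
    X ⊆ attrs (C.toList.map fun p => (Rs.get p.1).proj p.2) := fun a ha => by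
  obtain ⟨p, hp, hap⟩ := hC.exists_mem ha
  exact mem_attrs.2 ⟨_, List.mem_map.2 ⟨p, by simpa using hp, rfl⟩, by rwa [hC.schema_proj hp]⟩

theorem IsCover.coverValue_le (hC : IsCover Rs X C)
    (hv : ∀ p ∈ C, (Rs.get p.1).PackedBy p.2 v) : coverValue Rs X C ≤ ∑ a ∈ X, v a := by
  refine csInf_le ⟨∑ _a ∈ X, -Real.log 2, ?_⟩ ⟨v, hv, rfl⟩
  rintro _ ⟨w, hw, rfl⟩
  refine Finset.sum_le_sum fun a ha => ?_
  obtain ⟨p, hp, hap⟩ := hC.exists_mem ha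
  exact Table.PackedBy.neg_log_two_le (hw p hp) hap

theorem IsCover.dbpBound_le (hC : IsCover Rs X C) :
    dbpBound Rs X ≤ Real.exp (coverValue Rs X C) := by
  refine Real.exp_le_exp.2 (csInf_le (Set.Finite.bddBelow ?_) ⟨C, hC, rfl⟩)
  refine (Set.finite_range (coverValue Rs X)).subset ?_
  rintro _ ⟨C, -, rfl⟩
  exact ⟨C, rfl⟩

omit [DecidableEq D] in
theorem isCover_filter {p : Fin Rs.length × Finset V → Prop} [DecidablePred p]
    (h : ∀ a ∈ X, ∃ i A, A ⊆ (Rs.get i).schema ∩ X ∧ p (i, A) ∧ a ∈ A) :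
    IsCover Rs X (Finset.univ.filter fun q => q.2 ⊆ (Rs.get q.1).schema ∩ X ∧ p q) := by
  refine ⟨fun q hq => (Finset.mem_filter.1 hq).2.1, Finset.Subset.antisymm ?_ fun a ha => ?_⟩
  · exact Finset.biUnion_subset.2 fun q hq =>
      (Finset.mem_filter.1 hq).2.1.trans Finset.inter_subset_right
  · obtain ⟨i, A, hA, hp, haA⟩ := h a ha
    exact Finset.mem_biUnion.2 ⟨(i, A), Finset.mem_filter.2 ⟨Finset.mem_univ _, hA, hp⟩, haA⟩

theorem bestCover_spec (h : ∃ C, IsCover Rs X C) :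
    IsCover Rs X (bestCover Rs X) ∧
      ∀ C, IsCover Rs X C → coverValue Rs X (bestCover Rs X) ≤ coverValue Rs X C := by
  classical
  have hbest : ∃ C, IsCover Rs X C ∧
      ∀ C', IsCover Rs X C' → coverValue Rs X C ≤ coverValue Rs X C' := by
    obtain ⟨C, hC, hmin⟩ := (Set.toFinite {C | IsCover Rs X C}).exists_minimalFor
      (coverValue Rs X) _ h
    exact ⟨C, hC, fun C' h' => (le_total _ _).elim id (hmin h')⟩
  rw [bestCover, dif_pos hbest]
  exact hbest.choose_spec

end Covers

section Packs

variable {V D : Type*} [Fintype V] [DecidableEq V] [DecidableEq D]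
  {Rs Rs' : List (Table V D)} {X : Finset V} {N N' : ℝ}

/-- The tables `Rs` contain projections that cover `X`, together with a nonnegative solution of
their linear program of value at most `log N`; then `N` bounds the cost of the Light transform on
`X`. -/
def Packs (Rs : List (Table V D)) (X : Finset V) (N : ℝ) : Prop :=
  ∃ v : V → ℝ, (∀ a, 0 ≤ v a) ∧ ∑ a ∈ X, v a ≤ Real.log N ∧
    ∀ a ∈ X, ∃ T ∈ Rs, ∃ A ⊆ T.schema ∩ X, a ∈ A ∧ T.PackedBy A v

namespace Packs

theorem mono (h : Packs Rs X N) (hN : 0 < N) (hNN : N ≤ N') : Packs Rs X N' := by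
  obtain ⟨v, v_nonneg, hsum, hcover⟩ := h
  exact ⟨v, v_nonneg, hsum.trans (Real.log_le_log hN hNN), hcover⟩

theorem of_rows_subset (h : Packs Rs X N)
    (hRs : ∀ T ∈ Rs, ∃ T' ∈ Rs', T'.schema = T.schema ∧ T'.rows ⊆ T.rows) : Packs Rs' X N := by
  obtain ⟨v, v_nonneg, hsum, hcover⟩ := h
  refine ⟨v, v_nonneg, hsum, fun a ha => ?_⟩
  obtain ⟨T, hT, A, hA, haA, hv⟩ := hcover a ha
  obtain ⟨T', hT', hschema, hrows⟩ := hRs T hT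
  exact ⟨T', hT', A, hschema ▸ hA, haA, hv.mono_rows v_nonneg hrows⟩

theorem exists_cover (h : Packs Rs X N) :
    ∃ C, IsCover Rs X C ∧ coverValue Rs X C ≤ Real.log N := by
  classical
  obtain ⟨v, -, hsum, hcover⟩ := h
  have hC := isCover_filter (Rs := Rs) (X := X)
    (p := fun q => (Rs.get q.1).PackedBy q.2 v) fun a ha => by
      obtain ⟨T, hT, A, hA, haA, hv⟩ := hcover a ha
      obtain ⟨i, rfl⟩ := List.mem_iff_get.1 hT
      exact ⟨i, A, hA, hv, haA⟩
  exact ⟨_, hC, (hC.coverValue_le fun p hp => (Finset.mem_filter.1 hp).2.2).trans hsum⟩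

theorem dbpBound_le (h : Packs Rs X N) (hN : 0 < N) : dbpBound Rs X ≤ N := by
  obtain ⟨C, hC, hv⟩ := h.exists_cover
  rw [← Real.exp_log hN]
  exact hC.dbpBound_le.trans (Real.exp_le_exp.2 hv)

end Packs

end Packs

section LightCost

/-- The constant in the bound for the nested loop of a Light transform on `n` relations. -/
def loopConst (V : Type*) [Fintype V] (n : ℕ) : ℕ :=
  (n * 2 ^ Fintype.card V + n + 1) * 2 ^ (n * 2 ^ Fintype.card V) * 2 ^ Fintype.card V

/-- The constant in the bound for the cost of a Light transform on `n` relations. -/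
def lightConst (V : Type*) [Fintype V] (n : ℕ) : ℕ :=
  2 ^ Fintype.card V * 2 ^ Fintype.card V * n + (n * 2 ^ Fintype.card V + n) + loopConst V n

variable {V D : Type*} [Fintype V]

theorem card_finset_prod_le {n : ℕ} (C : Finset (Fin n × Finset V)) :
    C.card ≤ n * 2 ^ Fintype.card V :=
  (Finset.card_le_univ C).trans_eq (by simp)

theorem loop_factor_le {n : ℕ} (C : Finset (Fin n × Finset V)) (X : Finset V) :
    (C.card + n + 1 : ℝ) * 2 ^ C.card * 2 ^ X.card ≤ loopConst V n := by
  rw [loopConst]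
  push_cast
  gcongr
  · exact_mod_cast card_finset_prod_le C
  · exact one_le_two
  · exact card_finset_prod_le C
  · exact one_le_two
  · exact Finset.card_le_univ X

omit [Fintype V] in
theorem tableSize_le {Rs : List (Table V D)} {N : ℕ} (h : ∀ R ∈ Rs, R.rows.card ≤ N) :
    tableSize Rs ≤ Rs.length * N := by
  simpa [tableSize] using
    List.sum_le_card_nsmul (Rs.map fun R => R.rows.card) N (by simpa using h)

variable [DecidableEq V] [DecidableEq D] {Rs : List (Table V D)} {X : Finset V}
  {C : Finset (Fin Rs.length × Finset V)} {N : ℝ}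

theorem loopSteps_lightTables_le_exp (hwf : ∀ R ∈ Rs, R.WF) (hC : IsCover Rs X C) {v : V → ℝ}
    (hv : ∀ p ∈ C, (Rs.get p.1).PackedBy p.2 v) :
    (loopSteps (lightTables Rs X C) emptyTup : ℝ)
      ≤ loopConst V Rs.length * Real.exp (∑ a ∈ X, v a) := by
  have hexp : Real.exp (∑ a ∈ X, (v a + Real.log 2))
      = 2 ^ X.card * Real.exp (∑ a ∈ X, v a) := by
    rw [Finset.sum_add_distrib, Finset.sum_const, Real.exp_add, Real.exp_nsmul,
      Real.exp_log two_pos, mul_comm]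
  have hloop := loopSteps_append_le (X := X) (u := fun a => v a + Real.log 2) (B := ∅)
    (t := (emptyTup : Tup V D)) (F := Rs.map (Table.proj X))
    (Ts := C.toList.map fun p => (Rs.get p.1).proj p.2)
    (fun a ha => by
      obtain ⟨p, hp, hap⟩ := hC.exists_mem ha
      linarith [(hv p hp).neg_log_two_le hap])
    (List.forall_mem_map.2 fun R hR => (hwf R hR).proj X)
    (List.forall_mem_map.2 fun R _ => Finset.inter_subset_right)
    (List.forall_mem_map.2 fun p _ => (hwf _ (List.get_mem _ _)).proj _)
    (List.forall_mem_map.2 fun p hp => by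
      rw [Finset.mem_toList] at hp
      exact (hC.schema_proj hp).trans_subset ((hC.1 p hp).trans Finset.inter_subset_right))
    (List.forall_mem_map.2 fun p hp A' hA' => by
      rw [Finset.mem_toList] at hp
      rw [hC.schema_proj hp] at hA' ⊢
      refine ((hv p hp).maxDeg_le hA').trans ?_
      gcongr
      exact le_add_of_nonneg_right (Real.log_nonneg one_le_two))
    (by rw [Finset.empty_union]; exact hC.subset_attrs_map_proj)
    (by simp)
  rw [Finset.sdiff_empty, hexp, List.length_map, List.length_map, Finset.length_toList,
    ← mul_assoc] at hloop
  exact hloop.trans (mul_le_mul_of_nonneg_right (loop_factor_le C X) (Real.exp_nonneg _))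

theorem loopSteps_lightTables_le (hwf : ∀ R ∈ Rs, R.WF) (hC : IsCover Rs X C) :
    (loopSteps (lightTables Rs X C) emptyTup : ℝ)
      ≤ loopConst V Rs.length * Real.exp (coverValue Rs X C) := by
  have const_pos : (0 : ℝ) < loopConst V Rs.length := by
    rw [loopConst]
    positivity
  have steps_pos : (0 : ℝ) < loopSteps (lightTables Rs X C) (emptyTup : Tup V D) := by
    rw [Nat.cast_pos]
    cases lightTables Rs X C <;> simp [loopSteps]
  rw [← div_le_iff₀' const_pos, ← Real.log_le_iff_le_exp (by positivity)]
  refine le_csInf ?_ ?_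
  · obtain ⟨v, hv⟩ := exists_packedBy Rs C
    exact ⟨_, v, hv, rfl⟩
  · rintro _ ⟨v, hv, rfl⟩
    rw [Real.log_le_iff_le_exp (by positivity), div_le_iff₀' const_pos]
    exact loopSteps_lightTables_le_exp hwf hC hv

theorem Packs.loopSteps_le (h : Packs Rs X N) (hwf : ∀ R ∈ Rs, R.WF) (hN : 0 < N) :
    (loopSteps (lightTables Rs X (bestCover Rs X)) emptyTup : ℝ) ≤ loopConst V Rs.length * N := by
  obtain ⟨C, hC, hv⟩ := h.exists_cover
  obtain ⟨hbest, hmin⟩ := bestCover_spec ⟨C, hC⟩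
  refine (loopSteps_lightTables_le hwf hbest).trans ?_
  gcongr
  rw [← Real.le_log_iff_exp_le hN]
  exact (hmin C hC).trans hv

theorem Packs.card_lightRel_le (h : Packs Rs X N) (hwf : ∀ R ∈ Rs, R.WF) (hN : 0 < N) :
    ((lightRel Rs X).rows.card : ℝ) ≤ loopConst V Rs.length * N :=
  (Nat.cast_le.2 (card_loopRows_le_loopSteps _ _)).trans (h.loopSteps_le hwf hN)

omit [DecidableEq V] [DecidableEq D] in
theorem sum_degree_scans_le {N : ℕ} (h : ∀ R ∈ Rs, R.rows.card ≤ N) :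
    (Rs.map fun R => ∑ B ∈ R.schema.powerset, ∑ _A ∈ B.powerset, R.rows.card).sum
      ≤ 2 ^ Fintype.card V * 2 ^ Fintype.card V * Rs.length * N := by
  have card_powerset_le (A : Finset V) : A.powerset.card ≤ 2 ^ Fintype.card V := by
    rw [Finset.card_powerset]
    exact Nat.pow_le_pow_right two_pos (Finset.card_le_univ A)
  have hsum := List.sum_le_card_nsmul
    (Rs.map fun R => ∑ B ∈ R.schema.powerset, ∑ _A ∈ B.powerset, R.rows.card)
    (2 ^ Fintype.card V * (2 ^ Fintype.card V * N)) (List.forall_mem_map.2 fun R hR => by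
      refine (Finset.sum_le_card_nsmul _ _ (2 ^ Fintype.card V * N) fun B _ => ?_).trans ?_
      · rw [Finset.sum_const, smul_eq_mul]
        exact Nat.mul_le_mul (card_powerset_le B) (h R hR)
      · rw [smul_eq_mul]
        exact Nat.mul_le_mul_right _ (card_powerset_le _))
  rw [List.length_map, smul_eq_mul] at hsum
  exact hsum.trans_eq (by ring)

theorem tableSize_lightTables_le {N : ℕ} (h : ∀ R ∈ Rs, R.rows.card ≤ N) (X : Finset V)
    (C : Finset (Fin Rs.length × Finset V)) :
    tableSize (lightTables Rs X C) ≤ (Rs.length * 2 ^ Fintype.card V + Rs.length) * N := by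
  refine (tableSize_le (N := N) fun T hT => ?_).trans (Nat.mul_le_mul_right _ ?_)
  · rcases mem_lightTables.1 hT with ⟨p, -, rfl⟩ | ⟨R, hR, rfl⟩
    · exact Finset.card_image_le.trans (h _ (List.get_mem _ _))
    · exact Finset.card_image_le.trans (h R hR)
  · rw [lightTables, List.length_append, List.length_map, List.length_map, Finset.length_toList]
    exact Nat.add_le_add_right (card_finset_prod_le C) _

theorem Packs.lightSteps_le (h : Packs Rs X N) (hwf : ∀ R ∈ Rs, R.WF) (hN : 0 < N)
    (hR : ∀ R ∈ Rs, (R.rows.card : ℝ) ≤ N) :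
    (lightSteps Rs X : ℝ) ≤ lightConst V Rs.length * N := by
  have hfloor : ∀ R ∈ Rs, R.rows.card ≤ ⌊N⌋₊ := fun R hR' => Nat.le_floor (hR R hR')
  have hscan := Nat.cast_le (α := ℝ).2 (sum_degree_scans_le hfloor)
  have hsize := Nat.cast_le (α := ℝ).2 (tableSize_lightTables_le hfloor X (bestCover Rs X))
  have hloop := h.loopSteps_le hwf hN
  rw [lightSteps, joinSteps, lightConst]
  push_cast at hscan hsize hloop ⊢
  calc _ ≤ (2 : ℝ) ^ Fintype.card V * 2 ^ Fintype.card V * Rs.length * ⌊N⌋₊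
        + ((Rs.length * 2 ^ Fintype.card V + Rs.length) * ⌊N⌋₊ + loopConst V Rs.length * N) :=
        add_le_add hscan (add_le_add hsize hloop)
    _ ≤ (2 : ℝ) ^ Fintype.card V * 2 ^ Fintype.card V * Rs.length * N
        + ((Rs.length * 2 ^ Fintype.card V + Rs.length) * N + loopConst V Rs.length * N) := by
        gcongr <;> exact Nat.floor_le hN.le
    _ = _ := by ring

end LightCost

/-! ## Packing bounds for uniform degrees -/

section Tight

/-- Raising the coordinates of `v = 0` one after the other until a constraint is tight. -/
theorem exists_tight {V κ : Type*} (K : Finset κ) (s : κ → Finset V) (h : κ → ℝ)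
    (h_nonneg : ∀ k ∈ K, 0 ≤ h k) (X : Finset V) (hX : ∀ a ∈ X, ∃ k ∈ K, a ∈ s k) :
    ∃ v : V → ℝ, (∀ a, 0 ≤ v a) ∧ (∀ k ∈ K, ∑ a ∈ s k, v a ≤ h k) ∧
      ∀ a ∈ X, ∃ k ∈ K, a ∈ s k ∧ ∑ b ∈ s k, v b = h k := by
  classical
  induction X using Finset.induction_on with
  | empty => exact ⟨0, by simp, by simpa using h_nonneg, by simp⟩
  | insert b X _ ih =>
    rw [Finset.forall_mem_insert] at hX
    obtain ⟨v, v_nonneg, hle, htight⟩ := ih hX.2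
    obtain ⟨k₁, hk₁, hmin⟩ := Finset.exists_min_image (K.filter fun k => b ∈ s k)
      (fun k => h k - ∑ a ∈ s k, v a) (hX.1.imp fun k => Finset.mem_filter.2)
    simp only [Finset.mem_filter] at hk₁ hmin
    set δ := h k₁ - ∑ a ∈ s k₁, v a with hδ
    have δ_nonneg : 0 ≤ δ := sub_nonneg.2 (hle k₁ hk₁.1)
    have sum_eq (k) : ∑ a ∈ s k, (v + Pi.single b δ : V → ℝ) a
        = ∑ a ∈ s k, v a + if b ∈ s k then δ else 0 := by
      simp only [Pi.add_apply, Finset.sum_add_distrib, Finset.sum_pi_single']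
    refine ⟨(v + Pi.single b δ : V → ℝ), fun a => ?_, fun k hk => ?_,
      (Finset.forall_mem_insert _ _ _).2 ⟨⟨k₁, hk₁.1, hk₁.2, ?_⟩, fun a ha => ?_⟩⟩
    · exact add_nonneg (v_nonneg a) ((Pi.single_nonneg (α := fun _ : V => ℝ)).2 δ_nonneg a)
    · rw [sum_eq]
      split_ifs with hbk
      · linarith [hmin k ⟨hk, hbk⟩]
      · linarith [hle k hk]
    · rw [sum_eq, if_pos hk₁.2, hδ, add_sub_cancel]
    · obtain ⟨k, hk, hak, heq⟩ := htight a ha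
      refine ⟨k, hk, hak, ?_⟩
      rw [sum_eq]
      split_ifs with hbk
      · linarith [hmin k ⟨hk, hbk⟩]
      · rw [heq, add_zero]

end Tight

section Uniform

variable {V D : Type*} {m : ℕ} {q : Query V m}

theorem Inst.one_le_card (I : Inst q D) (i : Fin m) : (1 : ℝ) ≤ (I.rows i).card := by
  exact_mod_cast (I.nonempty i).card_pos

variable [DecidableEq V]

theorem Query.fracCover_one (q : Query V m) (X : Finset V) : q.FracCover X fun _ => 1 := by
  refine ⟨fun _ => zero_le_one, fun a _ => ?_⟩
  obtain ⟨i, hi⟩ := q.covered a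
  rw [Finset.sum_const, nsmul_eq_mul, mul_one]
  exact_mod_cast Finset.card_pos.2 ⟨i, by simpa using hi⟩

theorem Query.FracCover.sum_le {X : Finset V} {w : Fin m → ℝ} (hw : q.FracCover X w) {v : V → ℝ}
    (hv : ∀ a, 0 ≤ v a) : ∑ a ∈ X, v a ≤ ∑ i, w i * ∑ a ∈ q.schema i ∩ X, v a := by
  calc ∑ a ∈ X, v a ≤ ∑ a ∈ X, v a * ∑ i with a ∈ q.schema i, w i :=
        Finset.sum_le_sum fun a ha => le_mul_of_one_le_right (hv a) (hw.2 a ha)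
    _ = ∑ i, w i * ∑ a ∈ q.schema i ∩ X, v a := by
        simp only [Finset.mul_sum, Finset.sum_filter]
        rw [Finset.sum_comm]
        refine Finset.sum_congr rfl fun i _ => ?_
        rw [Finset.inter_comm, ← Finset.filter_mem_eq_inter, Finset.sum_filter]
        exact Finset.sum_congr rfl fun a _ => by split <;> simp [mul_comm]

theorem Inst.agm_le (I : Inst q D) {X : Finset V} {w : Fin m → ℝ} (hw : q.FracCover X w) :
    I.agm X ≤ ∏ i, ((I.rows i).card : ℝ) ^ w i := by
  refine csInf_le ⟨0, ?_⟩ ⟨w, hw, rfl⟩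
  rintro _ ⟨w, -, rfl⟩
  positivity

theorem Inst.le_agm (I : Inst q D) {X : Finset V} {x : ℝ}
    (h : ∀ w, q.FracCover X w → x ≤ ∏ i, ((I.rows i).card : ℝ) ^ w i) : x ≤ I.agm X := by
  refine le_csInf ⟨_, _, q.fracCover_one X, rfl⟩ ?_
  rintro _ ⟨w, hw, rfl⟩
  exact h w hw

theorem Inst.one_le_agm (I : Inst q D) (X : Finset V) : 1 ≤ I.agm X :=
  I.le_agm fun _ hw => Finset.one_le_prod fun i _ => Real.one_le_rpow (I.one_le_card i) (hw.1 i)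

variable [Fintype V]

theorem Query.unionAll_schemas (q : Query V m) : unionAll q.schemas = Finset.univ := by
  ext a
  obtain ⟨i, hi⟩ := q.covered a
  simp only [mem_unionAll, Finset.mem_univ, iff_true]
  exact ⟨_, List.mem_ofFn.2 ⟨i, rfl⟩, hi⟩

variable [DecidableEq D]

theorem card_mul_le_deg {rows U : Finset (Tup V D)} {A B : Finset V} {t : Tup V D} {k : ℕ}
    (hB : B ⊆ A) (hU : ∀ u ∈ U, restrict B u = t ∧ k ≤ deg u rows A) :
    U.card * k ≤ deg t rows B := by
  have hfibre := Finset.mul_card_image_le_card_of_maps_to (f := restrict A)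
    (s := rows.filter fun r => restrict A r ∈ U) (t := U)
    (fun r hr => (Finset.mem_filter.1 hr).2) k (fun u hu => by
      refine (hU u hu).2.trans (Finset.card_le_card fun r hr => ?_)
      obtain ⟨hr, hru⟩ := Finset.mem_filter.1 hr
      exact Finset.mem_filter.2 ⟨Finset.mem_filter.2 ⟨hr, hru ▸ hu⟩, hru⟩)
  rw [mul_comm]
  refine hfibre.trans (Finset.card_le_card fun r hr => ?_)
  rw [Finset.mem_filter] at hr ⊢
  exact ⟨hr.1, by rw [← restrict_restrict hB, (hU _ hr.2).1]⟩

variable {I : Inst q D} {c : Config V m} {i j : Fin m} {A B X : Finset V} {r : Tup V D}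
  {T : Table V D} {Rs : List (Table V D)}

omit [DecidableEq D] in
theorem Inst.mem_configs (hc : c ∈ I.configs) (i : Fin m) :
    c i (q.schema i) = 0 ∧ c i ∅ = Nat.log 2 (I.rows i).card ∧
      ∀ A' A, A' ⊆ A → A ⊆ q.schema i → c i A ≤ c i A' :=
  (Finset.mem_filter.1 hc).2 i

theorem Inst.log_deg_of_mem_part (hr : r ∈ I.part c i) (hA : A ⊆ q.schema i) :
    Nat.log 2 (deg (restrict A r) (I.rows i) A) = c i A :=
  (Finset.mem_filter.1 hr).2 A (Finset.mem_powerset.2 hA)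

theorem Inst.two_pow_le_deg (hr : r ∈ I.part c i) (hA : A ⊆ q.schema i) :
    2 ^ c i A ≤ deg (restrict A r) (I.rows i) A := by
  rw [← log_deg_of_mem_part hr hA]
  exact Nat.pow_log_le_self 2 (Finset.card_ne_zero_of_mem
    (Finset.mem_filter.2 ⟨Finset.filter_subset _ _ hr, rfl⟩))

theorem Inst.deg_lt_two_pow (hr : r ∈ I.part c i) (hA : A ⊆ q.schema i) :
    deg (restrict A r) (I.rows i) A < 2 ^ (c i A + 1) := by
  rw [← log_deg_of_mem_part hr hA]
  exact Nat.lt_pow_succ_log_self one_lt_two _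

theorem Inst.maxDeg_proj_mul_le (hA : A ⊆ q.schema i) (hB : B ⊆ A)
    (hT : ∀ t ∈ T.rows, ∃ r ∈ I.part c i, restrict A r = restrict A t) :
    maxDeg (T.proj A) B * 2 ^ c i A ≤ 2 ^ (c i B + 1) := by
  rw [← Nat.le_div_iff_mul_le (by positivity)]
  refine Finset.sup_le fun u₀ hu₀ => ?_
  rw [Nat.le_div_iff_mul_le (by positivity)]
  have exists_row : ∀ u ∈ (T.proj A).rows, ∃ r ∈ I.part c i, restrict A r = u := fun u hu => by
    obtain ⟨t, ht, rfl⟩ := Finset.mem_image.1 hu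
    exact hT t ht
  obtain ⟨r₀, hr₀, rfl⟩ := exists_row u₀ hu₀
  rw [restrict_restrict hB]
  refine le_trans (card_mul_le_deg hB fun u hu => ?_) (deg_lt_two_pow hr₀ (hB.trans hA)).le
  obtain ⟨hu, hBu⟩ := Finset.mem_filter.1 hu
  obtain ⟨r, hr, rfl⟩ := exists_row u hu
  exact ⟨hBu, two_pow_le_deg hr hA⟩

/-- The rows of `T`, restricted to the part of the schema of the relation `i` inside `X`, come
from rows of `R(c)`. The degree bounds of `R(c)` are thus inherited by the intermediate relations
of a plan. -/
def Inst.Dominates (I : Inst q D) (c : Config V m) (X : Finset V) (i : Fin m)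
    (T : Table V D) : Prop :=
  q.schema i ∩ X ⊆ T.schema ∧ ∀ t ∈ T.rows,
    restrict (q.schema i ∩ X) t ∈ (I.part c i).image (restrict (q.schema i ∩ X))

theorem Inst.Dominates.log_maxDeg_le (h : I.Dominates c X i T) (hc : c ∈ I.configs)
    (hA : A ⊆ q.schema i ∩ X) (hB : B ⊆ A) :
    Real.log ((maxDeg (T.proj A) B : ℝ) / 2) ≤ ((c i B : ℝ) - c i A) * Real.log 2 := by
  have hAi := hA.trans Finset.inter_subset_left
  have hdeg := Inst.maxDeg_proj_mul_le (T := T) hAi hB fun t ht => by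
    obtain ⟨r, hr, hrt⟩ := Finset.mem_image.1 (h.2 t ht)
    exact ⟨r, hr, restrict_eq_iff.2 fun a ha => restrict_eq_iff.1 hrt a (hA ha)⟩
  rcases (maxDeg (T.proj A) B).eq_zero_or_pos with hzero | hpos
  · have hle : (c i A : ℝ) ≤ c i B := Nat.cast_le.2 ((Inst.mem_configs hc i).2.2 B A hB hAi)
    simpa [hzero] using mul_nonneg (sub_nonneg.2 hle) (Real.log_nonneg one_le_two)
  · have hlog := Real.log_le_log (x := (maxDeg (T.proj A) B : ℝ) * 2 ^ c i A)
      (y := 2 ^ (c i B + 1)) (by positivity) (by exact_mod_cast hdeg)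
    rw [Real.log_mul (by positivity) (by positivity), Real.log_pow, Real.log_pow] at hlog
    rw [Real.log_div (by positivity) two_ne_zero]
    push_cast at hlog
    linarith

/-- A packing `v` that satisfies the upper bounds `(c(R, ∅) - c(R, A)) log 2` and cannot be
increased solves the linear program of the cover formed by its tight pairs `(R, A)`. -/
theorem Inst.packs_of_dominates (hc : c ∈ I.configs) (J : Finset (Fin m))
    (hX : ∀ a ∈ X, ∃ i ∈ J, a ∈ q.schema i) (hdom : ∀ i ∈ J, ∃ T ∈ Rs, I.Dominates c X i T)
    {N : ℝ} (hN : ∀ v : V → ℝ, (∀ a, 0 ≤ v a) → (∀ i ∈ J, ∀ A ⊆ q.schema i ∩ X,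
      ∑ a ∈ A, v a ≤ ((c i ∅ : ℝ) - c i A) * Real.log 2) → ∑ a ∈ X, v a ≤ Real.log N) :
    Packs Rs X N := by
  obtain ⟨v, v_nonneg, hle, htight⟩ := exists_tight
    (J.sigma fun i => (q.schema i ∩ X).powerset) Sigma.snd
    (fun p => ((c p.1 ∅ : ℝ) - c p.1 p.2) * Real.log 2) (fun p hp => by
      rw [Finset.mem_sigma, Finset.mem_powerset] at hp
      refine mul_nonneg (sub_nonneg.2 (Nat.cast_le.2 ?_)) (Real.log_nonneg one_le_two)
      exact (mem_configs hc p.1).2.2 ∅ _ (Finset.empty_subset _)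
        (hp.2.trans Finset.inter_subset_left)) X (fun a ha => by
      obtain ⟨i, hi, hai⟩ := hX a ha
      exact ⟨⟨i, {a}⟩, Finset.mem_sigma.2 ⟨hi, Finset.mem_powerset.2 (by simp [hai, ha])⟩, by simp⟩)
  have hle' : ∀ i ∈ J, ∀ A ⊆ q.schema i ∩ X,
      ∑ a ∈ A, v a ≤ ((c i ∅ : ℝ) - c i A) * Real.log 2 := fun i hi A hA =>
    hle ⟨i, A⟩ (Finset.mem_sigma.2 ⟨hi, Finset.mem_powerset.2 hA⟩)
  refine ⟨v, v_nonneg, hN v v_nonneg hle', fun a ha => ?_⟩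
  obtain ⟨⟨i, A⟩, hiA, haA, htight⟩ := htight a ha
  rw [Finset.mem_sigma, Finset.mem_powerset] at hiA
  obtain ⟨hi, hA⟩ := hiA
  obtain ⟨T, hT, hdomT⟩ := hdom i hi
  refine ⟨T, hT, A, Finset.subset_inter (hA.trans hdomT.1) (hA.trans Finset.inter_subset_right),
    haA, fun A' hA' => (hdomT.log_maxDeg_le hc hA Finset.sdiff_subset).trans ?_⟩
  have hsum : ∑ b ∈ A \ A', v b + ∑ b ∈ A', v b = ∑ b ∈ A, v b := Finset.sum_sdiff hA'
  have hrest := hle' i hi (A \ A') (Finset.sdiff_subset.trans hA)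
  linarith

omit [DecidableEq D] in
theorem Inst.packing_bound_le_log_card (hc : c ∈ I.configs) (i : Fin m) (A : Finset V) :
    ((c i ∅ : ℝ) - c i A) * Real.log 2 ≤ Real.log (I.rows i).card := by
  calc ((c i ∅ : ℝ) - c i A) * Real.log 2 ≤ c i ∅ * Real.log 2 := by
        gcongr
        simp
    _ = Real.log (2 ^ Nat.log 2 (I.rows i).card) := by rw [(mem_configs hc i).2.1, Real.log_pow]
    _ ≤ Real.log (I.rows i).card := Real.log_le_log (by positivity)
        (by exact_mod_cast Nat.pow_log_le_self 2 (I.nonempty i).card_pos.ne')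

theorem Inst.packs_agm (hc : c ∈ I.configs) (hdom : ∀ i, ∃ T ∈ Rs, I.Dominates c X i T) :
    Packs Rs X (I.agm X) := by
  refine packs_of_dominates hc Finset.univ (fun a _ => by simpa using q.covered a)
    (fun i _ => hdom i) fun v v_nonneg hle => ?_
  have card_pos (i) : (0 : ℝ) < (I.rows i).card := zero_lt_one.trans_le (I.one_le_card i)
  rw [Real.le_log_iff_exp_le (zero_lt_one.trans_le (I.one_le_agm X))]
  refine I.le_agm fun w hw => ?_
  rw [← Real.le_log_iff_exp_le (Finset.prod_pos fun i _ => Real.rpow_pos_of_pos (card_pos i) _),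
    Real.log_prod fun i _ => (Real.rpow_pos_of_pos (card_pos i) _).ne']
  refine (hw.sum_le v_nonneg).trans (Finset.sum_le_sum fun i _ => ?_)
  rw [Real.log_rpow (card_pos i)]
  exact mul_le_mul_of_nonneg_left ((hle i (Finset.mem_univ i) _ subset_rfl).trans
    (packing_bound_le_log_card hc i _)) (hw.1 i)

theorem Inst.packs_schema (hc : c ∈ I.configs)
    (hdom : ∃ T ∈ Rs, I.Dominates c (q.schema j) j T) :
    Packs Rs (q.schema j) (I.rows j).card :=
  packs_of_dominates hc {j} (fun a ha => ⟨j, by simp, ha⟩) (by simpa using hdom)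
    fun _ _ hle => (hle j (by simp) (q.schema j) (by simp)).trans
      (packing_bound_le_log_card hc j _)

theorem Inst.dominates_part (I : Inst q D) (c : Config V m) (X : Finset V) (i : Fin m) :
    I.Dominates c X i ⟨q.schema i, I.part c i⟩ :=
  ⟨Finset.inter_subset_left, fun _ ht => Finset.mem_image_of_mem _ ht⟩

theorem Inst.mem_parts : T ∈ I.parts c ↔ ∃ i, T = ⟨q.schema i, I.part c i⟩ := by
  rw [Inst.parts, List.mem_ofFn]
  simp only [eq_comm]

theorem Inst.parts_wf (I : Inst q D) (c : Config V m) : ∀ R ∈ I.parts c, R.WF := fun R hR => by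
  obtain ⟨i, rfl⟩ := mem_parts.1 hR
  exact fun r hr => I.wf i r (Finset.filter_subset _ _ hr)

theorem Inst.map_schema_parts (I : Inst q D) (c : Config V m) :
    (I.parts c).map Table.schema = q.schemas := by
  rw [Inst.parts, List.map_ofFn]
  rfl

theorem Inst.attrs_parts (I : Inst q D) (c : Config V m) : attrs (I.parts c) = Finset.univ := by
  rw [attrs, I.map_schema_parts, q.unionAll_schemas]

end Uniform

/-! ## Repeated Split on ears -/

section EarPlans

theorem pick_false {α : Type*} (l : List α) : pick (fun _ => false) l = [] := by
  induction l with
  | nil => rfl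
  | cons a l ih => simpa [pick] using ih

theorem pick_true {α : Type*} (l : List α) : pick (fun _ => true) l = l := by
  induction l with
  | nil => rfl
  | cons a l ih => simpa [pick] using ih

theorem pick_beq {α : Type*} (l : List α) {k : ℕ} (hk : k < l.length) :
    pick (fun i => i == k) l = [l[k]] := by
  induction l generalizing k with
  | nil => simp at hk
  | cons a l ih =>
    cases k with
    | zero => simpa [pick] using pick_false l
    | succ k => simpa [pick] using ih (k := k) (by simpa using hk)

theorem pick_bne {α : Type*} (l : List α) (k : ℕ) :
    pick (fun i => i != k) l = l.eraseIdx k := by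
  induction l generalizing k with
  | nil => rfl
  | cons a l ih =>
    cases k with
    | zero => simpa [pick] using pick_true l
    | succ k => simpa [pick] using ih k

variable {V : Type*} [DecidableEq V] {l : List (Finset V)} {k j : Fin l.length}

theorem GYOAcyclic.filter_not_subset_of_mem {M : Multiset (Finset V)} {t : Finset V}
    (hM : GYOAcyclic M) (ht : t ∈ M) : GYOAcyclic (t ::ₘ M.filter fun s => ¬ s ⊆ t) := by
  obtain ⟨M, rfl⟩ := Multiset.exists_cons_of_mem ht
  rw [Multiset.filter_cons_of_neg (p := fun s => ¬ s ⊆ t) M (not_not.2 subset_rfl)]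
  exact hM.filter_not_subset

theorem unionAll_cons_filter_not_subset {X : Finset V} (hX : X ⊆ unionAll l) :
    unionAll (X :: l.filter fun s => ¬ s ⊆ X) = unionAll l := by
  ext a
  simp only [mem_unionAll, List.mem_cons, List.mem_filter, decide_eq_true_eq]
  constructor
  · rintro ⟨s, rfl | hs, ha⟩
    · exact mem_unionAll.1 (hX ha)
    · exact ⟨s, hs.1, ha⟩
  · rintro ⟨s, hs, ha⟩
    by_cases hsX : s ⊆ X
    · exact ⟨X, .inl rfl, hsX ha⟩
    · exact ⟨s, .inr ⟨hs, hsX⟩, ha⟩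

namespace Plan

omit [DecidableEq V] in
theorem IsEar.mem_eraseIdx (h : IsEar l k j) : l.get j ∈ l.eraseIdx k :=
  List.mem_eraseIdx_iff_getElem.2 ⟨j, j.2, fun hjk => h.1 (Fin.ext hjk.symm), rfl⟩

omit [DecidableEq V] in
theorem exists_isEar {s t : Finset V} {M : Multiset (Finset V)} (hl : (l : Multiset _) = s ::ₘ M)
    (ht : t ∈ M) (hst : AttachesTo s t M) :
    ∃ k j, IsEar l k j ∧ l.get j = t ∧ (l.eraseIdx k : Multiset (Finset V)) = M := by
  have hs : s ∈ l := by
    rw [← Multiset.mem_coe, hl]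
    exact Multiset.mem_cons_self _ _
  obtain ⟨k, rfl⟩ := List.mem_iff_get.1 hs
  have hM : ((l.eraseIdx k : List (Finset V)) : Multiset (Finset V)) = M := by
    refine (Multiset.cons_inj_right (l.get k)).1 (Eq.trans ?_ hl)
    exact Multiset.coe_eq_coe.2 (List.getElem_cons_eraseIdx_perm k.2)
  rw [← hM, Multiset.mem_coe] at ht
  obtain ⟨j, hj, hjk, rfl⟩ := List.mem_eraseIdx_iff_getElem.1 ht
  refine ⟨k, ⟨j, hj⟩, ⟨fun hkj => hjk (congrArg Fin.val hkj).symm, fun a ha => ?_⟩, rfl, hM⟩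
  by_contra! h
  obtain ⟨i, hik, hai⟩ := h.2
  refine h.1 (hst a ha ⟨l.get i, ?_, hai⟩)
  rw [← hM, Multiset.mem_coe]
  exact List.mem_eraseIdx_iff_getElem.2 ⟨i, i.2, fun h => hik (Fin.ext h), rfl⟩

theorem exists_earPlan (hl : GYOAcyclic (l : Multiset (Finset V))) :
    ∃ p : Plan V, p.EarPlan l := by
  induction hn : l.length using Nat.strong_induction_on generalizing l with
  | _ n ih =>
    generalize hM' : (l : Multiset (Finset V)) = M' at hl
    cases hl with
    | single s =>
      rw [Multiset.coe_eq_singleton] at hM'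
      exact ⟨.done, hM' ▸ .single s⟩
    | cons hM ht hst =>
      obtain ⟨k, j, hear, rfl, rfl⟩ := exists_isEar hM' ht hst
      have hreduced : ((l.get k ∩ l.get j) :: l.eraseIdx k).filter (fun s => ¬ s ⊆ l.get j)
          = (l.eraseIdx k).filter fun s => ¬ s ⊆ l.get j :=
        List.filter_cons_of_neg (by simp)
      have hlength : (l.get j :: (l.eraseIdx k).filter fun s => ¬ s ⊆ l.get j).length < n := by
        have herase := List.length_eraseIdx_of_lt k.2
        have hfilter : ((l.eraseIdx k).filter fun s => ¬ s ⊆ l.get j).length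
            < (l.eraseIdx k).length :=
          List.length_filter_lt_length_iff_exists.2 ⟨_, hear.mem_eraseIdx, by simp⟩
        rw [List.length_cons]
        have := k.2
        omega
      obtain ⟨p, hp⟩ := ih _ hlength (hM.filter_not_subset_of_mem ht) rfl
      exact ⟨_, .step l k j p hear (hreduced ▸ hp)⟩

theorem IsEar.separates (h : IsEar l k j) :
    Separates (l.get k ∩ l.get j) (fun i => i == k.1) (fun i => i != k.1) l := by
  have hunion : unionAll [l.get k] = l.get k := Finset.union_empty _
  rw [Separates, pick_beq l k.2, pick_bne, ← List.get_eq_getElem, hunion]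
  refine ⟨fun i _ => by by_cases hi : i = k <;> simp [hi], fun a ha => ?_,
    Finset.inter_subset_left⟩
  obtain ⟨hak, ha⟩ := Finset.mem_inter.1 ha
  obtain ⟨s, hs, has⟩ := mem_unionAll.1 ha
  obtain ⟨i, hi, hik, rfl⟩ := List.mem_eraseIdx_iff_getElem.1 hs
  exact Finset.mem_inter.2 ⟨hak, (h.2 a hak).resolve_right fun hother =>
    hother ⟨i, hi⟩ (fun h => hik (congrArg Fin.val h)) has⟩

theorem EarPlan.valid {p : Plan V} (hp : p.EarPlan l) : p.Valid l (unionAll l) := by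
  induction hp with
  | single s => exact ⟨s, rfl, by simp [unionAll]⟩
  | step l k j p hear _ ih =>
    have subset_unionAll : ∀ {l : List (Finset V)} {s}, s ∈ l → s ⊆ unionAll l :=
      fun hs a ha => mem_unionAll.2 ⟨_, hs, ha⟩
    have hS : l.get k ∩ l.get j ⊆ unionAll l :=
      Finset.inter_subset_left.trans (subset_unionAll (List.get_mem l k))
    refine ⟨hear.separates, hS, ?_⟩
    rw [pick_beq l k.2, pick_bne]
    have hj : l.get j ⊆ unionAll ((l.get k ∩ l.get j) :: l.eraseIdx k) :=
      subset_unionAll (List.mem_cons_of_mem _ hear.mem_eraseIdx)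
    have hO : unionAll l ∩ (l.get k ∩ l.get j ∪ unionAll (l.eraseIdx k))
        = unionAll ((l.get k ∩ l.get j) :: l.eraseIdx k) := by
      refine Finset.inter_eq_right.2 (Finset.union_subset hS fun a ha => ?_)
      obtain ⟨s, hs, has⟩ := mem_unionAll.1 ha
      exact subset_unionAll (List.mem_of_mem_eraseIdx hs) has
    refine ⟨⟨_, rfl, Finset.inter_subset_left⟩, ⟨hj, ?_⟩, subset_unionAll (by simp),
      l.get k, by simp, by simp [unionAll]⟩
    rw [hO]
    rwa [unionAll_cons_filter_not_subset hj] at ih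

end Plan

end EarPlans

section EarCost

variable {V D : Type*} [Fintype V] [DecidableEq D]

theorem joinSteps_singleton {R : Table V D} (hR : R.WF) : joinSteps [R] = 2 * R.rows.card + 1 := by
  rw [joinSteps, loopSteps_singleton hR, tableSize, List.map_singleton, List.sum_singleton]
  ring

variable [DecidableEq V]

theorem card_projJoin_le (Rs : List (Table V D)) (O : Finset V) :
    (projJoin Rs O).rows.card ≤ (joinRows Rs).card :=
  Finset.card_image_le

theorem card_projJoin_singleton_le {R : Table V D} (hR : R.WF) (O : Finset V) :
    (projJoin [R] O).rows.card ≤ R.rows.card := by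
  simpa only [joinRows_singleton hR] using card_projJoin_le [R] O

omit [Fintype V] [DecidableEq D] in
theorem attrs_singleton (R : Table V D) : attrs [R] = R.schema := by
  rw [attrs_cons, show attrs ([] : List (Table V D)) = ∅ from rfl, Finset.union_empty]

omit [DecidableEq V] in
theorem joinSteps_triple_le {R₀ R₁ R₂ : Table V D} (h₀ : R₀.WF) (h₁ : R₁.WF) (h₂ : R₂.WF)
    (hs : R₀.schema ⊆ R₁.schema) :
    joinSteps [R₀, R₁, R₂] ≤ 1 + 2 * R₀.rows.card + 2 * R₁.rows.card + R₂.rows.card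
      + (joinRows [R₀, R₁, R₂]).card := by
  classical
  have hwf : ∀ R ∈ [R₀, R₁], R.WF := by simpa using ⟨h₀, h₁⟩
  have hsteps₂ := loopSteps_concat (Rs := [R₀, R₁]) (R := R₂) (by simpa using ⟨h₀, h₁, h₂⟩) emptyTup
  have hsteps₁ := loopSteps_concat (Rs := [R₀]) (R := R₁) hwf emptyTup
  have hcard : (joinRows [R₀, R₁]).card ≤ R₁.rows.card := by
    refine Finset.card_le_card fun u hu => ?_
    obtain ⟨hu, hsat⟩ := (mem_joinRows hwf).1 hu
    have hattrs : attrs [R₀, R₁] = R₁.schema := by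
      rw [attrs_cons, attrs_singleton, Finset.union_eq_right.2 hs]
    rw [hattrs] at hu
    have hmem := hsat R₁ (by simp)
    rwa [hu.restrict_eq_self] at hmem
  simp only [List.cons_append, List.nil_append] at hsteps₁ hsteps₂
  rw [joinSteps, hsteps₂, hsteps₁, loopSteps_singleton h₀]
  simp only [tableSize, List.map_cons, List.map_nil, List.sum_cons, List.sum_nil]
  unfold joinRows at hcard ⊢
  omega

theorem lightRel_schema_subset {Rs : List (Table V D)} (hwf : ∀ R ∈ Rs, R.WF) {R : Table V D}
    (hR : R ∈ Rs) : (lightRel Rs R.schema).rows ⊆ R.rows := by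
  intro u hu
  obtain ⟨hu, hmem⟩ := (mem_lightRel hwf (subset_attrs hR)).1 hu
  obtain ⟨r, hr, hru⟩ := hmem R hR
  rw [Finset.inter_self, hu.restrict_eq_self, (hwf R hR r hr).restrict_eq_self] at hru
  exact hru ▸ hr

/-- The relations have at most `N` rows each, and the degrees of each of them alone give the packing
bound `N` for the Light transform on its schema. Absorbing a small relation preserves this. -/
structure SelfPacks (Rs : List (Table V D)) (N : ℝ) : Prop where
  card_le : ∀ R ∈ Rs, (R.rows.card : ℝ) ≤ N
  packs : ∀ R ∈ Rs, Packs [R] R.schema N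

namespace SelfPacks

variable {Rs Rs' : List (Table V D)} {T R : Table V D} {N : ℝ}

theorem mono (h : SelfPacks Rs N) (hRs : Rs' ⊆ Rs) : SelfPacks Rs' N :=
  ⟨fun R hR => h.card_le R (hRs hR), fun R hR => h.packs R (hRs hR)⟩

theorem lightReduce_cons (h : SelfPacks Rs N) (hwf : ∀ R ∈ T :: Rs, R.WF) (hR : R ∈ Rs)
    (hTR : T.schema ⊆ R.schema) :
    SelfPacks (lightReduce (T :: Rs) R.schema) N := by
  have hsub := lightRel_schema_subset hwf (List.mem_cons_of_mem T hR)
  have forall_mem {P : Table V D → Prop} (hlight : P (lightRel (T :: Rs) R.schema))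
      (hRs : ∀ U ∈ Rs, P U) : ∀ U ∈ lightReduce (T :: Rs) R.schema, P U := by
    intro U hU
    rcases mem_lightReduce.1 hU with rfl | ⟨hU, hUR⟩
    · exact hlight
    · exact hRs U ((List.mem_cons.1 hU).resolve_left (by rintro rfl; exact hUR hTR))
  exact ⟨forall_mem (le_trans (mod_cast Finset.card_le_card hsub) (h.card_le R hR)) h.card_le,
    forall_mem ((h.packs R hR).of_rows_subset (by simpa using ⟨rfl, hsub⟩)) h.packs⟩

theorem lightSteps_cons_le (h : SelfPacks Rs N) (hN : 0 < N) (hwf : ∀ R ∈ T :: Rs, R.WF)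
    (hT : (T.rows.card : ℝ) ≤ N) (hR : R ∈ Rs) :
    (lightSteps (T :: Rs) R.schema : ℝ) ≤ lightConst V (Rs.length + 1) * N :=
  ((h.packs R hR).of_rows_subset (Rs' := T :: Rs) (by
    simpa using Or.inr ⟨R, hR, rfl, subset_rfl⟩)).lightSteps_le hwf hN
    (List.forall_mem_cons.2 ⟨hT, h.card_le⟩)

theorem light_done_steps_le (h : SelfPacks [R] N) (hN : 1 ≤ N) (hT : T.WF) (hR : R.WF)
    (hTR : T.schema ⊆ R.schema) (hTN : (T.rows.card : ℝ) ≤ N) (O : Finset V) :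
    ((Plan.light R.schema .done).steps [T, R] O : ℝ) ≤ (lightConst V 2 + 3) * N := by
  have hwf : ∀ U ∈ [T, R], U.WF := by simpa using ⟨hT, hR⟩
  have hmem : R ∈ [T, R] := by simp
  have hreduce : lightReduce [T, R] R.schema = [lightRel [T, R] R.schema] := by
    simp [lightReduce, hTR]
  have hcard : ((lightRel [T, R] R.schema).rows.card : ℝ) ≤ N :=
    le_trans (mod_cast Finset.card_le_card (lightRel_schema_subset hwf hmem))
      (h.card_le R (by simp))
  have hlight := h.lightSteps_cons_le (zero_lt_one.trans_le hN) hwf hTN (List.mem_singleton_self R)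
  rw [List.length_singleton] at hlight
  rw [Plan.steps, Plan.steps, hreduce, joinSteps_singleton (lightRel_wf hwf (subset_attrs hmem))]
  push_cast
  linarith

end SelfPacks

namespace IsSplit

variable {Rs G : List (Table V D)} {R : Table V D} {S : Finset V}

theorem card_projJoin_le_singleton (h : IsSplit Rs [R] G S) (hwf : ∀ R ∈ Rs, R.WF) {A : Finset V}
    (hA : A ⊆ attrs [R]) : (projJoin Rs A).rows.card ≤ R.rows.card := by
  have hR : R.WF := hwf R (h.left_subset (List.mem_singleton_self R))
  exact (Finset.card_le_card (h.projJoin_subset hwf hA)).trans (card_projJoin_singleton_le hR A)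

theorem joinSteps_recombine_le (h : IsSplit Rs [R] G S) (hwf : ∀ R ∈ Rs, R.WF) :
    joinSteps [projJoin Rs S, projJoin Rs (attrs Rs ∩ attrs [R]), projJoin Rs (S ∪ attrs G)]
      ≤ 1 + 4 * R.rows.card + 2 * (joinRows Rs).card := by
  have hS : S ⊆ attrs Rs := h.subset_attrs.trans (attrs_mono h.left_subset)
  have hsteps := joinSteps_triple_le (projJoin_wf hwf hS)
    (projJoin_wf hwf (Finset.inter_subset_left (s₂ := attrs [R])))
    (projJoin_wf hwf h.union_subset_attrs) (Finset.subset_inter hS h.subset_attrs)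
  have hrecombine := h.joinRows_recombine hwf hS subset_rfl
  rw [Finset.inter_eq_right.2 h.union_subset_attrs] at hrecombine
  rw [hrecombine] at hsteps
  have hcard₀ := h.card_projJoin_le_singleton hwf h.subset_attrs
  have hcard₁ := h.card_projJoin_le_singleton hwf
    (Finset.inter_subset_right (s₁ := attrs Rs))
  have hcard₂ := card_projJoin_le Rs (S ∪ attrs G)
  have hcard := card_projJoin_le Rs (attrs Rs)
  omega

theorem forall_mem_cons_wf (h : IsSplit Rs [R] G S) (hwf : ∀ R ∈ Rs, R.WF) :
    ∀ T ∈ projJoin [R] S :: G, T.WF :=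
  List.forall_mem_cons.2 ⟨projJoin_wf (fun T hT => hwf T (h.left_subset hT)) h.subset_attrs,
    fun T hT => hwf T (h.right_subset hT)⟩

theorem card_joinRows_lightReduce_le (h : IsSplit Rs [R] G S) (hwf : ∀ R ∈ Rs, R.WF)
    {X : Finset V} (hX : X ⊆ S ∪ attrs G) :
    (joinRows (lightReduce (projJoin [R] S :: G) X)).card ≤ (joinRows Rs).card := by
  have hwf' := h.forall_mem_cons_wf hwf
  have hjoin := (projJoin_attrs hwf').symm.trans (h.projJoin_cons_right hwf subset_rfl)
  rw [joinRows_lightReduce hwf' hX, show joinRows _ = _ from congrArg Table.rows hjoin]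
  exact card_projJoin_le Rs _

end IsSplit

namespace Plan

theorem steps_ear_le {Rs G : List (Table V D)} {R R' : Table V D} {S : Finset V}
    {m₁ m₂ : ℕ → Bool} {p : Plan V} {N : ℝ} (hR : pick m₁ Rs = [R]) (hG : pick m₂ Rs = G)
    (hv : (splitOut S m₁ m₂ done (light R'.schema p) (light R.schema done)).Valid
      (Rs.map Table.schema) (attrs Rs))
    (hwf : ∀ R ∈ Rs, R.WF) (hN : 1 ≤ N) (h : SelfPacks Rs N) (hR' : R' ∈ G) :
    ((splitOut S m₁ m₂ done (light R'.schema p) (light R.schema done)).steps Rs (attrs Rs) : ℝ)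
      ≤ (lightConst V (G.length + 1) + lightConst V 2 + 12) * N + 3 * (joinRows Rs).card
        + p.steps (lightReduce (projJoin [R] S :: G) R'.schema) (attrs (projJoin [R] S :: G)) := by
  change _ ≤ _ + (p.steps _ (S ∪ attrs G) : ℝ)
  have hs : IsSplit Rs [R] G S := hR ▸ hG ▸ (valid_splitOut_iff.1 hv).1.isSplit
  have hRmem : R ∈ Rs := hs.left_subset (List.mem_singleton_self R)
  have hSR : S ⊆ R.schema := attrs_singleton R ▸ hs.subset_attrs
  have hcardR := h.card_le R hRmem
  have hcardRS : ((projJoin [R] S).rows.card : ℝ) ≤ N :=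
    le_trans (mod_cast card_projJoin_singleton_le (hwf R hRmem) S) hcardR
  have hcardS : ((projJoin Rs S).rows.card : ℝ) ≤ N :=
    le_trans (mod_cast hs.card_projJoin_le_singleton hwf hs.subset_attrs) hcardR
  have hlight := (h.mono hs.right_subset).lightSteps_cons_le (zero_lt_one.trans_le hN)
    (hs.forall_mem_cons_wf hwf) hcardRS hR'
  have hear := (h.mono hs.left_subset).light_done_steps_le hN
    (projJoin_wf hwf (hSR.trans (subset_attrs hRmem))) (hwf R hRmem) hSR hcardS
    (attrs Rs ∩ attrs [R])
  have hrecombine : (joinSteps [projJoin Rs S, projJoin Rs (attrs Rs ∩ attrs [R]),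
      projJoin Rs (S ∪ attrs G)] : ℝ)
      ≤ 1 + 4 * R.rows.card + 2 * (joinRows Rs).card := mod_cast hs.joinSteps_recombine_le hwf
  have hcardA : ((projJoin Rs (S ∪ attrs G)).rows.card : ℝ) ≤ (joinRows Rs).card :=
    mod_cast card_projJoin_le Rs (S ∪ attrs G)
  have hsteps := steps_splitOut hwf subset_rfl hv
  rw [hR, hG, Finset.inter_eq_right.2 hs.union_subset_attrs, steps.eq_1, steps.eq_3,
    joinSteps_singleton (hwf R hRmem), tableSize] at hsteps
  simp only [List.map_cons, List.map_nil, List.sum_cons, List.sum_nil] at hsteps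
  rw [hsteps]
  push_cast
  linarith

omit [Fintype V] [DecidableEq V] [DecidableEq D] in
theorem IsEar.exists_tables {Rs : List (Table V D)} {k j : Fin (Rs.map Table.schema).length}
    (h : IsEar (Rs.map Table.schema) k j) :
    ∃ R R', R.schema = (Rs.map Table.schema).get k ∧ R'.schema = (Rs.map Table.schema).get j ∧
      pick (fun i => i == k.1) Rs = [R] ∧ R' ∈ Rs.eraseIdx k := by
  have hk : k.1 < Rs.length := by simpa using k.2
  have hmem := h.mem_eraseIdx
  rw [List.eraseIdx_map] at hmem
  obtain ⟨R', hR', hR'j⟩ := List.mem_map.1 hmem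
  exact ⟨Rs[k.1], R', by simp, hR'j, pick_beq Rs hk, hR'⟩

theorem EarPlan.steps_le {l : List (Finset V)} {p : Plan V} (hp : p.EarPlan l) :
    ∃ C K : ℕ, ∀ (D : Type*) [DecidableEq D] (Rs : List (Table V D)) (N : ℝ),
      Rs.map Table.schema = l → (∀ R ∈ Rs, R.WF) → 1 ≤ N → SelfPacks Rs N →
        (p.steps Rs (attrs Rs) : ℝ) ≤ C * N + K * (joinRows Rs).card := by
  induction hp with
  | single s =>
    refine ⟨3, 0, fun D _ Rs N hl hwf hN h => ?_⟩
    obtain ⟨R, rfl, -⟩ := List.map_eq_singleton_iff.1 hl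
    have hcard := h.card_le R (List.mem_singleton_self R)
    rw [steps, joinSteps_singleton (hwf R (List.mem_singleton_self R))]
    push_cast
    linarith
  | step l k j p hear hp ih =>
    obtain ⟨C, K, ih⟩ := ih
    refine ⟨lightConst V l.length + lightConst V 2 + 12 + C, 3 + K,
      fun D _ Rs N hl hwf hN h => ?_⟩
    have hv := (EarPlan.step l k j p hear hp).valid
    subst hl
    obtain ⟨R, R', hRk, hR'j, hpick, hR'⟩ := hear.exists_tables
    rw [← hRk, ← hR'j] at hv ih ⊢
    rw [List.eraseIdx_map] at ih
    have hear_le := steps_ear_le hpick (pick_bne Rs k.1) hv hwf hN h hR'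
    have hs := (valid_splitOut_iff.1 hv).1.isSplit
    rw [hpick, pick_bne] at hs
    have hwf' := hs.forall_mem_cons_wf hwf
    have hX := subset_attrs (List.mem_cons_of_mem (projJoin [R] (R.schema ∩ R'.schema)) hR')
    have hrest := ih D _ N (map_schema_lightReduce _ _) (lightReduce_wf hwf' hX) hN
      ((h.mono hs.right_subset).lightReduce_cons hwf' hR' Finset.inter_subset_right)
    rw [attrs_lightReduce hX] at hrest
    have hout := mul_le_mul_of_nonneg_left (Nat.cast_le (α := ℝ).2
      (hs.card_joinRows_lightReduce_le hwf hX)) K.cast_nonneg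
    have hlen : (Rs.eraseIdx k).length + 1 = (Rs.map Table.schema).length :=
      (List.length_eraseIdx_add_one (by simpa using k.2)).trans (List.length_map _).symm
    rw [hlen] at hear_le
    push_cast
    exact hear_le.trans (by linarith)

end Plan

end EarCost

/-! ## Runs over all degree configurations -/

section Degrees

variable {V D : Type*} [Fintype V] [DecidableEq V] [DecidableEq D] {rows : Finset (Tup V D)}
  {A B : Finset V}

theorem deg_anti (h : A ⊆ B) (t : Tup V D) :
    deg (restrict B t) rows B ≤ deg (restrict A t) rows A := by
  refine Finset.card_le_card (Finset.monotone_filter_right _ fun r _ hr => ?_)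
  rw [← restrict_restrict h r, hr, restrict_restrict h]

theorem deg_empty (t : Tup V D) : deg (restrict ∅ t) rows ∅ = rows.card :=
  congrArg Finset.card (Finset.filter_true_of_mem fun _ _ => restrict_eq_iff.2 (by simp))

theorem deg_le_one_of_hasSchema (h : ∀ r ∈ rows, HasSchema A r) (t : Tup V D) :
    deg t rows A ≤ 1 := by
  refine Finset.card_le_one.2 fun r hr r' hr' => ?_
  rw [Finset.mem_filter] at hr hr'
  rw [← (h r hr.1).restrict_eq_self, ← (h r' hr'.1).restrict_eq_self, hr.2, hr'.2]

end Degrees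

section ConfigOf

variable {V D : Type*} [Fintype V] [DecidableEq V] [DecidableEq D] {m : ℕ} {q : Query V m}

/-- The degree configuration of a tuple `t` of the join: the buckets of the degrees of its
projections. -/
def Inst.configOf (I : Inst q D) (t : Tup V D) : Config V m := fun i A =>
  if A ⊆ q.schema i then Nat.log 2 (deg (restrict A t) (I.rows i) A) else 0

namespace Inst

variable {I : Inst q D} {c : Config V m} {t : Tup V D} {i : Fin m} {A : Finset V}

theorem configOf_of_subset (hA : A ⊆ q.schema i) :
    I.configOf t i A = Nat.log 2 (deg (restrict A t) (I.rows i) A) := if_pos hA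

theorem configOf_mem_configs (I : Inst q D) (t : Tup V D) : I.configOf t ∈ I.configs := by
  refine Finset.mem_filter.2 ⟨Fintype.mem_piFinset.2 fun i => Fintype.mem_piFinset.2 fun A => ?_,
    fun i => ⟨?_, ?_, fun A B hAB hB => ?_⟩⟩
  · split_ifs with hA
    · rw [configOf_of_subset hA, Finset.mem_range, Nat.lt_succ_iff]
      exact Nat.log_mono_right (Finset.card_filter_le _ _)
    · exact Finset.mem_singleton.2 (if_neg hA)
  · rw [configOf_of_subset subset_rfl]
    exact Nat.log_of_lt (Nat.lt_succ_of_le (deg_le_one_of_hasSchema (I.wf i) _))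
  · rw [configOf_of_subset (Finset.empty_subset _), deg_empty]
  · rw [configOf_of_subset hB, configOf_of_subset (hAB.trans hB)]
    exact Nat.log_mono_right (deg_anti hAB t)

theorem mem_joinSet_part_configOf (ht : t ∈ joinSet q I.rows) :
    t ∈ joinSet q (I.part (I.configOf t)) := by
  refine ⟨ht.1, fun i => Finset.mem_filter.2 ⟨ht.2 i, fun A hA => ?_⟩⟩
  rw [Finset.mem_powerset] at hA
  rw [configOf_of_subset hA, restrict_restrict hA]

theorem configOf_mem_liveConfigs (ht : t ∈ joinSet q I.rows) : I.configOf t ∈ I.liveConfigs :=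
  Finset.mem_filter.2 ⟨I.configOf_mem_configs t, fun i => ⟨_, (mem_joinSet_part_configOf ht).2 i⟩⟩

theorem mem_configs_of_mem_liveConfigs (hc : c ∈ I.liveConfigs) : c ∈ I.configs :=
  (Finset.mem_filter.1 hc).1

end Inst

end ConfigOf

section Output

variable {V D : Type*} [Fintype V] [DecidableEq V] [DecidableEq D] {m : ℕ} {q : Query V m}

theorem coe_joinRows_ofFn {R : Fin m → Finset (Tup V D)}
    (hR : ∀ i, ∀ t ∈ R i, HasSchema (q.schema i) t) :
    (joinRows (List.ofFn fun i => (⟨q.schema i, R i⟩ : Table V D)) : Set (Tup V D))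
      = joinSet q R := by
  ext u
  have attrs_eq : attrs (List.ofFn fun i => (⟨q.schema i, R i⟩ : Table V D)) = Finset.univ := by
    rw [attrs, List.map_ofFn]
    exact q.unionAll_schemas
  rw [Finset.mem_coe, mem_joinRows (List.forall_mem_ofFn_iff.2 hR), attrs_eq]
  simp only [HasSchema, Satisfies, List.forall_mem_ofFn_iff, Finset.mem_univ, iff_true, joinSet,
    Set.mem_ofPred_eq]

namespace Inst

theorem coe_joinRows_parts (I : Inst q D) (c : Config V m) :
    (joinRows (I.parts c) : Set (Tup V D)) = joinSet q (I.part c) :=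
  coe_joinRows_ofFn fun i t ht => I.wf i t (Finset.filter_subset _ _ ht)

theorem card_joinRows_parts (I : Inst q D) (c : Config V m) :
    (joinRows (I.parts c)).card = (joinSet q (I.part c)).ncard := by
  rw [← I.coe_joinRows_parts, Set.ncard_coe_finset]

theorem joinSet_part_subset (I : Inst q D) (c : Config V m) :
    joinSet q (I.part c) ⊆ joinSet q I.rows :=
  fun _ ht => ⟨ht.1, fun i => Finset.filter_subset _ _ (ht.2 i)⟩

theorem ncard_joinSet_part_le_OUT (I : Inst q D) (c : Config V m) :
    (joinSet q (I.part c)).ncard ≤ I.OUT := by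
  refine Set.ncard_le_ncard (I.joinSet_part_subset c) ?_
  rw [← coe_joinRows_ofFn I.wf]
  exact Finset.finite_toSet _

theorem card_joinRows_parts_le_OUT (I : Inst q D) (c : Config V m) :
    (joinRows (I.parts c)).card ≤ I.OUT :=
  (I.card_joinRows_parts c).trans_le (I.ncard_joinSet_part_le_OUT c)

end Inst

theorem Plan.out_parts_rows {p : Plan V} (hp : p.Valid q.schemas Finset.univ) (I : Inst q D)
    (c : Config V m) : (p.out (I.parts c) Finset.univ).rows = joinRows (I.parts c) := by
  have hwf := I.parts_wf c
  rw [p.out_eq hwf (I.attrs_parts c).ge ((I.map_schema_parts c).symm ▸ hp), ← I.attrs_parts c,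
    projJoin_attrs hwf]

theorem coe_runOut {choice : Config V m → Plan V}
    (hv : ∀ c, (choice c).Valid q.schemas Finset.univ) (I : Inst q D) :
    (runOut choice I : Set (Tup V D)) = joinSet q I.rows := by
  ext t
  simp only [runOut, Finset.coe_biUnion, Plan.out_parts_rows (hv _), Set.mem_iUnion,
    I.coe_joinRows_parts, Finset.mem_coe, exists_prop]
  exact ⟨fun ⟨c, _, h⟩ => I.joinSet_part_subset c h,
    fun h => ⟨_, Inst.configOf_mem_liveConfigs h, Inst.mem_joinSet_part_configOf h⟩⟩

end Output

section RunSteps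

theorem half_le_log_add_two (n : ℕ) : (1 : ℝ) / 2 ≤ Real.log (n + 2) := by
  have h2 : Real.log 2 ≤ Real.log ((n : ℝ) + 2) := Real.log_le_log (by norm_num) (by simp)
  linarith [Real.log_two_gt_d9]

theorem natLog_two_add_one_le (n : ℕ) : (Nat.log 2 n : ℝ) + 1 ≤ 4 * Real.log (n + 2) := by
  have log_two_lt := Real.log_two_gt_d9
  have natLog_le : (Nat.log 2 n : ℝ) * Real.log 2 ≤ Real.log (n + 2) := by
    rcases Nat.eq_zero_or_pos n with rfl | hn
    · simp [Real.log_nonneg]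
    · rw [← Real.log_pow]
      refine Real.log_le_log (by positivity) ?_
      have : ((2 ^ Nat.log 2 n : ℕ) : ℝ) ≤ n := by exact_mod_cast Nat.pow_log_le_self 2 hn.ne'
      push_cast at this
      linarith
  nlinarith [half_le_log_add_two n, Nat.cast_nonneg (α := ℝ) (Nat.log 2 n)]

theorem Inst.card_le_IN {V D : Type*} {m : ℕ} {q : Query V m} (I : Inst q D) (i : Fin m) :
    (I.rows i).card ≤ I.IN :=
  Finset.single_le_sum (f := fun i => (I.rows i).card) (fun _ _ => Nat.zero_le _)
    (Finset.mem_univ i)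

theorem Inst.one_le_IN {V D : Type*} {m : ℕ} {q : Query V m} (I : Inst q D) (hm : 0 < m) :
    (1 : ℝ) ≤ I.IN :=
  (I.one_le_card ⟨0, hm⟩).trans (by exact_mod_cast I.card_le_IN _)

variable {V D : Type*} [Fintype V] {m : ℕ} {q : Query V m}

theorem Inst.degree_scan_steps_le (I : Inst q D) :
    ∑ i, ∑ _A ∈ (q.schema i).powerset, 2 * (I.rows i).card
      ≤ 2 * 2 ^ Fintype.card V * I.IN := by
  rw [Inst.IN, Finset.mul_sum]
  refine Finset.sum_le_sum fun i _ => ?_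
  rw [Finset.sum_const, smul_eq_mul, Finset.card_powerset, mul_left_comm, mul_assoc]
  gcongr
  · exact one_le_two
  · exact Finset.card_le_univ _

variable [DecidableEq V]

theorem Inst.card_configs_le (I : Inst q D) :
    I.configs.card ≤ (Nat.log 2 I.IN + 1) ^ (m * 2 ^ Fintype.card V) := by
  refine (Finset.card_filter_le _ _).trans ?_
  rw [Fintype.card_piFinset, mul_comm m, pow_mul]
  refine (Finset.prod_le_pow_card _ _ ((Nat.log 2 I.IN + 1) ^ 2 ^ Fintype.card V)
    fun i _ => ?_).trans_eq (by simp)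
  rw [Fintype.card_piFinset]
  refine (Finset.prod_le_pow_card _ _ (Nat.log 2 I.IN + 1) fun A _ => ?_).trans_eq (by simp)
  split_ifs
  · rw [Finset.card_range]
    exact Nat.succ_le_succ (Nat.log_mono_right (I.card_le_IN i))
  · simp

theorem Inst.card_configs_le_log (I : Inst q D) :
    (I.configs.card : ℝ) ≤ (4 * Real.log (I.IN + 2)) ^ (m * 2 ^ Fintype.card V) := by
  have h : (I.configs.card : ℝ) ≤ ((Nat.log 2 I.IN : ℝ) + 1) ^ (m * 2 ^ Fintype.card V) := by
    exact_mod_cast I.card_configs_le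
  exact h.trans (pow_le_pow_left₀ (by positivity) (natLog_two_add_one_le _) _)

variable [DecidableEq D]

theorem Inst.sum_card_part_le (I : Inst q D) (c : Config V m) :
    ∑ i, (1 + (I.part c i).card) ≤ m + I.IN := by
  rw [Finset.sum_add_distrib]
  gcongr
  · simp
  · exact Finset.sum_le_sum fun i _ => Finset.card_filter_le _ _

/-- A constant for the cost of a run over all configurations: `runSteps_le`. The first factor
converts the logarithms to base `2` that count the configurations into natural ones. -/
def runConst (V : Type*) [Fintype V] (m : ℕ) : ℕ :=
  4 ^ (m * 2 ^ Fintype.card V) * (2 * 2 ^ Fintype.card V + m + 2)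

theorem runSteps_le_of_steps_le (choice : Config V m → Plan V) (I : Inst q D) {B : ℝ} (hB₀ : 0 ≤ B)
    (hB : ∀ c ∈ I.liveConfigs, ((choice c).steps (I.parts c) Finset.univ : ℝ)
      + ((choice c).out (I.parts c) Finset.univ).rows.card ≤ B) :
    (runSteps choice I : ℝ)
      ≤ 2 * 2 ^ Fintype.card V * I.IN + I.configs.card * (1 + (m + I.IN)) + I.configs.card * B := by
  have scan_le : ((∑ i, ∑ _A ∈ (q.schema i).powerset, 2 * (I.rows i).card : ℕ) : ℝ)
      ≤ 2 * 2 ^ Fintype.card V * I.IN := by exact_mod_cast I.degree_scan_steps_le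
  have fetch_le : ((∑ c ∈ I.configs, (1 + ∑ i, (1 + (I.part c i).card)) : ℕ) : ℝ)
      ≤ I.configs.card * (1 + (m + I.IN)) := by
    have := Finset.sum_le_card_nsmul I.configs _ _
      fun c _ => Nat.add_le_add_left (I.sum_card_part_le c) 1
    exact_mod_cast this
  have plans_le : ((∑ c ∈ I.liveConfigs, ((choice c).steps (I.parts c) Finset.univ
      + ((choice c).out (I.parts c) Finset.univ).rows.card) : ℕ) : ℝ) ≤ I.configs.card * B := by
    push_cast
    refine (Finset.sum_le_card_nsmul _ _ B hB).trans ?_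
    rw [nsmul_eq_mul]
    gcongr
    exact Finset.filter_subset _ _
  rw [runSteps]
  rw [Nat.cast_add, Nat.cast_add]
  exact add_le_add_three scan_le fetch_le plans_le

theorem runSteps_le {choice : Config V m → Plan V}
    (hv : ∀ c, (choice c).Valid q.schemas Finset.univ) (I : Inst q D) {a F : ℝ} (ha : 0 ≤ a)
    (hF : 1 ≤ F) (hIN : I.IN ≤ F)
    (h : ∀ c ∈ I.liveConfigs, ((choice c).steps (I.parts c) Finset.univ : ℝ)
      + (joinRows (I.parts c)).card ≤ a * F) :
    (runSteps choice I : ℝ)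
      ≤ runConst V m * (a + 1) * Real.log (I.IN + 2) ^ (m * 2 ^ Fintype.card V) * F := by
  set k := m * 2 ^ Fintype.card V
  set L := Real.log ((I.IN : ℝ) + 2)
  have one_le : 1 ≤ (4 * L) ^ k := one_le_pow₀ (by linarith [half_le_log_add_two I.IN])
  have hm : (0 : ℝ) ≤ m := Nat.cast_nonneg _
  calc (runSteps choice I : ℝ)
      ≤ 2 * 2 ^ Fintype.card V * I.IN + I.configs.card * (1 + (m + I.IN))
          + I.configs.card * (a * F) :=
        runSteps_le_of_steps_le choice I (by positivity) fun c hc => by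
          simpa only [Plan.out_parts_rows (hv c)] using h c hc
    _ ≤ (4 * L) ^ k * (2 * 2 ^ Fintype.card V * F) + (4 * L) ^ k * ((m + 2) * F)
          + (4 * L) ^ k * (a * F) := by
        gcongr ?_ + ?_ + ?_
        · exact (mul_le_mul_of_nonneg_left hIN (by positivity)).trans
            (le_mul_of_one_le_left (by positivity) one_le)
        · exact mul_le_mul I.card_configs_le_log (by nlinarith) (by positivity) (by positivity)
        · exact mul_le_mul_of_nonneg_right I.card_configs_le_log (by positivity)
    _ = 4 ^ k * (2 * 2 ^ Fintype.card V + m + 2 + a) * L ^ k * F := by rw [mul_pow]; ring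
    _ ≤ 4 ^ k * ((2 * 2 ^ Fintype.card V + m + 2) * (a + 1)) * L ^ k * F := by
        have : 0 ≤ L := (by norm_num : (0 : ℝ) ≤ 1 / 2).trans (half_le_log_add_two I.IN)
        have : (0 : ℝ) ≤ 2 ^ Fintype.card V * a := by positivity
        gcongr
        nlinarith [mul_nonneg hm ha]
    _ = _ := by rw [runConst]; push_cast; ring

end RunSteps

section SinglePlanRuns

variable {V : Type*} [Fintype V] [DecidableEq V] {m : ℕ} {q : Query V m}

theorem Query.coe_schemas {V : Type*} {m : ℕ} (q : Query V m) :
    (q.schemas : Multiset (Finset V)) = Finset.univ.val.map q.schema := by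
  rw [Query.schemas, Fin.univ_val_map]

namespace Inst

variable {D : Type*} [DecidableEq D] {I : Inst q D} {c : Config V m}

theorem card_le_IN_of_mem_parts : ∀ R ∈ I.parts c, (R.rows.card : ℝ) ≤ I.IN := fun R hR => by
  obtain ⟨i, rfl⟩ := mem_parts.1 hR
  exact_mod_cast (Finset.card_filter_le _ _).trans (I.card_le_IN i)

theorem selfPacks_parts (hc : c ∈ I.configs) : SelfPacks (I.parts c) I.IN where
  card_le := card_le_IN_of_mem_parts
  packs R hR := by
    obtain ⟨i, rfl⟩ := mem_parts.1 hR
    exact (packs_schema hc ⟨_, List.mem_singleton_self _, I.dominates_part c _ i⟩).mono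
      (by linarith [I.one_le_card i]) (by exact_mod_cast I.card_le_IN i)

theorem packs_parts_agm (hc : c ∈ I.configs) (X : Finset V) : Packs (I.parts c) X (I.agm X) :=
  packs_agm hc fun i => ⟨_, mem_parts.2 ⟨i, rfl⟩, I.dominates_part c X i⟩

theorem dbpBound_parts_le_agm (hc : c ∈ I.configs) (X : Finset V) :
    dbpBound (I.parts c) X ≤ I.agm X :=
  (packs_parts_agm hc X).dbpBound_le (by linarith [I.one_le_agm X])

theorem light_univ_steps_le (hc : c ∈ I.configs) :
    ((Plan.light Finset.univ .done).steps (I.parts c) Finset.univ : ℝ)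
      + (joinRows (I.parts c)).card
      ≤ (lightConst V m + 3 * loopConst V m + 1) * (I.IN + I.agm Finset.univ) := by
  have one_le_agm := I.one_le_agm Finset.univ
  have : (0 : ℝ) ≤ I.IN := Nat.cast_nonneg _
  have hpack : Packs (I.parts c) Finset.univ (I.IN + I.agm Finset.univ) :=
    (packs_parts_agm hc _).mono (by linarith) (by linarith)
  have hlen : (I.parts c).length = m := List.length_ofFn
  have hwf := I.parts_wf c
  have hX : Finset.univ ⊆ attrs (I.parts c) := (I.attrs_parts c).ge
  have light_le := hpack.lightSteps_le hwf (by linarith) fun R hR =>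
    (card_le_IN_of_mem_parts R hR).trans (by linarith)
  have card_le := hpack.card_lightRel_le hwf (by linarith)
  have reduce_eq : lightReduce (I.parts c) Finset.univ = [lightRel (I.parts c) Finset.univ] := by
    simp [lightReduce]
  have rel_wf := lightRel_wf hwf hX
  rw [hlen] at light_le card_le
  rw [← joinRows_lightReduce hwf hX, Plan.steps, Plan.steps, reduce_eq, joinSteps_singleton rel_wf,
    joinRows_singleton rel_wf]
  push_cast
  linarith

end Inst

theorem Plan.valid_light_univ_done (q : Query V m) :
    (Plan.light Finset.univ .done).Valid q.schemas Finset.univ :=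
  ⟨q.unionAll_schemas.ge, Finset.univ, by simp, subset_rfl⟩

omit [Fintype V] in
theorem Plan.EarPlan.length_pos {p : Plan V} {l : List (Finset V)} (hp : p.EarPlan l) :
    0 < l.length := by
  cases hp with
  | single => exact Nat.one_pos
  | step l k => exact k.pos

universe u

theorem exists_earPlan_runSteps_le {p : Plan V} (hp : p.EarPlan q.schemas) :
    ∃ (C : ℝ) (k : ℕ), ∀ (D : Type u) [DecidableEq D] (I : Inst q D),
      (runOut (fun _ => p) I : Set (Tup V D)) = joinSet q I.rows ∧
      (runSteps (fun _ => p) I : ℝ) ≤ C * Real.log (I.IN + 2) ^ k * (I.IN + I.OUT) := by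
  have hv : p.Valid q.schemas Finset.univ := q.unionAll_schemas ▸ hp.valid
  have hm : 0 < m := by simpa [Query.schemas] using hp.length_pos
  obtain ⟨C, K, hCK⟩ := hp.steps_le
  refine ⟨_, _, fun D _ I => ⟨coe_runOut (fun _ => hv) I,
    runSteps_le (fun _ => hv) I (a := C + K + 1) (by positivity) ?_ (by simp) fun c hc => ?_⟩⟩
  · linarith [I.one_le_IN hm, Nat.cast_nonneg (α := ℝ) I.OUT]
  have hout : ((joinRows (I.parts c)).card : ℝ) ≤ I.OUT := by
    exact_mod_cast I.card_joinRows_parts_le_OUT c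
  have hsteps := hCK D (I.parts c) I.IN (I.map_schema_parts c) (I.parts_wf c) (I.one_le_IN hm)
    (Inst.selfPacks_parts (Inst.mem_configs_of_mem_liveConfigs hc))
  rw [I.attrs_parts] at hsteps
  calc (p.steps (I.parts c) Finset.univ : ℝ) + (joinRows (I.parts c)).card
      ≤ C * I.IN + K * I.OUT + I.OUT := by linarith [mul_le_mul_of_nonneg_left hout K.cast_nonneg]
    _ ≤ C * I.IN + K * I.OUT + I.OUT + (C * I.OUT + K * I.IN + I.IN) :=
        le_add_of_nonneg_right (by positivity)
    _ = (C + K + 1) * (I.IN + I.OUT) := by ring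

theorem exists_light_univ_runSteps_le (q : Query V m) :
    ∃ (C : ℝ) (k : ℕ), ∀ (D : Type u) [DecidableEq D] (I : Inst q D),
      (runOut (fun _ => .light Finset.univ .done) I : Set (Tup V D)) = joinSet q I.rows ∧
      (runSteps (fun _ => .light Finset.univ .done) I : ℝ) ≤
        C * Real.log (I.IN + 2) ^ k * (I.IN + I.agm Finset.univ) :=
  have hv := Plan.valid_light_univ_done q
  ⟨_, _, fun D _ I => ⟨coe_runOut (fun _ => hv) I, runSteps_le (fun _ => hv) I (by positivity)
    (by linarith [I.one_le_agm Finset.univ, Nat.cast_nonneg (α := ℝ) I.IN])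
    (by linarith [I.one_le_agm Finset.univ])
    fun _ hc => Inst.light_univ_steps_le (Inst.mem_configs_of_mem_liveConfigs hc)⟩⟩

end SinglePlanRuns

/-! ## Light transforms on the bags of a decomposition -/

section Lights

variable {V : Type*} [DecidableEq V] {bs l : List (Finset V)} {p : Plan V}

/-- The plan that applies Light to the sets `bs` in turn and continues with `p`. -/
def Plan.lights (bs : List (Finset V)) (p : Plan V) : Plan V := bs.foldr .light p

/-- The schemas left of `l` by Light transforms on the given sets. -/
def lightsSchemas : List (Finset V) → List (Finset V) → List (Finset V)
  | [], l => l
  | b :: bs, l => lightsSchemas bs (b :: l.filter fun s => ¬ s ⊆ b)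

theorem unionAll_lightsSchemas (h : ∀ b ∈ bs, b ⊆ unionAll l) :
    unionAll (lightsSchemas bs l) = unionAll l := by
  induction bs generalizing l with
  | nil => rfl
  | cons b bs ih =>
    rw [List.forall_mem_cons] at h
    have hunion := unionAll_cons_filter_not_subset h.1
    rw [lightsSchemas, ih (hunion ▸ h.2), hunion]

theorem lightsSchemas_eq_append (l : List (Finset V)) (h : bs.Pairwise fun b b' => ¬ b ⊆ b') :
    lightsSchemas bs l = bs.reverse ++ l.filter fun s => ∀ b ∈ bs, ¬ s ⊆ b := by
  induction bs generalizing l with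
  | nil => simp [lightsSchemas]
  | cons b bs ih =>
    rw [List.pairwise_cons] at h
    rw [lightsSchemas, ih _ h.2, List.filter_cons_of_pos (by simpa using h.1),
      List.filter_filter, List.reverse_cons, List.append_assoc, List.singleton_append]
    congr 2
    exact List.filter_congr fun s _ => by simp [Bool.and_comm]

theorem Plan.lights_valid {O : Finset V} (h : ∀ b ∈ bs, b ⊆ unionAll l)
    (hp : p.Valid (lightsSchemas bs l) O) : (Plan.lights bs p).Valid l O := by
  induction bs generalizing l with
  | nil => exact hp
  | cons b bs ih =>
    rw [List.forall_mem_cons] at h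
    exact ⟨h.1, ih (unionAll_cons_filter_not_subset h.1 ▸ h.2) hp⟩

omit [DecidableEq V] in
theorem Plan.SplitLight.lights (hp : p.SplitLight) : (Plan.lights bs p).SplitLight := by
  induction bs with
  | nil => exact hp
  | cons _ _ ih => exact ih

theorem Plan.EarPlan.splitLight (hp : p.EarPlan l) : p.SplitLight := by
  induction hp with
  | single => trivial
  | step _ _ _ _ _ _ ih => exact ⟨trivial, ih, trivial⟩

end Lights

section Bags

variable {V : Type*} [Fintype V] [DecidableEq V] {m : ℕ} {q : Query V m}
  {D : Type*} [DecidableEq D] {I : Inst q D} {c : Config V m} {Rs : List (Table V D)}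
  {X b : Finset V} {bs : List (Finset V)} {M N : ℝ}

namespace Inst

/-- For each relation of the query, some table contains its schema and restricts to rows of `R(c)`.
Light transforms merge relations but keep this property, and with it the degree bounds of `c`. -/
def Refines (I : Inst q D) (c : Config V m) (Rs : List (Table V D)) : Prop :=
  ∀ i, ∃ T ∈ Rs, q.schema i ⊆ T.schema ∧ ∀ t ∈ T.rows, restrict (q.schema i) t ∈ I.part c i

namespace Refines

theorem exists_dominates (h : I.Refines c Rs) (X : Finset V) (i : Fin m) :
    ∃ T ∈ Rs, I.Dominates c X i T := by
  obtain ⟨T, hT, hs, hr⟩ := h i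
  exact ⟨T, hT, Finset.inter_subset_left.trans hs, fun t ht =>
    Finset.mem_image.2 ⟨_, hr t ht, restrict_restrict Finset.inter_subset_left t⟩⟩

theorem lightReduce (h : I.Refines c Rs) (hwf : ∀ R ∈ Rs, R.WF) (hX : X ⊆ attrs Rs) :
    I.Refines c (lightReduce Rs X) := fun i => by
  obtain ⟨T, hT, hs, hr⟩ := h i
  by_cases hTX : T.schema ⊆ X
  · refine ⟨_, mem_lightReduce.2 (.inl rfl), hs.trans hTX, fun u hu => ?_⟩
    rw [← restrict_restrict hs]
    exact hr _ (restrict_schema_mem_of_mem_lightRel hwf hX hT hTX hu)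
  · exact ⟨T, mem_lightReduce.2 (.inr ⟨hT, hTX⟩), hs, hr⟩

theorem dominates_lightRel (h : I.Refines c Rs) (hwf : ∀ R ∈ Rs, R.WF) (hX : X ⊆ attrs Rs)
    (i : Fin m) : I.Dominates c X i (lightRel Rs X) := by
  obtain ⟨T, hT, hs, hr⟩ := h i
  refine ⟨Finset.inter_subset_right, fun u hu => ?_⟩
  obtain ⟨r, hrT, he⟩ := ((mem_lightRel hwf hX).1 hu).2 T hT
  refine Finset.mem_image.2 ⟨_, hr r hrT, ?_⟩
  rw [restrict_restrict Finset.inter_subset_left,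
    ← restrict_restrict Finset.inter_subset_right r, he,
    restrict_restrict (Finset.inter_subset_inter_right hs)]

end Refines

/-- The invariant of the Light transforms on the bags of a decomposition, `bs` being the bags still
to come: all relations have at most `M` rows, and those that no remaining bag will absorb give the
packing bound `N`. -/
structure BagReduction (I : Inst q D) (c : Config V m) (bs : List (Finset V)) (M N : ℝ)
    (Rs : List (Table V D)) : Prop where
  wf : ∀ R ∈ Rs, R.WF
  refines : I.Refines c Rs
  card_le : ∀ R ∈ Rs, (R.rows.card : ℝ) ≤ M
  packs : ∀ R ∈ Rs, Packs [R] R.schema N ∨ ∃ b ∈ bs, R.schema ⊆ b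

namespace BagReduction

theorem selfPacks (h : I.BagReduction c [] M N Rs) (hN : 0 < N) (hNM : N ≤ M) :
    SelfPacks Rs M where
  card_le := h.card_le
  packs R hR := ((h.packs R hR).resolve_right (by simp)).mono hN hNM

theorem packs_bag (h : I.BagReduction c bs M N Rs) (hc : c ∈ I.configs) (hb : I.agm b ≤ N) :
    Packs Rs b N :=
  (packs_agm hc (h.refines.exists_dominates b)).mono (by linarith [I.one_le_agm b]) hb

theorem lightSteps_le (h : I.BagReduction c bs M N Rs) (hc : c ∈ I.configs) (hb : I.agm b ≤ N)
    (hNM : N ≤ M) : (lightSteps Rs b : ℝ) ≤ lightConst V Rs.length * M := by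
  have hN : 0 < N := by linarith [I.one_le_agm b]
  exact ((h.packs_bag hc hb).mono hN hNM).lightSteps_le h.wf (hN.trans_le hNM) h.card_le

theorem lightReduce (h : I.BagReduction c (b :: bs) M N Rs) (hc : c ∈ I.configs)
    (hb : I.agm b ≤ N) (hM : 0 ≤ M) (hX : b ⊆ attrs Rs) :
    I.BagReduction c bs (M + loopConst V Rs.length * N) N (lightReduce Rs b) where
  wf := lightReduce_wf h.wf hX
  refines := h.refines.lightReduce h.wf hX
  card_le R hR := by
    have hN : 0 < N := by linarith [I.one_le_agm b]
    rcases mem_lightReduce.1 hR with rfl | ⟨hR, -⟩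
    · exact ((h.packs_bag hc hb).card_lightRel_le h.wf hN).trans (le_add_of_nonneg_left hM)
    · exact (h.card_le R hR).trans (le_add_of_nonneg_right (by positivity))
  packs R hR := by
    rcases mem_lightReduce.1 hR with rfl | ⟨hR, hRb⟩
    · exact .inl ((packs_agm hc fun i => ⟨_, List.mem_singleton_self _,
        h.refines.dominates_lightRel h.wf hX i⟩).mono (by linarith [I.one_le_agm b]) hb)
    · refine (h.packs R hR).imp_right ?_
      rintro ⟨b', hb', hRb'⟩
      rcases List.mem_cons.1 hb' with rfl | hb'
      · exact absurd hRb' hRb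
      · exact ⟨b', hb', hRb'⟩

end BagReduction

theorem bagReduction_parts (I : Inst q D) (c : Config V m) (N : ℝ)
    (h : ∀ i, ∃ b ∈ bs, q.schema i ⊆ b) : I.BagReduction c bs I.IN N (I.parts c) where
  wf := I.parts_wf c
  refines i := ⟨_, mem_parts.2 ⟨i, rfl⟩, subset_rfl, fun t ht => by
    rwa [HasSchema.restrict_eq_self (I.wf i t (Finset.filter_subset _ _ ht))]⟩
  card_le := card_le_IN_of_mem_parts
  packs R hR := by
    obtain ⟨i, rfl⟩ := mem_parts.1 hR
    exact .inr (h i)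

end Inst

universe u

theorem Plan.EarPlan.lights_steps_le {l : List (Finset V)} {p : Plan V}
    (hp : p.EarPlan (lightsSchemas bs l)) (hbs : ∀ b ∈ bs, b ⊆ unionAll l) {κ : ℕ} (hκ : 1 ≤ κ) :
    ∃ C K : ℕ, ∀ (D : Type u) [DecidableEq D] (I : Inst q D) (c : Config V m)
      (Rs : List (Table V D)) (N : ℝ), c ∈ I.configs → Rs.map Table.schema = l → 1 ≤ N →
      (∀ b ∈ bs, I.agm b ≤ N) → I.BagReduction c bs (κ * N) N Rs →
      ((Plan.lights bs p).steps Rs (attrs Rs) : ℝ) ≤ C * N + K * (joinRows Rs).card := by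
  have le_mul {κ : ℕ} (hκ : 1 ≤ κ) {N : ℝ} (hN : 1 ≤ N) : N ≤ κ * N :=
    le_mul_of_one_le_left (by linarith) (by exact_mod_cast hκ)
  induction bs generalizing l κ with
  | nil =>
    obtain ⟨C, K, hCK⟩ := hp.steps_le
    refine ⟨C * κ, K, fun D _ I c Rs N _ hl hN _ h => ?_⟩
    have hκN := le_mul hκ hN
    rw [Nat.cast_mul, mul_assoc]
    exact hCK D Rs (κ * N) hl h.wf (hN.trans hκN) (h.selfPacks (by linarith) hκN)
  | cons b bs ih =>
    rw [List.forall_mem_cons] at hbs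
    obtain ⟨C, K, hCK⟩ := ih hp (unionAll_cons_filter_not_subset hbs.1 ▸ hbs.2)
      (κ := κ + loopConst V l.length) (by omega)
    refine ⟨lightConst V l.length * κ + C, K, fun D _ I c Rs N hc hl hN hagm h => ?_⟩
    obtain ⟨hb, hagm⟩ := List.forall_mem_cons.1 hagm
    have hX : b ⊆ attrs Rs := by rw [attrs, hl]; exact hbs.1
    have hlen : Rs.length = l.length := by rw [← hl, List.length_map]
    have hlight := h.lightSteps_le hc hb (le_mul hκ hN)
    have hreduced := h.lightReduce hc hb (by positivity) hX
    rw [hlen] at hlight hreduced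
    rw [← add_mul, ← Nat.cast_add] at hreduced
    have hrest := hCK D I c (lightReduce Rs b) N hc (by rw [map_schema_lightReduce, hl]) hN hagm
      hreduced
    rw [joinRows_lightReduce h.wf hX, attrs_lightReduce hX] at hrest
    change ((lightSteps Rs b + (Plan.lights bs p).steps _ _ : ℕ) : ℝ) ≤ _
    push_cast
    linarith

/-- `B` consists of the bags of a decomposition of the query, none of which contains another; that
the bags can be arranged in a tree is expressed by GYO-acyclicity. -/
structure Query.ReducedBags (q : Query V m) (B : Finset (Finset V)) : Prop where
  acyclic : GYOAcyclic B.val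
  covers : ∀ i, ∃ b ∈ B, q.schema i ⊆ b
  antichain : IsAntichain (· ⊆ ·) (B : Set (Finset V))

omit [DecidableEq V] in
theorem Query.reducedBags_univ (q : Query V m) : q.ReducedBags {Finset.univ} :=
  ⟨.single _, fun i => ⟨Finset.univ, by simp, Finset.subset_univ _⟩, by simp⟩

omit [Fintype V] [DecidableEq V] in
theorem GHD.exists_reducedBags {n : ℕ} (T : GHD q n) :
    ∃ B, q.ReducedBags B ∧ ∀ b ∈ B, ∃ t, T.bag t = b := by
  obtain ⟨B, hB, hle, hsub, hanti⟩ :=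
    (GYOAcyclic.of_isTree T.isTree T.running).exists_antichain
  refine ⟨B, ⟨hB, fun i => ?_, hanti⟩, fun b hb => ?_⟩
  · obtain ⟨t, ht⟩ := T.covers i
    obtain ⟨b, hb, htb⟩ := hsub (T.bag t) (Multiset.mem_map_of_mem _ (Finset.mem_univ t))
    exact ⟨b, hb, ht.trans htb⟩
  · obtain ⟨t, -, ht⟩ := Multiset.mem_map.1 (Multiset.mem_of_le hle hb)
    exact ⟨t, ht⟩

namespace Query.ReducedBags

variable {B : Finset (Finset V)}

omit [Fintype V] [DecidableEq V] in
theorem nonempty (hB : q.ReducedBags B) : B.Nonempty := by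
  have := hB.acyclic
  rw [Finset.nonempty_iff_ne_empty]
  rintro rfl
  generalize hM : (∅ : Finset (Finset V)).val = M at this
  cases this <;> simp at hM

omit [Fintype V] in
theorem lightsSchemas_eq (hB : q.ReducedBags B) :
    lightsSchemas B.toList q.schemas = B.toList.reverse := by
  have hpairwise : B.toList.Pairwise fun b b' => ¬ b ⊆ b' :=
    B.nodup_toList.imp_of_mem fun ha hb hne hab =>
      hB.antichain (Finset.mem_toList.1 ha) (Finset.mem_toList.1 hb) hne hab
  rw [lightsSchemas_eq_append _ hpairwise, List.filter_eq_nil_iff.2, List.append_nil]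
  intro s hs
  obtain ⟨i, rfl⟩ := (List.mem_ofFn' _ _).1 hs
  simpa using hB.covers i

theorem exists_plan (hB : q.ReducedBags B) :
    ∃ (p : Plan V) (C K : ℕ), p.SplitLight ∧ p.Valid q.schemas Finset.univ ∧
      ∀ (D : Type u) [DecidableEq D] (I : Inst q D) (c : Config V m) (N : ℝ),
        c ∈ I.configs → 1 ≤ N → (I.IN : ℝ) ≤ N → (∀ b ∈ B, I.agm b ≤ N) →
        (p.steps (I.parts c) Finset.univ : ℝ) ≤ C * N + K * (joinRows (I.parts c)).card := by
  have hacyclic : GYOAcyclic (lightsSchemas B.toList q.schemas : Multiset (Finset V)) := by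
    rw [hB.lightsSchemas_eq, Multiset.coe_reverse, Finset.coe_toList]
    exact hB.acyclic
  obtain ⟨p, hp⟩ := Plan.exists_earPlan hacyclic
  have hsub : ∀ b ∈ B.toList, b ⊆ unionAll q.schemas := fun b _ => by
    rw [q.unionAll_schemas]
    exact Finset.subset_univ b
  obtain ⟨C, K, hCK⟩ := hp.lights_steps_le.{u} (q := q) hsub le_rfl
  refine ⟨.lights B.toList p, C, K, hp.splitLight.lights, Plan.lights_valid hsub ?_,
    fun D _ I c N hc hN hIN hagm => ?_⟩
  · rw [← q.unionAll_schemas, ← unionAll_lightsSchemas hsub]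
    exact hp.valid
  · have hreduction := I.bagReduction_parts c N (bs := B.toList) (by simpa using hB.covers)
    rw [← I.attrs_parts c]
    exact hCK D I c (I.parts c) N hc (I.map_schema_parts c) hN (by simpa using hagm)
      { hreduction with card_le := fun R hR => by simpa using (hreduction.card_le R hR).trans hIN }

end Query.ReducedBags

theorem Query.exists_plan_of_reducedBags (q : Query V m) :
    ∃ C K : ℕ, ∀ B, q.ReducedBags B →
      ∃ p : Plan V, p.SplitLight ∧ p.Valid q.schemas Finset.univ ∧
        ∀ (D : Type u) [DecidableEq D] (I : Inst q D) (c : Config V m) (N : ℝ),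
          c ∈ I.configs → 1 ≤ N → (I.IN : ℝ) ≤ N → (∀ b ∈ B, I.agm b ≤ N) →
          (p.steps (I.parts c) Finset.univ : ℝ) ≤ C * N + K * (joinRows (I.parts c)).card := by
  classical
  choose p C K hsplit hvalid hsteps using
    fun B : {B : Finset (Finset V) // q.ReducedBags B} => B.2.exists_plan.{u}
  refine ⟨∑ B, C B, ∑ B, K B, fun B hB => ⟨p ⟨B, hB⟩, hsplit _, hvalid _,
    fun D _ I c N hc hN hIN hagm => (hsteps ⟨B, hB⟩ D I c N hc hN hIN hagm).trans ?_⟩⟩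
  gcongr
  · exact Finset.single_le_sum (fun _ _ => Nat.zero_le _) (Finset.mem_univ _)
  · exact Finset.single_le_sum (fun _ _ => Nat.zero_le _) (Finset.mem_univ _)

end Bags

/-! ## The plan chosen by DARTS -/

section Darts

variable {V : Type*} {m : ℕ} {q : Query V m} {D : Type*} {X : Finset V}

theorem Query.FracCover.min_one [DecidableEq V] {w : Fin m → ℝ} (hw : q.FracCover X w) :
    q.FracCover X fun i => min (w i) 1 := by
  have min_nonneg (i : Fin m) : 0 ≤ min (w i) 1 := le_min (hw.1 i) zero_le_one
  refine ⟨min_nonneg, fun a ha => ?_⟩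
  by_cases hlarge : ∃ i, a ∈ q.schema i ∧ 1 ≤ w i
  · obtain ⟨i, hi, hwi⟩ := hlarge
    calc (1 : ℝ) = min (w i) 1 := (min_eq_right hwi).symm
      _ ≤ ∑ i with a ∈ q.schema i, min (w i) 1 :=
        Finset.single_le_sum (f := fun i => min (w i) 1) (fun i _ => min_nonneg i)
          (by simpa using hi)
  · push Not at hlarge
    refine (hw.2 a ha).trans_eq (Finset.sum_congr rfl fun i hi => ?_)
    exact (min_eq_left (hlarge i (Finset.mem_filter.1 hi).2).le).symm

variable [Fintype V] [DecidableEq V] {I I' : Inst q D} {c : Config V m}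

namespace Inst

theorem card_le_two_mul_of_mem_configs (h : c ∈ I.configs) (h' : c ∈ I'.configs) (i : Fin m) :
    (I'.rows i).card ≤ 2 * (I.rows i).card := by
  have hlog : Nat.log 2 (I'.rows i).card = Nat.log 2 (I.rows i).card :=
    (mem_configs h' i).2.1.symm.trans (mem_configs h i).2.1
  have hlt := Nat.lt_pow_succ_log_self one_lt_two (I'.rows i).card
  have hle := Nat.pow_log_le_self 2 (I.nonempty i).card_pos.ne'
  rw [hlog, pow_succ] at hlt
  omega

theorem IN_le_two_mul_of_mem_configs (h : c ∈ I.configs) (h' : c ∈ I'.configs) :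
    I'.IN ≤ 2 * I.IN := by
  rw [Inst.IN, Inst.IN, Finset.mul_sum]
  exact Finset.sum_le_sum fun i _ => card_le_two_mul_of_mem_configs h h' i

theorem agm_le_two_pow_mul_of_mem_configs (h : c ∈ I.configs) (h' : c ∈ I'.configs)
    (X : Finset V) : I'.agm X ≤ 2 ^ m * I.agm X := by
  have two_pow_pos : (0 : ℝ) < 2 ^ m := by positivity
  rw [← div_le_iff₀' two_pow_pos]
  refine I.le_agm fun w hw => ?_
  rw [div_le_iff₀' two_pow_pos]
  have hw' := hw.min_one
  calc I'.agm X ≤ ∏ i, ((I'.rows i).card : ℝ) ^ min (w i) 1 := I'.agm_le hw'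
    _ ≤ ∏ i, (2 * (I.rows i).card : ℝ) ^ min (w i) 1 := by
        gcongr with i
        · exact hw'.1 i
        · exact_mod_cast card_le_two_mul_of_mem_configs h h' i
    _ = ∏ i, 2 ^ min (w i) 1 * ((I.rows i).card : ℝ) ^ min (w i) 1 :=
        Finset.prod_congr rfl fun i _ => Real.mul_rpow zero_le_two (Nat.cast_nonneg _)
    _ ≤ ∏ i, 2 ^ (1 : ℝ) * ((I.rows i).card : ℝ) ^ w i := by
        gcongr with i
        · exact one_le_two
        · exact min_le_right _ _
        · exact I.one_le_card i
        · exact min_le_left _ _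
    _ = 2 ^ m * ∏ i, ((I.rows i).card : ℝ) ^ w i := by
        rw [Finset.prod_mul_distrib]
        simp

end Inst

theorem qBound_le_iff [DecidableEq D] {K x : ℕ} {p : Plan V} :
    qBound q D K c p ≤ x ↔ ∀ I : Inst q D, c ∈ I.liveConfigs →
      p.steps (I.parts c) Finset.univ ≤ x + K * (joinRows (I.parts c)).card := by
  simp only [qBound, iSup_le_iff, Subtype.forall, Nat.cast_le, Nat.sub_le_iff_le_add,
    Inst.card_joinRows_parts]

universe u

theorem dartsChoice_spec {rep : Set (Plan V)} (hrep : {p | p.SplitLight} ⊆ rep) (q : Query V m)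
    (D : Type u) [DecidableEq D] (K : ℕ) (c : Config V m) :
    (dartsChoice q D K rep c).Valid q.schemas Finset.univ ∧
      ∀ p : Plan V, p.SplitLight → p.Valid q.schemas Finset.univ →
        qBound q D K c (dartsChoice q D K rep c) ≤ qBound q D K c p := by
  have exists_min : ∃ p, (p ∈ rep ∧ p.Valid q.schemas Finset.univ) ∧
      ∀ p', p' ∈ rep ∧ p'.Valid q.schemas Finset.univ →
        qBound q D K c p ≤ qBound q D K c p' := by
    obtain ⟨p₀, -, -, hsplit, hvalid, -⟩ := q.reducedBags_univ.exists_plan.{u}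
    obtain ⟨p, hp, hmin⟩ := exists_minimalFor_of_wellFoundedLT
      (fun p => p ∈ rep ∧ p.Valid q.schemas Finset.univ) (qBound q D K c) ⟨p₀, hrep hsplit, hvalid⟩
    exact ⟨p, hp, fun p' hp' => (le_total _ _).elim id (hmin hp')⟩
  rw [dartsChoice, dif_pos exists_min]
  exact ⟨exists_min.choose_spec.1.2, fun p hsplit hvalid =>
    exists_min.choose_spec.2 p ⟨hrep hsplit, hvalid⟩⟩

theorem dartsChoice_steps_le {rep : Set (Plan V)} (hrep : {p | p.SplitLight} ⊆ rep)
    [DecidableEq D] {K : ℕ} {p : Plan V} (hsplit : p.SplitLight)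
    (hvalid : p.Valid q.schemas Finset.univ) {x : ℝ} (hx : 0 ≤ x)
    (h : ∀ I : Inst q D, c ∈ I.liveConfigs →
      (p.steps (I.parts c) Finset.univ : ℝ) ≤ x + K * (joinRows (I.parts c)).card)
    (hc : c ∈ I.liveConfigs) :
    ((dartsChoice q D K rep c).steps (I.parts c) Finset.univ : ℝ)
      ≤ x + K * (joinRows (I.parts c)).card := by
  have hp : qBound q D K c p ≤ ⌊x⌋₊ := qBound_le_iff.2 fun I' hI' => by
    rw [← Nat.floor_add_natCast hx]
    exact Nat.le_floor (by exact_mod_cast h I' hI')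
  have hchoice := qBound_le_iff.1 (((dartsChoice_spec hrep q D K c).2 p hsplit hvalid).trans hp)
    I hc
  calc ((dartsChoice q D K rep c).steps (I.parts c) Finset.univ : ℝ)
      ≤ ⌊x⌋₊ + K * (joinRows (I.parts c)).card := by exact_mod_cast hchoice
    _ ≤ x + K * (joinRows (I.parts c)).card := by gcongr; exact Nat.floor_le hx

theorem exists_plan_steps_le_of_mem_liveConfigs (q : Query V m) :
    ∃ C K : ℕ, ∀ B, q.ReducedBags B →
      ∃ p : Plan V, p.SplitLight ∧ p.Valid q.schemas Finset.univ ∧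
        ∀ (D : Type u) [DecidableEq D] (I I' : Inst q D) (c : Config V m) (N : ℝ),
          c ∈ I.liveConfigs → c ∈ I'.liveConfigs → (I.IN : ℝ) ≤ N → (∀ b ∈ B, I.agm b ≤ N) →
          (p.steps (I'.parts c) Finset.univ : ℝ) ≤ C * N + K * (joinRows (I'.parts c)).card := by
  obtain ⟨C, K, hplan⟩ := q.exists_plan_of_reducedBags.{u}
  refine ⟨C * (2 * 2 ^ m), K, fun B hB => ?_⟩
  obtain ⟨p, hsplit, hvalid, hsteps⟩ := hplan B hB
  obtain ⟨b₀, hb₀⟩ := hB.nonempty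
  refine ⟨p, hsplit, hvalid, fun D _ I I' c N hc hc' hIN hagm => ?_⟩
  replace hc := Inst.mem_configs_of_mem_liveConfigs hc
  replace hc' := Inst.mem_configs_of_mem_liveConfigs hc'
  have one_le_N : 1 ≤ N := (I.one_le_agm b₀).trans (hagm b₀ hb₀)
  have one_le_two_pow : (1 : ℝ) ≤ 2 ^ m := one_le_pow₀ one_le_two
  have IN_le : (I'.IN : ℝ) ≤ 2 * I.IN := by exact_mod_cast Inst.IN_le_two_mul_of_mem_configs hc hc'
  refine (hsteps D I' c (2 * 2 ^ m * N) hc' (by nlinarith) (by nlinarith) fun b hb => ?_).trans_eq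
    (by push_cast; ring)
  calc I'.agm b ≤ 2 ^ m * I.agm b := Inst.agm_le_two_pow_mul_of_mem_configs hc hc' b
    _ ≤ 2 ^ m * N := by gcongr; exact hagm b hb
    _ ≤ 2 * 2 ^ m * N := by nlinarith

theorem exists_dartsChoice_runSteps_le (q : Query V m) :
    ∃ K₀ : ℕ, ∀ K ≥ K₀, ∃ (C : ℝ) (k : ℕ), ∀ rep : Set (Plan V), {p | p.SplitLight} ⊆ rep →
      ∀ (D : Type u) [DecidableEq D] (I : Inst q D) (B : Finset (Finset V)) (N : ℝ),
        q.ReducedBags B → (I.IN : ℝ) ≤ (m + 1) * N → (∀ b ∈ B, I.agm b ≤ N) →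
        (runSteps (dartsChoice q D K rep) I : ℝ) ≤
          C * Real.log (I.IN + 2) ^ k * (N + I.OUT) := by
  obtain ⟨C, K₀, hplan⟩ := exists_plan_steps_le_of_mem_liveConfigs.{u} q
  refine ⟨K₀, fun K hK => ⟨runConst V m * (C + K + 1 + 1) * (m + 1), m * 2 ^ Fintype.card V,
    fun rep hrep D _ I B N hB hIN hagm => ?_⟩⟩
  obtain ⟨p, hsplit, hvalid, hsteps⟩ := hplan B hB
  obtain ⟨b₀, hb₀⟩ := hB.nonempty
  have one_le_N : 1 ≤ N := (I.one_le_agm b₀).trans (hagm b₀ hb₀)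
  have N_le : N ≤ (m + 1) * N := le_mul_of_one_le_left (by linarith) (by simp)
  have OUT_le : (I.OUT : ℝ) ≤ (m + 1) * I.OUT := le_mul_of_one_le_left (by simp) (by simp)
  refine (runSteps_le (fun c => (dartsChoice_spec hrep q D K c).1) I
    (a := C + K + 1) (F := (m + 1) * (N + I.OUT)) (by positivity) (by linarith)
    (by linarith) fun c hc => ?_).trans_eq (by ring)
  have hchoice := dartsChoice_steps_le hrep hsplit hvalid (K := K) (x := C * ((m + 1) * N))
    (by positivity) (fun I' hI' => (hsteps D I I' c _ hc hI' hIN fun b hb =>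
      (hagm b hb).trans N_le).trans (by gcongr)) hc
  have hcard : ((joinRows (I.parts c)).card : ℝ) ≤ I.OUT := by
    exact_mod_cast I.card_joinRows_parts_le_OUT c
  calc ((dartsChoice q D K rep c).steps (I.parts c) Finset.univ : ℝ) + (joinRows (I.parts c)).card
      ≤ C * ((m + 1) * N) + K * (joinRows (I.parts c)).card + (joinRows (I.parts c)).card := by
        gcongr
    _ ≤ C * ((m + 1) * N) + K * ((m + 1) * I.OUT) + (m + 1) * I.OUT := by
        gcongr <;> exact hcard.trans OUT_le
    _ ≤ (C + K + 1) * ((m + 1) * (N + I.OUT)) := by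
        have : 0 ≤ (K + 1) * ((m + 1) * N) + C * ((m + 1) * (I.OUT : ℝ)) := by positivity
        linarith

end Darts

/-! ## Widths -/

section Widths

variable {V : Type*} {m : ℕ} {q : Query V m} {D : Type*} {f : Finset V → ℝ}

/-- The decomposition with a single bag. -/
def GHD.single [Fintype V] (q : Query V m) : GHD q 1 where
  tree := ⊥
  isTree := .of_subsingleton
  bag _ := Finset.univ
  covers _ := ⟨0, Finset.subset_univ _⟩
  running a := by
    have : Nonempty {_t : Fin 1 | a ∈ (Finset.univ : Finset V)} := ⟨⟨0, Finset.mem_univ a⟩⟩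
    exact ⟨fun x y => by rw [Subsingleton.elim x y]⟩

/-- The `f`-width of a query: the smallest possible value of the largest `f t` over the bags `t` of
a decomposition. The two widths `Query.fhw` and `Inst.fhw` are of this form by definition. -/
noncomputable def Query.width (q : Query V m) (f : Finset V → ℝ) : ℝ :=
  sInf {x : ℝ | ∃ (n : ℕ) (T : GHD q n), x = ⨆ t, f (T.bag t)}

theorem GHD.le_iSup {n : ℕ} (T : GHD q n) (f : Finset V → ℝ) (t : Fin n) :
    f (T.bag t) ≤ ⨆ t, f (T.bag t) :=
  le_ciSup (f := fun t => f (T.bag t)) (Set.finite_range _).bddAbove t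

namespace Query

theorem one_le_rhoStar [DecidableEq V] (q : Query V m) {X : Finset V} (hX : X.Nonempty) :
    1 ≤ q.rhoStar X := by
  obtain ⟨a, ha⟩ := hX
  refine le_csInf ⟨_, _, q.fracCover_one X, rfl⟩ ?_
  rintro _ ⟨w, hw, rfl⟩
  exact (hw.2 a ha).trans
    (Finset.sum_le_sum_of_subset_of_nonneg (Finset.filter_subset _ _) fun i _ _ => hw.1 i)

variable [Finite V]

theorem exists_ghd_width_eq (q : Query V m) (f : Finset V → ℝ) :
    ∃ (n : ℕ) (T : GHD q n), q.width f = ⨆ t, f (T.bag t) := by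
  cases nonempty_fintype V
  refine Set.Nonempty.csInf_mem (s := {x : ℝ | ∃ (n : ℕ) (T : GHD q n), x = ⨆ t, f (T.bag t)})
    ⟨_, 1, GHD.single q, rfl⟩ ?_
  refine (Set.finite_range fun s : Set (Finset V) => sSup (f '' s)).subset ?_
  rintro _ ⟨n, T, rfl⟩
  exact ⟨Set.range T.bag, congrArg sSup (Set.range_comp f T.bag).symm⟩

theorem exists_reducedBags_le_width (q : Query V m) (f : Finset V → ℝ) :
    ∃ B, q.ReducedBags B ∧ ∀ b ∈ B, f b ≤ q.width f := by
  obtain ⟨n, T, hT⟩ := q.exists_ghd_width_eq f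
  obtain ⟨B, hB, hbag⟩ := T.exists_reducedBags
  refine ⟨B, hB, fun b hb => ?_⟩
  obtain ⟨t, rfl⟩ := hbag b hb
  exact hT ▸ T.le_iSup f t

theorem le_width {x : ℝ} (h : ∀ (n : ℕ) (T : GHD q n), ∃ t, x ≤ f (T.bag t)) : x ≤ q.width f := by
  obtain ⟨n, T, hT⟩ := q.exists_ghd_width_eq f
  obtain ⟨t, ht⟩ := h n T
  exact hT ▸ ht.trans (T.le_iSup f t)

theorem width_zero (q : Query V m) : q.width (fun _ => 0) = 0 := by
  obtain ⟨_, _, hT⟩ := q.exists_ghd_width_eq fun _ => 0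
  simpa using hT

variable [DecidableEq V]

theorem one_le_fhw [Nonempty V] (q : Query V m) : 1 ≤ q.fhw :=
  le_width fun _ T =>
    have ⟨t, ht⟩ := (T.running (Classical.arbitrary V)).nonempty
    ⟨t, q.one_le_rhoStar ⟨_, ht⟩⟩

theorem fhw_eq_zero_of_isEmpty [IsEmpty (Fin m)] (q : Query V m) : q.fhw = 0 := by
  have hrho (X : Finset V) : q.rhoStar X = 0 := by
    have : {x : ℝ | ∃ w, q.FracCover X w ∧ x = ∑ i, w i} = {0} := by
      ext x
      simpa using fun _ => ⟨_, q.fracCover_one X⟩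
    rw [rhoStar, this, csInf_singleton]
  exact (congrArg q.width (funext hrho)).trans q.width_zero

end Query

namespace Inst

variable [DecidableEq V]

theorem agm_le_one (I : Inst q D) (h : I.IN ≤ 1) (X : Finset V) : I.agm X ≤ 1 := by
  refine (I.agm_le (q.fracCover_one X)).trans (Finset.prod_le_one (fun i _ => by positivity) ?_)
  intro i _
  rw [Real.rpow_one]
  exact_mod_cast (I.card_le_IN i).trans h

theorem logb_agm_le_rhoStar (I : Inst q D) (h : 1 < I.IN) (X : Finset V) :
    Real.logb I.IN (I.agm X) ≤ q.rhoStar X := by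
  have one_lt_IN : (1 : ℝ) < I.IN := by exact_mod_cast h
  refine le_csInf ⟨_, _, q.fracCover_one X, rfl⟩ ?_
  rintro _ ⟨w, hw, rfl⟩
  rw [Real.logb_le_iff_le_rpow one_lt_IN (zero_lt_one.trans_le (I.one_le_agm X)),
    Real.rpow_sum_of_pos (by linarith)]
  refine (I.agm_le hw).trans (Finset.prod_le_prod (fun i _ => by positivity) fun i _ => ?_)
  exact Real.rpow_le_rpow (by positivity) (by exact_mod_cast I.card_le_IN i) (hw.1 i)

omit [DecidableEq V] in
theorem rpow_eq_one_of_IN_le_one (I : Inst q D) (h : I.IN ≤ 1) {x : ℝ} (hx : I.IN = 0 → x = 0) :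
    (I.IN : ℝ) ^ x = 1 := by
  rcases Nat.le_one_iff_eq_zero_or_eq_one.1 h with h₀ | h₁
  · rw [hx h₀, Real.rpow_zero]
  · rw [h₁, Nat.cast_one, Real.one_rpow]

theorem agm_le_rpow (I : Inst q D) {X : Finset V} {x : ℝ} (hx : I.IN = 0 → x = 0)
    (hlog : 1 < I.IN → Real.logb I.IN (I.agm X) ≤ x) : I.agm X ≤ (I.IN : ℝ) ^ x := by
  rcases Nat.lt_or_ge 1 I.IN with h | h
  · exact (Real.logb_le_iff_le_rpow (by exact_mod_cast h)
      (zero_lt_one.trans_le (I.one_le_agm X))).1 (hlog h)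
  · exact (I.agm_le_one h X).trans_eq (I.rpow_eq_one_of_IN_le_one h hx).symm

variable [Finite V]

theorem fhw_eq_zero_of_IN_eq_zero (I : Inst q D) (h : I.IN = 0) : I.fhw = 0 := by
  have : I.fhw = q.width fun X => Real.logb I.IN (I.agm X) := rfl
  simpa only [this, h, Nat.cast_zero, Real.logb_zero_left] using q.width_zero

theorem query_fhw_eq_zero_of_IN_eq_zero (I : Inst q D) (h : I.IN = 0) : q.fhw = 0 := by
  have : IsEmpty (Fin m) := ⟨fun i => by
    have := I.one_le_card i
    have := I.card_le_IN i
    simp_all⟩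
  exact q.fhw_eq_zero_of_isEmpty

theorem exists_reducedBags_agm_le_rpow_query_fhw (I : Inst q D) :
    ∃ B, q.ReducedBags B ∧ ∀ b ∈ B, I.agm b ≤ (I.IN : ℝ) ^ q.fhw := by
  obtain ⟨B, hB, hle⟩ := q.exists_reducedBags_le_width q.rhoStar
  exact ⟨B, hB, fun b hb => I.agm_le_rpow I.query_fhw_eq_zero_of_IN_eq_zero fun h =>
    (I.logb_agm_le_rhoStar h b).trans (hle b hb)⟩

theorem one_le_rpow_query_fhw (I : Inst q D) : 1 ≤ (I.IN : ℝ) ^ q.fhw := by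
  obtain ⟨B, hB, hle⟩ := I.exists_reducedBags_agm_le_rpow_query_fhw
  obtain ⟨b, hb⟩ := hB.nonempty
  exact (I.one_le_agm b).trans (hle b hb)

theorem IN_le_rpow_query_fhw (I : Inst q D) : (I.IN : ℝ) ≤ (m + 1) * (I.IN : ℝ) ^ q.fhw := by
  rcases isEmpty_or_nonempty V with hV | hV
  · have IN_le : I.IN ≤ m :=
      (Finset.sum_le_card_nsmul _ _ 1 fun i _ => Finset.card_le_one_of_subsingleton _).trans_eq
        (by simp)
    calc (I.IN : ℝ) ≤ (m + 1) * 1 := by exact_mod_cast IN_le.trans (by omega)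
      _ ≤ (m + 1) * (I.IN : ℝ) ^ q.fhw := by gcongr; exact I.one_le_rpow_query_fhw
  · refine le_trans ?_ (le_mul_of_one_le_left (by positivity) (by simp))
    rcases I.IN.eq_zero_or_pos with h | h
    · rw [h, Nat.cast_zero]
      positivity
    · exact Real.self_le_rpow_of_one_le (by exact_mod_cast h) q.one_le_fhw

theorem exists_reducedBags_agm_le_rpow_fhw (I : Inst q D) :
    ∃ B, q.ReducedBags B ∧ ∀ b ∈ B, I.agm b ≤ (I.IN : ℝ) ^ I.fhw := by
  obtain ⟨B, hB, hle⟩ := q.exists_reducedBags_le_width fun X => Real.logb I.IN (I.agm X)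
  exact ⟨B, hB, fun b hb => I.agm_le_rpow I.fhw_eq_zero_of_IN_eq_zero fun _ => hle b hb⟩

end Inst

end Widths

theorem mainTheorem10 {V : Type*} [Fintype V] [DecidableEq V] {m : ℕ} (q : Query V m) :
    -- DARTS, with any repertoire that includes all combinations of Split and Light transforms
    (∃ K₀ : ℕ, ∀ K ≥ K₀, ∃ (C : ℝ) (k : ℕ), ∀ rep : Set (Plan V), {p | p.SplitLight} ⊆ rep →
      ∀ (D : Type*) [DecidableEq D] (I : Inst q D),
        (runOut (dartsChoice q D K rep) I : Set (Tup V D)) = joinSet q I.rows ∧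
        (runSteps (dartsChoice q D K rep) I : ℝ) ≤
          C * Real.log (I.IN + 2) ^ k * ((I.IN : ℝ) ^ q.fhw + I.OUT) ∧
        (runSteps (dartsChoice q D K rep) I : ℝ) ≤
          C * Real.log (I.IN + 2) ^ k * (I.IN + (I.IN : ℝ) ^ I.fhw + I.OUT)) ∧
    -- repeated Split on ears
    (q.AlphaAcyclic →
      (∃ p : Plan V, p.EarPlan q.schemas) ∧
      ∀ p : Plan V, p.EarPlan q.schemas → ∃ (C : ℝ) (k : ℕ),
        ∀ (D : Type*) [DecidableEq D] (I : Inst q D),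
          (runOut (fun _ => p) I : Set (Tup V D)) = joinSet q I.rows ∧
          (runSteps (fun _ => p) I : ℝ) ≤
            C * Real.log (I.IN + 2) ^ k * (I.IN + I.OUT)) ∧
    -- a single Light transform
    (∃ (C : ℝ) (k : ℕ), ∀ (D : Type*) [DecidableEq D] (I : Inst q D),
      (∀ c ∈ I.liveConfigs, dbpBound (I.parts c) Finset.univ ≤ I.agm Finset.univ) ∧
      (runOut (fun _ => .light Finset.univ .done) I : Set (Tup V D)) = joinSet q I.rows ∧
      (runSteps (fun _ => .light Finset.univ .done) I : ℝ) ≤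
        C * Real.log (I.IN + 2) ^ k * (I.IN + I.agm Finset.univ)) := by
  refine ⟨?_, fun ⟨T, hT, hrun⟩ => ?_, ?_⟩
  · obtain ⟨K₀, hK₀⟩ := exists_dartsChoice_runSteps_le q
    refine ⟨K₀, fun K hK => ?_⟩
    obtain ⟨C, k, hsteps⟩ := hK₀ K hK
    refine ⟨C, k, fun rep hrep D _ I =>
      ⟨coe_runOut (fun c => (dartsChoice_spec hrep q D K c).1) I, ?_, ?_⟩⟩
    · obtain ⟨B, hB, hagm⟩ := I.exists_reducedBags_agm_le_rpow_query_fhw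
      exact hsteps rep hrep D I B _ hB I.IN_le_rpow_query_fhw hagm
    · obtain ⟨B, hB, hagm⟩ := I.exists_reducedBags_agm_le_rpow_fhw
      have IN_le : (I.IN : ℝ) ≤ I.IN + (I.IN : ℝ) ^ I.fhw := le_add_of_nonneg_right (by positivity)
      exact hsteps rep hrep D I B _ hB
        (IN_le.trans (le_mul_of_one_le_left (by positivity) (by simp)))
        fun b hb => (hagm b hb).trans (le_add_of_nonneg_left (by positivity))
  · have hacyclic : GYOAcyclic (q.schemas : Multiset (Finset V)) :=
      q.coe_schemas ▸ GYOAcyclic.of_isTree hT hrun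
    exact ⟨Plan.exists_earPlan hacyclic, fun p hp => exists_earPlan_runSteps_le hp⟩
  · obtain ⟨C, k, hrun⟩ := exists_light_univ_runSteps_le q
    exact ⟨C, k, fun D _ I => ⟨fun c hc =>
      Inst.dbpBound_parts_le_agm (Inst.mem_configs_of_mem_liveConfigs hc) _, hrun D I⟩⟩
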